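/- Let $R(x,y)=(x,-y)$, let $D\subset\mathbb{R}^2$ be a bounded open set with $R(D)=D$, and let $F=(F_1,F_2):D\to\mathbb{R}^2$ be of class $\mathcal{C}^2$. Put $F^-=F$, $F^+=-R\circ F\circ R$, and consider the $R$-reversible system that is given by $z'=F^+(z)$ for $y>0$ and by $z'=F^-(z)$ for $y<0$, with switching line $\Sigma=\{y=0\}$. Let $\Gamma(t,z)=(\Gamma_1,\Gamma_2)(t,z)$ be the flow of $F$ in $D$ and $Y(t,z)=D_z\Gamma(t,z)$. Assume: $(h_1)$ there are $x_i<x_v$ with $[x_i,x_v]\times\{0\}\subset D$, $F_2(x_i,0)=F_2(x_v,0)=0$, $\frac{\partial F_2}{\partial x}(x_v,0)F_1(x_v,0)<0$, $\frac{\partial F_2}{\partial x}(x_i,0)F_1(x_i,0)>0$, and $F_2(x,0)\ne0$ for $x_i<x<x_v$; $(h_2)$ for each $x\in(x_i,x_v]$ the solution $\Gamma(t,x,0)$ reaches $\Sigma$ for the first time at some $t=\overline\sigma(x)>0$, through the lower half plane and transversally: $\Gamma_2(t,x,0)<0$ for $0<t<\overline\sigma(x)$, $\Gamma_2(\overline\sigma(x),x,0)=0$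 and $F_2(\Gamma(\overline\sigma(x),x,0))\neq0$. Let $x_\sigma\in(x_i,x_v)$ with $\overline\sigma(x_\sigma)=\sigma$ and $\overline\sigma'(x_\sigma)\ne0$. Let $\varepsilon_0>0$ and let $G^\pm(t,z)$ and $H^\pm(t,z;\varepsilon)$ be smooth functions on $\mathbb{R}\times D$ and $\mathbb{R}\times D\times(-\varepsilon_0,\varepsilon_0)$ with values in $\mathbb{R}^2$, $2\sigma$-periodic in $t$. Consider the piecewise smooth system $$z'=X_\varepsilon^{\pm}(t,z)=F^\pm(z)+\varepsilon G^\pm(t,z)+\varepsilon^2H^\pm(t,z;\varepsilon)\quad\text{for } \pm y>0,\qquad(\ast)$$ whose solutions are understood in Filippov's sense. For $\theta\in\mathbb{R}/2\sigma\mathbb{Z}$ and $x\in(x_i,x_v]$ let $$M(\theta,x)=F\big(\Gamma(\overline\sigma(x),x,0)\big)\wedge\Big(Y(\overline\sigma(x),x,0)\int_0^{\overline\sigma(x)}Y(t,x,0)^{-1}\big[G^-(t+\theta,\Gamma(t,x,0))+R\,G^+(-t+\theta,R\,\Gamma(t,x,0))\big]dt\Big),$$ where $(a_1,a_2)\wedge(b_1,b_2)=a_1b_2-a_2b_1$.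 If $\theta^*$ satisfies $M(\theta^*,x_\sigma)=0$ and $\frac{\partial M}{\partial\theta}(\theta^*,x_\sigma)\neq0$, then there are $C>0$ and $\varepsilon_1\in(0,\varepsilon_0]$ such that for every $\varepsilon\in(0,\varepsilon_1)$ there are $\theta_\varepsilon,x_\varepsilon$ with $|\theta_\varepsilon-\theta^*|\le C\varepsilon$, $|x_\varepsilon-x_\sigma|\le C\varepsilon$ and a $2\sigma$-periodic solution $w$ of $(\ast)$ in $D$ with $w(\theta_\varepsilon)=(x_\varepsilon,0)$ which is crossing (it meets $\Sigma$ only at points where the second components of $X^+_\varepsilon$ and $X^-_\varepsilon$ have the same strict sign) and isolated (for some $\delta>0$, every $2\sigma$-periodic solution $u$ of $(\ast)$ in $D$ with $|u(t)-w(t)|<\delta$ for some $t$ equals $w$). -/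

import Mathlib

open Set MeasureTheory
open scoped ContDiff

noncomputable section

namespace TwoFold

/-- The phase plane, with coordinates `z = (x, y) = (z.1, z.2)`. The switching line is `z.2 = 0`. -/
abbrev Plane : Type := ℝ × ℝ

/-- The involution `R (x, y) = (x, -y)`. -/
def R (z : Plane) : Plane := (z.1, -z.2)

/-- The wedge product `(a₁, a₂) ∧ (b₁, b₂) = ⟨(-a₂, a₁), (b₁, b₂)⟩`. -/
def wedge (a b : Plane) : ℝ := -a.2 * b.1 + a.1 * b.2

/-- The upper vector field `F⁺ = - R ∘ F ∘ R` of the `R`-reversible system whose lower vector field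
is `F⁻ = F`. -/
def upperField (F : Plane → Plane) (z : Plane) : Plane := -R (F (R z))

/-- `c` is a solution of `z' = F z` in `D` with `c 0 = z` on the closed interval between
`0` and `T`. -/
def IsSolutionCurve (F : Plane → Plane) (D : Set Plane) (z : Plane) (T : ℝ) (c : ℝ → Plane) :
    Prop :=
  c 0 = z ∧ ∀ t ∈ uIcc 0 T, c t ∈ D ∧ HasDerivWithinAt c (F (c t)) (uIcc 0 T) t

/-- The solution of `z' = F z`, `z(0) = z`, in `D` exists from time `0` up to time `T`. -/
def SolutionExists (F : Plane → Plane) (D : Set Plane) (z : Plane) (T : ℝ) : Prop :=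
  ∃ c : ℝ → Plane, IsSolutionCurve F D z T c

open Classical in
/-- The flow `Γ(t, z)` of `z' = F z` in `D` (for a `C¹` field on an open set the solution curve
is unique); the value is `z` where the solution does not exist up to time `t`. -/
def flow (F : Plane → Plane) (D : Set Plane) (t : ℝ) (z : Plane) : Plane :=
  if h : SolutionExists F D z t then h.choose t else z

/-- The derivative `Y(t, z) = D_z Γ(t, z)` of the flow with respect to the initial condition. -/
def Y (F : Plane → Plane) (D : Set Plane) (t : ℝ) (z : Plane) : Plane →L[ℝ] Plane :=
  fderiv ℝ (fun w => flow F D t w) z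

/-- The half-return time `σ̄(x)`: the first positive time at which the solution of `z' = F z`
starting at `(x, 0)` is on the switching line. -/
def halfReturnTime (F : Plane → Plane) (D : Set Plane) (x : ℝ) : ℝ :=
  sInf {t : ℝ | 0 < t ∧ SolutionExists F D (x, 0) t ∧ (flow F D t (x, 0)).2 = 0}

/-- The fold condition: `(x_v, 0)` is a visible and `(x_i, 0)` an invisible fold, and there is no
tangency on the open segment between them. -/
structure FoldCondition (F : Plane → Plane) (D : Set Plane) (xi xv : ℝ) : Prop where
  lt : xi < xv
  mem : ∀ x ∈ Icc xi xv, ((x, 0) : Plane) ∈ D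
  tangent_v : (F (xv, 0)).2 = 0
  tangent_i : (F (xi, 0)).2 = 0
  visible : deriv (fun x : ℝ => (F (x, 0)).2) xv * (F (xv, 0)).1 < 0
  invisible : 0 < deriv (fun x : ℝ => (F (x, 0)).2) xi * (F (xi, 0)).1
  ne_zero : ∀ x ∈ Ioo xi xv, (F (x, 0)).2 ≠ 0

/-- The return condition: for each `x_i < x ≤ x_v` the solution of `z' = F z` starting at `(x, 0)`
runs through the lower half plane and reaches the switching line, transversely, at the
time `σ̄(x) > 0`. -/
structure ReturnCondition (F : Plane → Plane) (D : Set Plane) (xi xv : ℝ) : Prop where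
  pos : ∀ x ∈ Ioc xi xv, 0 < halfReturnTime F D x
  exists_solution : ∀ x ∈ Ioc xi xv, SolutionExists F D (x, 0) (halfReturnTime F D x)
  below : ∀ x ∈ Ioc xi xv, ∀ t ∈ Ioo 0 (halfReturnTime F D x), (flow F D t (x, 0)).2 < 0
  hits : ∀ x ∈ Ioc xi xv, (flow F D (halfReturnTime F D x) (x, 0)).2 = 0
  transverse : ∀ x ∈ Ioc xi xv, (F (flow F D (halfReturnTime F D x) (x, 0))).2 ≠ 0

/-- The periodic orbit `γ(·, x)` of the unperturbed system through `(x, 0)`, parametrised by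
`t ∈ [-σ̄(x), σ̄(x)]`. -/
def orbit (F : Plane → Plane) (D : Set Plane) (t x : ℝ) : Plane :=
  if 0 ≤ t then flow F D t (x, 0) else R (flow F D (-t) (x, 0))

/-- The defect of reversibility `G⁻(t + θ, z) + R G⁺(-t + θ, R z)`. -/
def reversibilityDefect (Gp Gm : ℝ → Plane → Plane) (θ t : ℝ) (z : Plane) : Plane :=
  Gm (t + θ) z + R (Gp (-t + θ) (R z))

/-- The Melnikov function `M(θ, x)`. -/
def melnikov (F : Plane → Plane) (D : Set Plane) (Gp Gm : ℝ → Plane → Plane) (θ x : ℝ) : ℝ :=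
  wedge (F (orbit F D (halfReturnTime F D x) x))
    (Y F D (halfReturnTime F D x) (x, 0)
      (∫ t in (0 : ℝ)..halfReturnTime F D x,
        (Y F D t (x, 0)).inverse (reversibilityDefect Gp Gm θ t (orbit F D t x))))

/-- The perturbed field `F(z) + ε G(t, z) + ε² H(t, z; ε)`. -/
def perturbedField (F : Plane → Plane) (G : ℝ → Plane → Plane) (H : ℝ → Plane → ℝ → Plane)
    (ε t : ℝ) (z : Plane) : Plane :=
  F z + ε • G t z + ε ^ 2 • H t z ε

/-- The set-valued right-hand side, in Filippov's sense, of the piecewise smooth system given by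
`Xp` for `y > 0` and by `Xm` for `y < 0`: on `y = 0` it is the segment between the two values. -/
def filippovSet (Xp Xm : ℝ → Plane → Plane) (t : ℝ) (z : Plane) : Set Plane :=
  {v | (0 < z.2 ∧ v = Xp t z) ∨ (z.2 < 0 ∧ v = Xm t z) ∨
    (z.2 = 0 ∧ v ∈ segment ℝ (Xp t z) (Xm t z))}

/-- `w` is a `T`-periodic solution in `D`, in Filippov's sense, of the piecewise smooth
system `(Xp, Xm)`: it is the integral of a locally integrable function (that is, `w` is locally
absolutely continuous) and its velocity is almost everywhere in the Filippov set. -/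
structure IsPeriodicSolution (Xp Xm : ℝ → Plane → Plane) (D : Set Plane) (T : ℝ)
    (w : ℝ → Plane) : Prop where
  mem : ∀ t, w t ∈ D
  periodic : ∀ t, w (t + T) = w t
  inclusion : ∃ v : ℝ → Plane, (∀ a b : ℝ, IntervalIntegrable v volume a b) ∧
    (∀ a b : ℝ, w b - w a = ∫ t in a..b, v t) ∧
    ∀ᵐ t : ℝ, v t ∈ filippovSet Xp Xm t (w t)

/-- The solution `w` meets the switching line only in the crossing region, that is, where the
normal components of both fields have the same strict sign. -/
def IsCrossing (Xp Xm : ℝ → Plane → Plane) (w : ℝ → Plane) : Prop :=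
  ∀ t, (w t).2 = 0 → 0 < (Xp t (w t)).2 * (Xm t (w t)).2

/-- The `T`-periodic solution `w` is isolated: some neighbourhood of its graph is not met by the
graph of any other `T`-periodic solution (crossing or not). -/
def IsIsolated (Xp Xm : ℝ → Plane → Plane) (D : Set Plane) (T : ℝ) (w : ℝ → Plane) : Prop :=
  ∃ δ > 0, ∀ u : ℝ → Plane, IsPeriodicSolution Xp Xm D T u →
    (∃ t, dist (u t) (w t) < δ) → u = w

end TwoFold

end

open TwoFold

/-!
Reversing time and reflecting by `R` turns the upper half of a crossing orbit into a lower arc, so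
that both halves become perturbations of the same orbit of `F`, issued from the same point of `Σ` at
the same time. As functions of `(ε, θ, x)` they have return times `τ₊`, `τ₋` and exit points, and
the two halves close up to a `2σ`-periodic orbit exactly when `τ₊ + τ₋ = 2σ` and the difference `P`
of the exit points vanishes. By reversibility `P` vanishes identically at `ε = 0`, so it is divided
by `ε`; the quotient at `ε = 0` is `M (θ, x)` up to a nonvanishing factor, while there
`τ₊ + τ₋ = 2 σ̄ (x)`. Hence the simple zero of `M` and `σ̄' ≠ 0` make the Jacobian in `(θ, x)`
invertible, and the implicit function theorem gives a unique branch of closed orbits.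

For isolation, a Filippov solution close to the orbit at one time stays close to it over a whole
period, since deviations grow at most by a constant factor even through a crossing. So it crosses
`Σ` near the same two times and nowhere else. It is then itself the closed orbit of a parameter near
the branch, and uniqueness of the branch identifies it.
-/

noncomputable section

namespace TwoFold

open Filter Topology
open scoped NNReal

/-! ### Smooth dependence of solutions of differential equations -/

section Superposition

universe u

variable {X : Type*} [TopologicalSpace X] [CompactSpace X]

/-- The bilinear map `(A, h) ↦ (x ↦ A x (h x))` on continuous functions. -/
def pointwiseApply (X E G : Type*) [TopologicalSpace X] [CompactSpace X]
    [NormedAddCommGroup E] [NormedSpace ℝ E] [NormedAddCommGroup G] [NormedSpace ℝ G] :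
    C(X, E →L[ℝ] G) →L[ℝ] C(X, E) →L[ℝ] C(X, G) :=
  LinearMap.mkContinuous₂
    (LinearMap.mk₂ ℝ (fun (A : C(X, E →L[ℝ] G)) (h : C(X, E)) =>
        (⟨fun x => A x (h x), by fun_prop⟩ : C(X, G)))
      (fun _ _ _ => by ext; simp) (fun _ _ _ => by ext; simp)
      (fun _ _ _ => by ext; simp) (fun _ _ _ => by ext; simp)) 1
    (fun A h => by
      rw [ContinuousMap.norm_le _ (by positivity)]
      intro x
      simp only [LinearMap.mk₂_apply, ContinuousMap.coe_mk, one_mul]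
      exact (A x).le_of_opNorm_le_of_le (A.norm_coe_le_norm x) (h.norm_coe_le_norm x))

variable {E G : Type u} [NormedAddCommGroup E] [NormedSpace ℝ E]
  [NormedAddCommGroup G] [NormedSpace ℝ G]

lemma hasFDerivAt_superposition {f : C(E, G)} {f' : C(E, E →L[ℝ] G)}
    (hf : ∀ x, HasFDerivAt f (f' x) x) (u : C(X, E)) :
    HasFDerivAt (fun v : C(X, E) => f.comp v) (pointwiseApply X E G (f'.comp u)) u := by
  rw [hasFDerivAt_iff_isLittleO, Asymptotics.isLittleO_iff]
  intro c hc
  obtain ⟨δ, hδ, hf'⟩ := Metric.mem_uniformity_dist.1 <|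
    (isCompact_range u.continuous).uniformContinuousAt_of_continuousAt f'
      (fun a _ => f'.continuous.continuousAt) (Metric.dist_mem_uniformity hc)
  filter_upwards [Metric.ball_mem_nhds u hδ] with v hv
  refine (ContinuousMap.norm_le _ (by positivity)).2 fun x => ?_
  have hvx : v x ∈ Metric.ball (u x) δ := (ContinuousMap.dist_apply_le_dist x).trans_lt hv
  refine ((convex_ball (u x) δ).norm_image_sub_le_of_norm_hasFDerivWithin_le'
    (φ := f' (u x)) (C := c) (fun y _ => (hf y).hasFDerivWithinAt) (fun y hy => ?_)
    (Metric.mem_ball_self hδ) hvx).trans ?_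
  · rw [← dist_eq_norm, dist_comm]
    exact (hf' (Metric.mem_ball'.1 hy) (mem_range_self x)).le
  · gcongr
    exact (v - u).norm_coe_le_norm x

lemma contDiff_superposition (n : ℕ) : ∀ {G : Type u} [NormedAddCommGroup G] [NormedSpace ℝ G]
    {f : C(E, G)}, ContDiff ℝ n f → ContDiff ℝ n (fun v : C(X, E) => f.comp v) := by
  induction n with
  | zero => exact fun _ => contDiff_zero.2 (ContinuousMap.continuous_postcomp _)
  | succ n ih =>
    intro G _ _ f hf
    obtain ⟨hdiff, -, hderiv⟩ := (contDiff_succ_iff_fderiv (n := (n : WithTop ℕ∞))).1 hf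
    have hsup : ∀ u : C(X, E), HasFDerivAt (fun v : C(X, E) => f.comp v) (pointwiseApply X E G
        ((⟨fderiv ℝ f, hderiv.continuous⟩ : C(E, E →L[ℝ] G)).comp u)) u :=
      hasFDerivAt_superposition fun x => (hdiff x).hasFDerivAt
    refine (contDiff_succ_iff_fderiv (n := (n : WithTop ℕ∞))).2
      ⟨fun u => (hsup u).differentiableAt, by simp, ?_⟩
    rw [funext fun u => (hsup u).fderiv]
    exact (pointwiseApply X E G).contDiff.comp (ih (f := ⟨fderiv ℝ f, hderiv.continuous⟩) hderiv)

end Superposition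

section Volterra

open scoped unitInterval

/-- Integration from `0`, as an operator on continuous functions on the unit interval. -/
def volterra (E : Type*) [NormedAddCommGroup E] [NormedSpace ℝ E] : C(I, E) →L[ℝ] C(I, E) :=
  LinearMap.mkContinuous
    { toFun := fun w => ⟨fun s : I => ∫ r in (0 : ℝ)..s, IccExtend zero_le_one w r,
        (intervalIntegral.continuous_primitive (fun a b =>
          (w.continuous.Icc_extend' (h := zero_le_one)).intervalIntegrable a b) 0).comp
          continuous_subtype_val⟩
      map_add' := fun w w' => ContinuousMap.ext fun s => intervalIntegral.integral_add
        ((w.continuous.Icc_extend' (h := zero_le_one)).intervalIntegrable _ _)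
        ((w'.continuous.Icc_extend' (h := zero_le_one)).intervalIntegrable _ _)
      map_smul' := fun c _ => ContinuousMap.ext fun _ => intervalIntegral.integral_smul c _ } 1
    (fun w => by
      refine (ContinuousMap.norm_le _ (by positivity)).2 fun s => ?_
      refine (intervalIntegral.norm_integral_le_of_norm_le_const (C := ‖w‖)
        (fun x _ => w.norm_coe_le_norm _)).trans ?_
      rw [sub_zero, abs_of_nonneg s.2.1, one_mul]
      exact mul_le_of_le_one_right (norm_nonneg _) s.2.2)

variable {E : Type*} [NormedAddCommGroup E] [NormedSpace ℝ E]

lemma norm_volterra_le : ‖volterra E‖ ≤ 1 := LinearMap.mkContinuous_norm_le _ zero_le_one _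

end Volterra

section Flow

variable {E : Type*} [NormedAddCommGroup E] [NormedSpace ℝ E] {f : E → E} {φ : ℝ → E → E} {K : ℝ≥0}

/-- `φ t z` is the global flow of the autonomous vector field `f`. -/
structure IsGlobalFlow (f : E → E) (φ : ℝ → E → E) : Prop where
  zero : ∀ z, φ 0 z = z
  isIntegralCurve : ∀ z, IsIntegralCurve (fun t => φ t z) fun _ => f

lemma IsGlobalFlow.eq_of_isIntegralCurve (h : IsGlobalFlow f φ) (hK : LipschitzWith K f)
    {c : ℝ → E} (hc : IsIntegralCurve c fun _ => f) (t : ℝ) : c t = φ t (c 0) :=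
  congrFun (ODE_solution_unique_univ (v := fun _ => f) (s := fun _ => univ) (K := K) (t₀ := 0)
    (fun _ => hK.lipschitzOnWith) (fun t => ⟨hc t, mem_univ _⟩)
    (fun t => ⟨h.isIntegralCurve (c 0) t, mem_univ _⟩) (h.zero _).symm) t

lemma IsGlobalFlow.add (h : IsGlobalFlow f φ) (hK : LipschitzWith K f) (s t : ℝ) (z : E) :
    φ (t + s) z = φ t (φ s z) := by
  simpa using h.eq_of_isIntegralCurve hK ((h.isIntegralCurve z).comp_add s) t

section Existence

variable [CompleteSpace E]

open scoped Manifold in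
lemma exists_isIntegralCurve (hf : ContDiff ℝ 1 f) (hK : LipschitzWith K f) {L : ℝ≥0}
    (hL : ∀ z, ‖f z‖ ≤ L) (z : E) : ∃ c : ℝ → E, c 0 = z ∧ IsIntegralCurve c fun _ => f := by
  have hlocal : ∀ a : ℝ, ∃ c : ℝ → E, c 0 = z ∧
      IsMIntegralCurveOn (I := 𝓘(ℝ, E)) c f (Ioo (-a) a) := by
    intro a
    rcases le_or_gt a 0 with ha | ha
    · exact ⟨fun _ => z, rfl, by simp [Ioo_eq_empty (by linarith : ¬ -a < a), IsMIntegralCurveOn]⟩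
    have hpl : IsPicardLindelof (fun _ => f) (⟨0, by constructor <;> linarith⟩ : Icc (-a) a) z
        (L * a.toNNReal) 0 L K :=
      ⟨fun _ _ => hK.lipschitzOnWith, fun _ _ => continuousOn_const, fun _ _ x _ => hL x,
        by simp [ha.le]⟩
    obtain ⟨c, hc0, hc⟩ := hpl.exists_eq_forall_mem_Icc_hasDerivWithinAt₀
    exact ⟨c, hc0, fun t ht => ((hc t (Ioo_subset_Icc_self ht)).mono
      Ioo_subset_Icc_self).hasFDerivWithinAt.hasMFDerivWithinAt⟩
  obtain ⟨c, hc0, hc⟩ := (exists_isMIntegralCurve_iff_exists_isMIntegralCurveOn_Ioo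
    (contMDiff_vectorSpace_iff_contDiff.2 hf) z).2 hlocal
  exact ⟨c, hc0, fun t =>
    hasDerivAt_iff_hasFDerivAt.2 (hasMFDerivAt_iff_hasFDerivAt.1 (hc t))⟩

lemma exists_isGlobalFlow (hf : ContDiff ℝ 1 f) (hK : LipschitzWith K f) {L : ℝ≥0}
    (hL : ∀ z, ‖f z‖ ≤ L) : ∃ φ : ℝ → E → E, IsGlobalFlow f φ := by
  choose c h0 h using exists_isIntegralCurve hf hK hL
  exact ⟨fun t z => c z t, h0, h⟩

end Existence

section FlowEquation

open scoped unitInterval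

universe u

variable {E : Type u} [NormedAddCommGroup E] [NormedSpace ℝ E] {f : C(E, E)} {φ : ℝ → E → E}
  {K : ℝ≥0} {T : ℝ} {z : E} {u : C(I, E)}

/-- The integral equation `u - z - T ∫₀ f ∘ u = 0` for the solution of `z' = f z` starting at `z`,
with the time interval from `0` to `T` rescaled to `[0, 1]`. -/
def flowEquation (f : C(E, E)) (q : (ℝ × E) × C(I, E)) : C(I, E) :=
  q.2 - ContinuousLinearMap.const ℝ I q.1.2 - q.1.1 • volterra E (f.comp q.2)

lemma contDiff_flowEquation {n : ℕ} (hf : ContDiff ℝ n f) : ContDiff ℝ n (flowEquation f) :=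
  (contDiff_snd.sub ((ContinuousLinearMap.const ℝ I).contDiff.comp
    (contDiff_snd.comp contDiff_fst))).sub ((contDiff_fst.comp contDiff_fst).smul
      ((volterra E).contDiff.comp ((contDiff_superposition n hf).comp contDiff_snd)))

lemma hasFDerivAt_flowEquation {f' : C(E, E →L[ℝ] E)} (hf : ∀ x, HasFDerivAt f (f' x) x)
    (p : ℝ × E) (u : C(I, E)) :
    HasFDerivAt (fun v => flowEquation f (p, v))
      (1 - p.1 • (volterra E ∘L pointwiseApply I E E (f'.comp u))) u :=
  ((hasFDerivAt_id (𝕜 := ℝ) u).sub_const (ContinuousLinearMap.const ℝ I p.2)).sub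
    (((volterra E).hasFDerivAt.comp u (hasFDerivAt_superposition hf u)).const_smul p.1)

lemma norm_pointwiseApply_le {X : Type*} [TopologicalSpace X] [CompactSpace X]
    {A : C(X, E →L[ℝ] E)} (hA : ∀ x, ‖A x‖ ≤ K) : ‖pointwiseApply X E E A‖ ≤ K :=
  ContinuousLinearMap.opNorm_le_bound _ K.2 fun v => (ContinuousMap.norm_le _ (by positivity)).2
    fun x => (A x).le_of_opNorm_le_of_le (hA x) (v.norm_coe_le_norm x)

lemma isInvertible_one_sub_smul_volterra [CompleteSpace E] {A : C(I, E) →L[ℝ] C(I, E)}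
    (hA : ‖A‖ ≤ K) (hT : |T| * K < 1) : (1 - T • (volterra E ∘L A)).IsInvertible := by
  have hlt : ‖T • (volterra E ∘L A)‖ < 1 :=
    calc ‖T • (volterra E ∘L A)‖ ≤ ‖T‖ * (‖volterra E‖ * ‖A‖) :=
          (ContinuousLinearMap.opNorm_smul_le T _).trans
            (by gcongr; exact ContinuousLinearMap.opNorm_comp_le _ _)
      _ ≤ ‖T‖ * (1 * K) := by gcongr; exact norm_volterra_le
      _ < 1 := by simpa using hT
  exact ⟨ContinuousLinearEquiv.unitsEquiv ℝ C(I, E)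
    (Units.oneSub (T • (volterra E ∘L A)) hlt), rfl⟩

section

variable [CompleteSpace E]

lemma IsGlobalFlow.flowEquation_eq_zero (h : IsGlobalFlow f φ) (hu : ∀ s : I, u s = φ (s * T) z) :
    flowEquation f ((T, z), u) = 0 := by
  have hcurve := (h.isIntegralCurve z).comp_mul T
  have hcont : Continuous fun r => φ (r * T) z :=
    continuous_iff_continuousAt.2 fun r => (hcurve r).continuousAt
  ext s
  have hint := intervalIntegral.integral_eq_sub_of_hasDerivAt (a := 0) (b := (s : ℝ))
    (fun r _ => hcurve r)
    ((continuous_const.smul (f.continuous.comp hcont)).intervalIntegrable _ _)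
  have hvolterra : volterra E (f.comp u) s = ∫ r in (0 : ℝ)..s, f (φ (r * T) z) := by
    refine intervalIntegral.integral_congr fun r hr => ?_
    rw [uIcc_of_le s.2.1] at hr
    have hr' : r ∈ Icc (0 : ℝ) 1 := ⟨hr.1, hr.2.trans s.2.2⟩
    simp only [IccExtend_of_mem _ _ hr', ContinuousMap.comp_apply, hu]
  simp only [Function.comp_apply, Pi.smul_apply, intervalIntegral.integral_smul, zero_mul,
    h.zero] at hint
  simp [flowEquation, hvolterra, hint, hu]

lemma IsGlobalFlow.eq_of_flowEquation_eq_zero (h : IsGlobalFlow f φ) (hK : LipschitzWith K f)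
    (h0 : flowEquation f ((T, z), u) = 0) (s : I) : u s = φ (s * T) z := by
  set W : ℝ → E := fun s => z + T • ∫ r in (0 : ℝ)..s, f (IccExtend zero_le_one u r) with hW
  have hWu : ∀ s : I, W s = u s := by
    intro s
    have := congrArg (fun g : C(I, E) => g s) h0
    simp only [flowEquation, ContinuousMap.sub_apply, ContinuousMap.zero_apply, sub_sub,
      sub_eq_zero] at this
    exact this.symm
  have hWd : ∀ s, HasDerivAt W (T • f (IccExtend zero_le_one u s)) s := by
    intro s
    have hc : Continuous fun r => f (IccExtend zero_le_one u r) :=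
      f.continuous.comp u.continuous.Icc_extend'
    exact ((intervalIntegral.integral_hasDerivAt_right (hc.intervalIntegrable _ _)
      hc.aestronglyMeasurable.stronglyMeasurableAtFilter hc.continuousAt).const_smul T).const_add _
  have hcurve := (h.isIntegralCurve z).comp_mul T
  have huniq : EqOn W (fun s => φ (s * T) z) (Icc 0 1) := by
    refine ODE_solution_unique (v := fun _ y => T • f y) (K := ‖T‖₊ * K)
      (fun _ => (lipschitzWith_smul T).comp hK)
      (fun s _ => (hWd s).continuousAt.continuousWithinAt) (fun s hs => ?_)
      (fun s _ => (hcurve s).continuousAt.continuousWithinAt)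
      (fun s _ => (hcurve s).hasDerivWithinAt) (by simp [hW, h.zero])
    have := (hWd s).hasDerivWithinAt (s := Ici s)
    rwa [IccExtend_of_mem _ _ (Ico_subset_Icc_self hs), ← hWu ⟨s, Ico_subset_Icc_self hs⟩] at this
  exact (hWu s).symm.trans (huniq s.2)

lemma IsGlobalFlow.contDiffAt_of_small (h : IsGlobalFlow f φ) (hK : LipschitzWith K f) {n : ℕ}
    (hn : n ≠ 0) (hf : ContDiff ℝ n f) (z : E) (hT : |T| * K < 1) :
    ContDiffAt ℝ n (fun p : ℝ × E => φ p.1 p.2) (T, z) := by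
  have hn0 : (n : WithTop ℕ∞) ≠ 0 := by exact_mod_cast hn
  have hcont : Continuous fun t => φ t z :=
    continuous_iff_continuousAt.2 fun t => (h.isIntegralCurve z t).continuousAt
  let u₀ : C(I, E) := ⟨fun s => φ (s * T) z, by fun_prop⟩
  have hzero : flowEquation f ((T, z), u₀) = 0 := h.flowEquation_eq_zero fun _ => rfl
  have hcd : ContDiffAt ℝ n (flowEquation f) ((T, z), u₀) := (contDiff_flowEquation hf).contDiffAt
  have hinv : (fderiv ℝ (flowEquation f) ((T, z), u₀) ∘L
      ContinuousLinearMap.inr ℝ (ℝ × E) C(I, E)).IsInvertible := by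
    have hpartial := hasFDerivAt_flowEquation
      (f' := ⟨fderiv ℝ f, hf.continuous_fderiv hn0⟩)
      (fun x => (hf.differentiable hn0 x).hasFDerivAt) (T, z) u₀
    rw [((hcd.differentiableAt hn0).hasFDerivAt.comp (f := fun v => ((T, z), v)) u₀
      (hasFDerivAt_prodMk_right (T, z) u₀)).unique hpartial]
    exact isInvertible_one_sub_smul_volterra
      (norm_pointwiseApply_le fun x => norm_fderiv_le_of_lipschitz ℝ hK) hT
  refine ((ContinuousMap.evalCLM ℝ (1 : I)).contDiff.contDiffAt.comp (T, z)
    (hcd.contDiffAt_implicitFunction hn0 hinv)).congr_of_eventuallyEq ?_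
  filter_upwards [hcd.eventually_apply_implicitFunction hn0 hinv] with p hp
  rw [hzero] at hp
  simpa using (h.eq_of_flowEquation_eq_zero hK hp 1).symm

theorem IsGlobalFlow.contDiff (h : IsGlobalFlow f φ) (hK : LipschitzWith K f) {n : ℕ}
    (hn : n ≠ 0) (hf : ContDiff ℝ n f) : ContDiff ℝ n (fun p : ℝ × E => φ p.1 p.2) := by
  have key : ∀ k : ℕ, ∀ p : ℝ × E, |p.1| * K < 2 ^ k →
      ContDiffAt ℝ n (fun p : ℝ × E => φ p.1 p.2) p := by
    intro k
    induction k with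
    | zero => exact fun p hp => h.contDiffAt_of_small hK hn hf p.2 (by simpa using hp)
    | succ k ih =>
      intro p hp
      have hdouble : (fun p : ℝ × E => φ p.1 p.2) =
          (fun p : ℝ × E => φ p.1 p.2) ∘ fun p => (p.1 / 2, φ (p.1 / 2) p.2) := by
        funext q
        simp only [Function.comp_apply, ← h.add hK, add_halves]
      have hhalf : |p.1 / 2| * K < 2 ^ k := by
        rw [abs_div, abs_two]
        rw [pow_succ] at hp
        linarith
      have hd : ContDiffAt ℝ n (fun p : ℝ × E => p.1 / 2) p := contDiffAt_fst.div_const 2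
      rw [hdouble]
      exact ContDiffAt.comp p (ih _ hhalf) (hd.prodMk (ContDiffAt.comp
        (f := fun p : ℝ × E => (p.1 / 2, p.2)) p (ih (p.1 / 2, p.2) hhalf)
        (hd.prodMk contDiffAt_snd)))
  rw [contDiff_iff_contDiffAt]
  intro p
  obtain ⟨k, hk⟩ := pow_unbounded_of_one_lt (|p.1| * (K : ℝ)) one_lt_two
  exact key k p hk

end

end FlowEquation

end Flow

section MixedPartials

variable {E G : Type*} [NormedAddCommGroup E] [NormedSpace ℝ E] [NormedAddCommGroup G]
  [NormedSpace ℝ G]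

theorem hasDerivAt_fderiv_of_hasDerivAt {ζ Θ : ℝ → E → G}
    (hζ : ContDiff ℝ 2 (fun p : ℝ × E => ζ p.1 p.2)) {s : ℝ} {e : E}
    (hΘ : ∀ᶠ p : ℝ × E in 𝓝 (s, e), HasDerivAt (fun s => ζ s p.2) (Θ p.1 p.2) p.1) :
    HasDerivAt (fun s => fderiv ℝ (ζ s) e) (fderiv ℝ (Θ s) e) s := by
  set Φ := fun p : ℝ × E => ζ p.1 p.2
  have hΦd : Differentiable ℝ Φ := hζ.differentiable two_ne_zero
  have hD : HasFDerivAt (fderiv ℝ Φ) (fderiv ℝ (fderiv ℝ Φ) (s, e)) (s, e) :=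
    ((hζ.fderiv_right (m := 1) (by norm_num)).differentiable one_ne_zero _).hasFDerivAt
  have hspace : ∀ t, fderiv ℝ (ζ t) e = fderiv ℝ Φ (t, e) ∘L .inr ℝ ℝ E := fun t =>
    HasFDerivAt.fderiv (f := ζ t) ((hΦd (t, e)).hasFDerivAt.comp e (hasFDerivAt_prodMk_right t e))
  have htime : ∀ᶠ p : ℝ × E in 𝓝 (s, e), Θ p.1 p.2 = fderiv ℝ Φ p (1, 0) := hΘ.mono fun p hp =>
    hp.unique <| (hΦd p).hasFDerivAt.comp_hasDerivAt (f := fun s => (s, p.2)) p.1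
      ((hasDerivAt_id p.1).prodMk (hasDerivAt_const p.1 p.2))
  have hleft : HasDerivAt (fun t => fderiv ℝ Φ (t, e) ∘L .inr ℝ ℝ E)
      (fderiv ℝ (fderiv ℝ Φ) (s, e) (1, 0) ∘L .inr ℝ ℝ E) s := by
    simpa using (hD.comp_hasDerivAt (f := fun t : ℝ => (t, e)) s
      ((hasDerivAt_id s).prodMk (hasDerivAt_const s e))).clm_comp (hasDerivAt_const s _)
  have hright : HasFDerivAt (Θ s) (((ContinuousLinearMap.apply ℝ G ((1 : ℝ), (0 : E))) ∘L
      fderiv ℝ (fderiv ℝ Φ) (s, e)) ∘L ContinuousLinearMap.inr ℝ ℝ E) e :=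
    HasFDerivAt.comp (g := fun p : ℝ × E => Θ p.1 p.2) e
      (((ContinuousLinearMap.apply ℝ G ((1 : ℝ), (0 : E))).hasFDerivAt.comp (s, e)
        hD).congr_of_eventuallyEq htime) (hasFDerivAt_prodMk_right s e)
  simp_rw [hspace, hright.fderiv]
  convert hleft using 1
  ext v
  exact ((hζ.contDiffAt (x := (s, e))).isSymmSndFDerivAt (by simp)).eq _ _

end MixedPartials

section Cutoff

variable {E G : Type*} [NormedAddCommGroup E] [NormedSpace ℝ E] [FiniteDimensional ℝ E]
  [NormedAddCommGroup G] [NormedSpace ℝ G]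

open scoped Manifold in
lemma exists_contDiff_hasCompactSupport_eqOn {n : ℕ} {f : E → G} {U K : Set E} (hU : IsOpen U)
    (hf : ContDiffOn ℝ n f U) (hK : IsCompact K) (hKU : K ⊆ U) :
    ∃ g : E → G, ContDiff ℝ n g ∧ HasCompactSupport g ∧
      ∃ N, IsOpen N ∧ K ⊆ N ∧ N ⊆ U ∧ EqOn g f N := by
  obtain ⟨L, hL, hKL, hLU⟩ := exists_compact_between hK hU hKU
  obtain ⟨χ, hχ1, hχ0, -⟩ := exists_contMDiffMap_one_nhds_of_subset_interior (n := n) 𝓘(ℝ, E)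
    hK.isClosed hKL
  have hsupp : ∀ x ∉ L, χ x • f x = 0 := fun x hx => by rw [hχ0 x hx, zero_smul]
  refine ⟨fun x => χ x • f x, contDiff_iff_contDiffAt.2 fun x => ?_,
    HasCompactSupport.intro hL hsupp, ?_⟩
  · by_cases hx : x ∈ L
    · exact χ.contMDiff.contDiff.contDiffAt.smul (hf.contDiffAt (hU.mem_nhds (hLU hx)))
    · refine (contDiffAt_const (c := (0 : G))).congr_of_eventuallyEq ?_
      filter_upwards [hL.isClosed.isOpen_compl.mem_nhds hx] with y hy using hsupp y hy
  · obtain ⟨N, hN, hKN, hN1⟩ := mem_nhdsSet_iff_exists.1 hχ1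
    refine ⟨N ∩ interior L, hN.inter isOpen_interior, subset_inter hKN hKL,
      fun x hx => hLU (interior_subset hx.2), fun x hx => ?_⟩
    have : χ x = 1 := hN1 hx.1
    simp only [this, one_smul]

end Cutoff

section Uniqueness

variable {E : Type*} [NormedAddCommGroup E] [NormedSpace ℝ E]

lemma eqOn_Icc_of_hasDerivWithinAt {X : ℝ → E → E} {D : Set E} (hD : IsOpen D)
    (hX : ContDiffOn ℝ 1 (fun p : ℝ × E => X p.1 p.2) (univ ×ˢ D)) {a b : ℝ} {u w : ℝ → E}
    (hu : ∀ t ∈ Icc a b, u t ∈ D ∧ HasDerivWithinAt u (X t (u t)) (Icc a b) t)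
    (hw : ∀ t ∈ Icc a b, w t ∈ D ∧ HasDerivWithinAt w (X t (w t)) (Icc a b) t)
    (h : u a = w a) : EqOn u w (Icc a b) := by
  have huc : ContinuousOn u (Icc a b) := fun t ht => (hu t ht).2.continuousWithinAt
  have hwc : ContinuousOn w (Icc a b) := fun t ht => (hw t ht).2.continuousWithinAt
  set K : Set (ℝ × E) := (fun t => (t, u t)) '' Icc a b ∪ (fun t => (t, w t)) '' Icc a b
  have hK : IsCompact K := (isCompact_Icc.image_of_continuousOn (continuousOn_id.prodMk huc)).union
    (isCompact_Icc.image_of_continuousOn (continuousOn_id.prodMk hwc))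
  have hKU : K ⊆ univ ×ˢ D := by
    rintro p (⟨t, ht, rfl⟩ | ⟨t, ht, rfl⟩)
    exacts [⟨mem_univ _, (hu t ht).1⟩, ⟨mem_univ _, (hw t ht).1⟩]
  have hlip : LocallyLipschitzOn K (fun p : ℝ × E => X p.1 p.2) := by
    intro p hp
    obtain ⟨C, s, hs, hC⟩ :=
      (hX.contDiffAt ((isOpen_univ.prod hD).mem_nhds (hKU hp))).exists_lipschitzOnWith
    exact ⟨C, s, mem_nhdsWithin_of_mem_nhds hs, hC⟩
  obtain ⟨C, hC⟩ := hlip.exists_lipschitzOnWith_of_compact hK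
  refine ODE_solution_unique_of_mem_Icc_right (v := X) (s := fun t => {z | (t, z) ∈ K}) (K := C)
    (fun t _ x hx y hy => by simpa [Prod.edist_eq] using hC hx hy)
    huc (fun t ht => ?_) (fun t ht => Or.inl ⟨t, Ico_subset_Icc_self ht, rfl⟩)
    hwc (fun t ht => ?_) (fun t ht => Or.inr ⟨t, Ico_subset_Icc_self ht, rfl⟩) h
  · exact (hu t (Ico_subset_Icc_self ht)).2.mono_of_mem_nhdsWithin (Icc_mem_nhdsGE_of_mem ht)
  · exact (hw t (Ico_subset_Icc_self ht)).2.mono_of_mem_nhdsWithin (Icc_mem_nhdsGE_of_mem ht)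

end Uniqueness

section PlanarFlow

variable {F : Plane → Plane} {D : Set Plane} {z : Plane} {T t : ℝ} {c : ℝ → Plane}

lemma isSolutionCurve_iff (hT : 0 ≤ T) : IsSolutionCurve F D z T c ↔
    c 0 = z ∧ ∀ t ∈ Icc 0 T, c t ∈ D ∧ HasDerivWithinAt c (F (c t)) (Icc 0 T) t := by
  rw [IsSolutionCurve, uIcc_of_le hT]

lemma IsSolutionCurve.mono (hc : IsSolutionCurve F D z T c) (ht : t ∈ Icc 0 T) :
    IsSolutionCurve F D z t c := by
  rw [isSolutionCurve_iff (ht.1.trans ht.2)] at hc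
  refine (isSolutionCurve_iff ht.1).2 ⟨hc.1, fun s hs => ?_⟩
  obtain ⟨hmem, hderiv⟩ := hc.2 s ⟨hs.1, hs.2.trans ht.2⟩
  exact ⟨hmem, hderiv.mono (Icc_subset_Icc_right ht.2)⟩

lemma flow_eq_of_isSolutionCurve (hD : IsOpen D) (hF : ContDiffOn ℝ 1 F D)
    (hc : IsSolutionCurve F D z T c) (ht : t ∈ Icc 0 T) : flow F D t z = c t := by
  have hct := (isSolutionCurve_iff ht.1).1 (hc.mono ht)
  have hex : SolutionExists F D z t := ⟨c, hc.mono ht⟩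
  rw [flow, dif_pos hex]
  have hchoose := (isSolutionCurve_iff ht.1).1 hex.choose_spec
  exact eqOn_Icc_of_hasDerivWithinAt (X := fun _ => F) hD
    (hF.comp contDiffOn_snd fun p hp => hp.2) hchoose.2 hct.2 (hchoose.1.trans hct.1.symm)
    (right_mem_Icc.2 ht.1)

end PlanarFlow

/-! ### Branches of zeros of a map vanishing at zero parameter -/

section Branch

section Division

variable {E G : Type*} [NormedAddCommGroup E] [NormedSpace ℝ E]
  [NormedAddCommGroup G] [NormedSpace ℝ G] {a : E}

/-- The linear map `(ε, a) ↦ (s ε, a)`, which contracts onto `ε = 0` as `s` runs from `1` to `0`. -/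
def scaleParam (E : Type*) [NormedAddCommGroup E] [NormedSpace ℝ E] (s : ℝ) :
    ℝ × E →L[ℝ] ℝ × E :=
  (s • ContinuousLinearMap.id ℝ ℝ).prodMap (ContinuousLinearMap.id ℝ E)

@[simp] lemma scaleParam_apply (s : ℝ) (q : ℝ × E) : scaleParam E s q = (s * q.1, q.2) := rfl

lemma norm_scaleParam_apply_le {s : ℝ} (hs : s ∈ Icc (0 : ℝ) 1) (q : ℝ × E) :
    ‖scaleParam E s q‖ ≤ ‖q‖ := by
  refine max_le_max ?_ le_rfl
  simp only [scaleParam_apply, norm_mul, Real.norm_eq_abs, abs_of_nonneg hs.1]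
  exact mul_le_of_le_one_left (abs_nonneg _) hs.2

lemma scaleParam_mem_ball {s r : ℝ} (hs : s ∈ Icc (0 : ℝ) 1) {q : ℝ × E}
    (hq : q ∈ Metric.ball (0, a) r) : scaleParam E s q ∈ Metric.ball (0, a) r := by
  rw [Metric.mem_ball, dist_eq_norm] at hq ⊢
  have : scaleParam E s q - (0, a) = scaleParam E s (q - (0, a)) := by
    rw [map_sub]
    simp
  exact this ▸ (norm_scaleParam_apply_le hs _).trans_lt hq

lemma integral_comp_scaleParam [CompleteSpace G] (A : ℝ × E →L[ℝ] G) (q : ℝ × E) :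
    ∫ s in (0 : ℝ)..1, A (scaleParam E s q) = A (scaleParam E 2⁻¹ q) := by
  have hsplit : ∀ s : ℝ, A (scaleParam E s q) = s • A (q.1, 0) + A (0, q.2) := by
    intro s
    rw [← map_smul, ← map_add]
    simp
  simp_rw [hsplit]
  rw [intervalIntegral.integral_add (Continuous.intervalIntegrable (by fun_prop) _ _)
      (Continuous.intervalIntegrable (by fun_prop) _ _), intervalIntegral.integral_smul_const]
  simp

lemma hasStrictFDerivAt_integral_scaleParam [CompleteSpace G] {h : ℝ × E → G}
    {h' : ℝ × E →L[ℝ] G} (hh : HasStrictFDerivAt h h' (0, a))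
    (hcont : ∀ᶠ q in 𝓝 (0, a), ContinuousAt h q) :
    HasStrictFDerivAt (fun q => ∫ s in (0 : ℝ)..1, h (scaleParam E s q))
      (h' ∘L scaleParam E 2⁻¹) (0, a) := by
  rw [hasStrictFDerivAt_iff_isLittleO, Asymptotics.isLittleO_iff] at hh ⊢
  intro c hc
  obtain ⟨r, hr, hball⟩ := Metric.eventually_nhds_iff_ball.1
    ((hh hc).and ((hcont.prod_inl_nhds _).and (hcont.prod_inr_nhds _)))
  filter_upwards [Metric.ball_mem_nhds _ hr] with p hp
  have hscale : ∀ s ∈ Icc (0 : ℝ) 1,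
      (scaleParam E s p.1, scaleParam E s p.2) ∈ Metric.ball (((0 : ℝ), a), ((0 : ℝ), a)) r := by
    rw [← ball_prod_same] at hp ⊢
    exact fun s hs => ⟨scaleParam_mem_ball hs hp.1, scaleParam_mem_ball hs hp.2⟩
  have hint : ∀ q : ℝ × E, (∀ s ∈ Icc (0 : ℝ) 1, ContinuousAt h (scaleParam E s q)) →
      IntervalIntegrable (fun s : ℝ => h (scaleParam E s q)) volume 0 1 := fun q hq =>
    ContinuousOn.intervalIntegrable fun s hs => ((hq s (by rwa [uIcc_of_le zero_le_one] at hs)).comp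
      (f := fun s : ℝ => (s * q.1, q.2)) (by fun_prop)).continuousWithinAt
  have hint₁ := hint p.1 fun s hs => (hball _ (hscale s hs)).2.1
  have hint₂ := hint p.2 fun s hs => (hball _ (hscale s hs)).2.2
  have hlin : Continuous fun s : ℝ => h' (scaleParam E s (p.1 - p.2)) :=
    h'.continuous.comp (by simp only [scaleParam_apply]; fun_prop)
  rw [ContinuousLinearMap.comp_apply, ← integral_comp_scaleParam,
    ← intervalIntegral.integral_sub hint₁ hint₂,
    ← intervalIntegral.integral_sub (hint₁.sub hint₂) (hlin.intervalIntegrable _ _)]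
  refine (intervalIntegral.norm_integral_le_of_norm_le_const (C := c * ‖p.1 - p.2‖)
    fun s hs => ?_).trans (by simp)
  rw [uIoc_of_le zero_le_one] at hs
  have hs' : s ∈ Icc (0 : ℝ) 1 := Ioc_subset_Icc_self hs
  rw [map_sub (scaleParam E s)]
  refine (hball _ (hscale s hs')).1.trans ?_
  gcongr
  simpa only [map_sub] using norm_scaleParam_apply_le hs' (p.1 - p.2)

lemma eventually_eq_smul_integral_fderiv [CompleteSpace G] {P : ℝ × E → G}
    (hP : ContDiffAt ℝ 1 P (0, a)) (hP0 : ∀ᶠ b in 𝓝 a, P (0, b) = 0) :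
    ∀ᶠ q in 𝓝 (0, a), P q = q.1 • ∫ s in (0 : ℝ)..1, fderiv ℝ P (scaleParam E s q) (1, 0) := by
  obtain ⟨r, hr, hball⟩ := Metric.eventually_nhds_iff_ball.1
    ((hP.eventually (by simp)).and (hP0.prod_inr_nhds (0 : ℝ)))
  filter_upwards [Metric.ball_mem_nhds _ hr] with q hq
  have hsmooth : ∀ s ∈ uIcc (0 : ℝ) 1, ContDiffAt ℝ 1 P (scaleParam E s q) := fun s hs =>
    (hball _ (scaleParam_mem_ball (by rwa [uIcc_of_le zero_le_one] at hs) hq)).1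
  have hderiv : ∀ s ∈ uIcc (0 : ℝ) 1, HasDerivAt (fun s => P (scaleParam E s q))
      (q.1 • fderiv ℝ P (scaleParam E s q) (1, 0)) s := by
    intro s hs
    have := ((hsmooth s hs).differentiableAt one_ne_zero).hasFDerivAt.comp_hasDerivAt
      (f := fun s : ℝ => scaleParam E s q) s
      (((hasDerivAt_id s).mul_const q.1).prodMk (hasDerivAt_const s q.2))
    rw [← map_smul]
    simpa [Function.comp_def] using this
  have hcont : ContinuousOn (fun s : ℝ => q.1 • fderiv ℝ P (scaleParam E s q) (1, 0))
      (uIcc 0 1) := fun s hs =>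
    (continuousAt_const.smul ((((hsmooth s hs).fderiv_right (m := 0) (by norm_num)).clm_apply
      contDiffAt_const).continuousAt.comp (f := fun s : ℝ => (s * q.1, q.2))
        (by fun_prop))).continuousWithinAt
  have hftc := intervalIntegral.integral_eq_sub_of_hasDerivAt hderiv hcont.intervalIntegrable
  have hq0 := (hball _ (scaleParam_mem_ball (s := 0) (by simp) hq)).2
  simp only [scaleParam_apply] at hq0
  simpa [hq0] using hftc.symm

end Division

lemma exists_unique_branch_of_graph {E : Type*} [NormedAddCommGroup E] {Z : Set (ℝ × E)}
    {ψ : ℝ → E} {a : E} (hψ : (fun ε => ψ ε - a) =O[𝓝 0] fun ε => ε)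
    (hZ : ∀ᶠ q in 𝓝 (0, a), q.1 ≠ 0 → (q ∈ Z ↔ ψ q.1 = q.2)) :
    ∃ C > 0, ∃ ρ > 0, ∃ ε₁ > 0, ∀ ε ∈ Ioo 0 ε₁, ∃ b, ‖b - a‖ ≤ C * ε ∧ (ε, b) ∈ Z ∧
      ∀ b' ∈ Metric.ball a ρ, (ε, b') ∈ Z → b' = b := by
  obtain ⟨ρ, hρ, hball⟩ := Metric.eventually_nhds_iff_ball.1 hZ
  obtain ⟨C, hC0, hC⟩ := hψ.exists_pos
  obtain ⟨r, hr, hbound⟩ := Metric.eventually_nhds_iff_ball.1 hC.bound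
  refine ⟨C, hC0, ρ, hρ, min r (min ρ (ρ / C)), by positivity, fun ε hε => ?_⟩
  have hεr : ε < r := hε.2.trans_le (min_le_left _ _)
  have hερ : ε < ρ := hε.2.trans_le ((min_le_right _ _).trans (min_le_left _ _))
  have hεC : C * ε < ρ := (lt_div_iff₀' hC0).1
    (hε.2.trans_le ((min_le_right _ _).trans (min_le_right _ _)))
  have hle : ‖ψ ε - a‖ ≤ C * ε := by
    simpa [abs_of_pos hε.1] using hbound ε (by simpa [abs_of_pos hε.1] using hεr)
  have hiff : ∀ b ∈ Metric.ball a ρ, ((ε, b) ∈ Z ↔ ψ ε = b) := fun b hb =>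
    hball (ε, b) (by
      rw [← ball_prod_same]
      exact ⟨by simpa [abs_of_pos hε.1] using hερ, hb⟩) hε.1.ne'
  exact ⟨ψ ε, hle, (hiff _ (mem_ball_iff_norm.2 (hle.trans_lt hεC))).2 rfl,
    fun b hb hbZ => ((hiff b hb).1 hbZ).symm⟩

lemma isInvertible_of_triangular {L : ℝ × ℝ →L[ℝ] ℝ × ℝ} (h₁ : (L (1, 0)).1 = 0)
    (h₂ : (L (0, 1)).1 ≠ 0) (h₃ : (L (1, 0)).2 ≠ 0) : L.IsInvertible := by
  have hinj : Function.Injective L.toLinearMap := by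
    rw [← LinearMap.ker_eq_bot, LinearMap.ker_eq_bot']
    rintro ⟨u, v⟩ huv
    have hsplit : L (u, v) = u • L (1, 0) + v • L (0, 1) := by
      rw [← map_smul, ← map_smul, ← map_add]
      simp
    obtain ⟨hfst, hsnd⟩ := Prod.ext_iff.1 (hsplit.symm.trans huv)
    obtain rfl : v = 0 := by simpa [h₁, h₂] using hfst
    obtain rfl : u = 0 := by simpa [h₃] using hsnd
    rfl
  exact ⟨(LinearEquiv.ofInjectiveEndo _ hinj).toContinuousLinearEquiv, by ext <;> rfl⟩

/-- Since `P` vanishes at `ε = 0`, the system `S = P = 0` is equivalent for `ε ≠ 0` to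
`S = P / ε = 0`, to which the implicit function theorem applies. -/
theorem exists_unique_branch {S P : ℝ × ℝ × ℝ → ℝ} {a : ℝ × ℝ}
    (hS : ContDiffAt ℝ 1 S (0, a)) (hP : ContDiffAt ℝ 2 P (0, a))
    (hS0 : S (0, a) = 0) (hSθ : fderiv ℝ S (0, a) (0, 1, 0) = 0)
    (hSx : fderiv ℝ S (0, a) (0, 0, 1) ≠ 0) (hP0 : ∀ᶠ b in 𝓝 a, P (0, b) = 0)
    (hP1 : fderiv ℝ P (0, a) (1, 0) = 0)
    (hP2 : deriv (fun θ => fderiv ℝ P (0, θ, a.2) (1, 0)) a.1 ≠ 0) :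
    ∃ C > 0, ∃ ρ > 0, ∃ ε₁ > 0, ∀ ε ∈ Ioo 0 ε₁, ∃ b, ‖b - a‖ ≤ C * ε ∧
      (S (ε, b) = 0 ∧ P (ε, b) = 0) ∧
      ∀ b' ∈ Metric.ball a ρ, S (ε, b') = 0 ∧ P (ε, b') = 0 → b' = b := by
  set h : ℝ × ℝ × ℝ → ℝ := fun q => fderiv ℝ P q (1, 0)
  set Q : ℝ × ℝ × ℝ → ℝ := fun q => ∫ s in (0 : ℝ)..1, h (scaleParam _ s q)
  set A := fderiv ℝ S (0, a)
  set B := fderiv ℝ h (0, a)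
  have hh : ContDiffAt ℝ 1 h (0, a) :=
    (hP.fderiv_right (m := 1) (by norm_num)).clm_apply contDiffAt_const
  have hSQ : HasStrictFDerivAt (fun q => (S q, Q q)) (A.prod (B ∘L scaleParam _ 2⁻¹)) (0, a) :=
    (hS.hasStrictFDerivAt one_ne_zero).prodMk (hasStrictFDerivAt_integral_scaleParam
      (hh.hasStrictFDerivAt one_ne_zero)
      ((hh.eventually (by simp)).mono fun q hq => hq.continuousAt))
  have hBθ : B (0, 1, 0) ≠ 0 := by
    have hd : HasDerivAt (fun θ : ℝ => h (0, θ, a.2)) (B (0, 1, 0)) a.1 :=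
      (hh.differentiableAt one_ne_zero).hasFDerivAt.comp_hasDerivAt
        (f := fun θ : ℝ => ((0 : ℝ), θ, a.2)) a.1 ((hasDerivAt_const _ _).prodMk
          ((hasDerivAt_id _).prodMk (hasDerivAt_const _ _)))
    exact hd.deriv ▸ hP2
  have hinv : ((A.prod (B ∘L scaleParam _ 2⁻¹)) ∘L .inr ℝ ℝ (ℝ × ℝ)).IsInvertible :=
    isInvertible_of_triangular (by simpa using hSθ) (by simpa using hSx) (by simpa using hBθ)
  have hQ0 : Q (0, a) = 0 := by simp [Q, h, hP1]
  have hiff := hSQ.eventually_apply_eq_iff_implicitFunctionOfProdDomain hinv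
  have hψ := (hSQ.hasStrictFDerivAt_implicitFunctionOfProdDomain hinv).hasFDerivAt.isBigO_sub
  have hψ0 : hSQ.implicitFunctionOfProdDomain hinv 0 = a := hiff.self_of_nhds.1 rfl
  simp only [hψ0, sub_zero] at hψ
  refine exists_unique_branch_of_graph (Z := {q | S q = 0 ∧ P q = 0}) hψ ?_
  filter_upwards [hiff, eventually_eq_smul_integral_fderiv (hP.of_le one_le_two) hP0]
    with q hq hPq hε
  rw [← hq, hS0, hQ0, Prod.mk.injEq, hPq, smul_eq_zero_iff_right hε]

end Branch

/-! ### Perturbed arcs -/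

section LinearODE

variable {E : Type*} [NormedAddCommGroup E] [NormedSpace ℝ E] {a b T : ℝ} {A Φ : ℝ → E →L[ℝ] E}

lemma eqOn_zero_of_linear_ode (hA : ContinuousOn A (Icc a b)) {d : ℝ → E}
    (hd : ∀ t ∈ Icc a b, HasDerivWithinAt d (A t (d t)) (Icc a b) t) (h0 : d a = 0 ∨ d b = 0) :
    EqOn d 0 (Icc a b) := by
  obtain ⟨K, hK⟩ := isCompact_Icc.exists_bound_of_continuousOn hA
  have hlip : ∀ t ∈ Icc a b, LipschitzOnWith K.toNNReal (A t) univ := fun t ht =>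
    ((A t).lipschitz.weaken ((NNReal.coe_le_coe).1
      ((hK t ht).trans (Real.le_coe_toNNReal K)))).lipschitzOnWith
  have hdc : ContinuousOn d (Icc a b) := fun t ht => (hd t ht).continuousWithinAt
  have hzero : ∀ s : Set ℝ, ∀ t, HasDerivWithinAt (0 : ℝ → E) (A t ((0 : ℝ → E) t)) s t := by
    intro s t
    rw [Pi.zero_apply, map_zero]
    exact hasDerivWithinAt_const t s 0
  rcases h0 with h0 | h0
  · exact ODE_solution_unique_of_mem_Icc_right (v := fun t => A t) (s := fun _ => univ)
      (fun t ht => hlip t (Ico_subset_Icc_self ht)) hdc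
      (fun t ht => (hd t (Ico_subset_Icc_self ht)).mono_of_mem_nhdsWithin
        (Icc_mem_nhdsGE_of_mem ht)) (fun _ _ => mem_univ _) continuousOn_const
      (fun t _ => hzero _ t) (fun _ _ => mem_univ _) h0
  · exact ODE_solution_unique_of_mem_Icc_left (v := fun t => A t) (s := fun _ => univ)
      (fun t ht => hlip t (Ioc_subset_Icc_self ht)) hdc
      (fun t ht => (hd t (Ioc_subset_Icc_self ht)).mono_of_mem_nhdsWithin
        (Icc_mem_nhdsLE_of_mem ht)) (fun _ _ => mem_univ _) continuousOn_const
      (fun t _ => hzero _ t) (fun _ _ => mem_univ _) h0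

lemma isInvertible_of_linear_ode [FiniteDimensional ℝ E] (hA : ContinuousOn A (Icc a b))
    (hΦ : ∀ t ∈ Icc a b, HasDerivWithinAt Φ (A t ∘L Φ t) (Icc a b) t)
    (ha : (Φ a).IsInvertible) {t : ℝ} (ht : t ∈ Icc a b) : (Φ t).IsInvertible := by
  have hsub : Icc a t ⊆ Icc a b := Icc_subset_Icc_right ht.2
  have hinj : Function.Injective (Φ t).toLinearMap := by
    rw [← LinearMap.ker_eq_bot, LinearMap.ker_eq_bot']
    intro v hv
    have hzero := eqOn_zero_of_linear_ode (d := fun s => Φ s v) (hA.mono hsub)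
      (fun s hs => by
        simpa using ((hΦ s (hsub hs)).mono hsub).clm_apply (hasDerivWithinAt_const s _ v))
      (Or.inr hv) (left_mem_Icc.2 ht.1)
    exact ha.injective (hzero.trans (map_zero (Φ a)).symm)
  exact ⟨(LinearEquiv.ofInjectiveEndo _ hinj).toContinuousLinearEquiv, by ext; rfl⟩

lemma continuousOn_inverse_apply [CompleteSpace E] {s : Set ℝ} (hΦ : ContinuousOn Φ s)
    (hinv : ∀ t ∈ s, (Φ t).IsInvertible) {f : ℝ → E} (hf : ContinuousOn f s) :
    ContinuousOn (fun t => (Φ t).inverse (f t)) s :=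
  ContinuousOn.clm_apply (fun t ht => ((hinv t ht).contDiffAt_map_inverse
    (n := 0)).continuousAt.comp_continuousWithinAt (hΦ t ht)) hf

theorem variation_of_constants [CompleteSpace E] (hT : 0 ≤ T) (hA : ContinuousOn A (Icc 0 T))
    (hΦ : ∀ t ∈ Icc 0 T, HasDerivWithinAt Φ (A t ∘L Φ t) (Icc 0 T) t)
    (hinv : ∀ t ∈ Icc 0 T, (Φ t).IsInvertible) {f u : ℝ → E} (hf : ContinuousOn f (Icc 0 T))
    (hu : ∀ t ∈ Icc 0 T, HasDerivWithinAt u (A t (u t) + f t) (Icc 0 T) t) (hu0 : u 0 = 0) :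
    u T = Φ T (∫ t in (0 : ℝ)..T, (Φ t).inverse (f t)) := by
  set J := fun t => ∫ s in (0 : ℝ)..t, (Φ s).inverse (f s)
  have hcont := continuousOn_inverse_apply (fun t ht => (hΦ t ht).continuousWithinAt) hinv hf
  have hJ : ∀ t ∈ Icc 0 T, HasDerivWithinAt J ((Φ t).inverse (f t)) (Icc 0 T) t := by
    intro t ht
    have : Fact (t ∈ Icc 0 T) := ⟨ht⟩
    exact intervalIntegral.integral_hasDerivWithinAt_right
      (hcont.mono (by rw [uIcc_of_le ht.1]; exact Icc_subset_Icc_right ht.2)).intervalIntegrable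
      (hcont.stronglyMeasurableAtFilter_nhdsWithin measurableSet_Icc t) (hcont t ht)
  have hdiff := eqOn_zero_of_linear_ode (d := fun t => u t - Φ t (J t)) hA (fun t ht => by
    refine ((hu t ht).fun_sub ((hΦ t ht).clm_apply (hJ t ht))).congr_deriv ?_
    rw [(hinv t ht).self_apply_inverse, map_sub, ContinuousLinearMap.comp_apply]
    abel) (Or.inl (by simp [hu0, J])) (right_mem_Icc.2 hT)
  exact sub_eq_zero.1 hdiff

end LinearODE

section ArcFlow

lemma exists_Ioo_subset_of_Icc_subset {U : Set ℝ} (hU : IsOpen U) {a b : ℝ} (hab : a ≤ b)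
    (h : Icc a b ⊆ U) : ∃ η > 0, Ioo (a - η) (b + η) ⊆ U := by
  obtain ⟨η₁, hη₁, ha⟩ := Metric.isOpen_iff.1 hU a (h (left_mem_Icc.2 hab))
  obtain ⟨η₂, hη₂, hb⟩ := Metric.isOpen_iff.1 hU b (h (right_mem_Icc.2 hab))
  rw [Real.ball_eq_Ioo] at ha hb
  refine ⟨min η₁ η₂, lt_min hη₁ hη₂, fun s hs => ?_⟩
  have h₁ := min_le_left η₁ η₂
  have h₂ := min_le_right η₁ η₂
  rcases lt_or_ge s a with hsa | hsa
  · exact ha ⟨by linarith [hs.1], by linarith⟩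
  rcases lt_or_ge b s with hsb | hsb
  · exact hb ⟨by linarith, by linarith [hs.2]⟩
  · exact h ⟨hsa, hsb⟩

lemma exists_tube {X : Type*} [TopologicalSpace X] {O : Set (ℝ × X)} (hO : IsOpen O) {a b : ℝ}
    (hab : a ≤ b) {x : X} (h : ∀ s ∈ Icc a b, (s, x) ∈ O) :
    ∃ η > 0, ∀ᶠ z in 𝓝 x, ∀ s ∈ Ioo (a - η) (b + η), (s, z) ∈ O := by
  obtain ⟨u, v, hu, hv, hau, hxv, huv⟩ := generalized_tube_lemma (isCompact_Icc (a := a) (b := b))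
    (isCompact_singleton (x := x)) hO (by rintro ⟨s, z⟩ ⟨hs, rfl⟩; exact h s hs)
  obtain ⟨η, hη, hηu⟩ := exists_Ioo_subset_of_Icc_subset hu hab hau
  exact ⟨η, hη, mem_of_superset (hv.mem_nhds (hxv rfl)) fun z hz s hs => huv ⟨hηu hs, hz⟩⟩

variable {E : Type*} [NormedAddCommGroup E] [NormedSpace ℝ E]
  {h : ℝ × E × ℝ → E} {D : Set E} {κ T : ℝ} {e₀ : ℝ × E × ℝ}

/-- The autonomous field `(κ, g, 0)` on triples (time, position, parameter), whose flow integrates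
`u' = g (θ + κ s, u, ε)` for all initial times, positions and parameters at once. -/
def suspension (κ : ℝ) (g : ℝ × E × ℝ → E) (e : ℝ × E × ℝ) : ℝ × E × ℝ := (κ, g e, 0)

section Suspension

variable {φ : ℝ → ℝ × E × ℝ → ℝ × E × ℝ}

lemma IsGlobalFlow.suspension_fst (hφ : IsGlobalFlow (suspension κ h) φ) (s : ℝ) (e : ℝ × E × ℝ) :
    (φ s e).1 = e.1 + κ * s := by
  have hd : ∀ s, HasDerivAt (fun s => (φ s e).1 - κ * s) 0 s := fun s => by
    have hfst : HasDerivAt (fun s => (φ s e).1) κ s := (hφ.isIntegralCurve e s).fst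
    simpa using hfst.fun_sub ((hasDerivAt_id' s).const_mul κ)
  have hconst := is_const_of_deriv_eq_zero (fun s => (hd s).differentiableAt)
    (fun s => (hd s).deriv) s 0
  simp only [hφ.zero, mul_zero, sub_zero] at hconst
  exact sub_eq_iff_eq_add.1 hconst

lemma IsGlobalFlow.suspension_snd_snd (hφ : IsGlobalFlow (suspension κ h) φ) (s : ℝ)
    (e : ℝ × E × ℝ) : (φ s e).2.2 = e.2.2 := by
  have hd : ∀ s, HasDerivAt (fun s => (φ s e).2.2) 0 s := fun s =>
    (hφ.isIntegralCurve e s).snd.snd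
  simpa only [hφ.zero] using is_const_of_deriv_eq_zero (fun s => (hd s).differentiableAt)
    (fun s => (hd s).deriv) s 0

lemma IsGlobalFlow.suspension_hasDerivAt (hφ : IsGlobalFlow (suspension κ h) φ) (s : ℝ)
    (e : ℝ × E × ℝ) :
    HasDerivAt (fun s => (φ s e).2.1) (h (e.1 + κ * s, (φ s e).2.1, e.2.2)) s := by
  rw [← hφ.suspension_fst, ← hφ.suspension_snd_snd s e]
  exact (hφ.isIntegralCurve e s).snd.fst

lemma IsGlobalFlow.suspension_eqOn (hφ : IsGlobalFlow (suspension κ h) φ) (hh : ContDiff ℝ 1 h)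
    {c : ℝ → E} {θ ε : ℝ}
    (hc : ∀ t ∈ Icc 0 T, HasDerivWithinAt c (h (θ + κ * t, c t, ε)) (Icc 0 T) t) :
    EqOn (fun s => φ s (θ, c 0, ε)) (fun s => (θ + κ * s, c s, ε)) (Icc 0 T) := by
  refine eqOn_Icc_of_hasDerivWithinAt (X := fun _ => suspension κ h) isOpen_univ
    (ContDiff.contDiffOn ((contDiff_const.prodMk (hh.prodMk contDiff_const)).comp contDiff_snd))
    (fun t _ => ⟨mem_univ _, (hφ.isIntegralCurve _ t).hasDerivWithinAt⟩)
    (fun t ht => ⟨mem_univ _, ?_⟩) (by simp [hφ.zero])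
  have htime : HasDerivWithinAt (fun s => θ + κ * s) κ (Icc 0 T) t := by
    simpa using (((hasDerivAt_id t).const_mul κ).const_add θ).hasDerivWithinAt
  exact htime.prodMk ((hc t ht).prodMk (hasDerivWithinAt_const _ _ _))

lemma exists_isGlobalFlow_suspension [FiniteDimensional ℝ E] {n : ℕ} (hn : n ≠ 0)
    (hh : ContDiff ℝ n h) (hsupp : HasCompactSupport h) (κ : ℝ) :
    ∃ φ, IsGlobalFlow (suspension κ h) φ ∧
      ContDiff ℝ n fun p : ℝ × (ℝ × E × ℝ) => φ p.1 p.2 := by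
  have hn1 : (1 : WithTop ℕ∞) ≤ n := by exact_mod_cast Nat.one_le_iff_ne_zero.2 hn
  have hsmooth : ContDiff ℝ n (suspension κ h) :=
    contDiff_const.prodMk (hh.prodMk contDiff_const)
  obtain ⟨K, hK⟩ := hh.lipschitzWith_of_hasCompactSupport hsupp (by exact_mod_cast hn)
  have hlip := (LipschitzWith.const (α := ℝ × E × ℝ) κ).prodMk
    (hK.prodMk (LipschitzWith.const (α := ℝ × E × ℝ) (0 : ℝ)))
  obtain ⟨M, hM⟩ := hsupp.exists_bound_of_continuous hh.continuous
  have hbound : ∀ e, ‖suspension κ h e‖ ≤ (⟨max |κ| (max M 0), by positivity⟩ : ℝ≥0) := by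
    intro e
    simp only [suspension, Prod.norm_def, norm_zero, Real.norm_eq_abs]
    exact max_le_max le_rfl (max_le_max (hM e) le_rfl)
  obtain ⟨φ, hφ⟩ := exists_isGlobalFlow (hsmooth.of_le hn1) hlip hbound
  exact ⟨φ, hφ, IsGlobalFlow.contDiff (f := ⟨_, hsmooth.continuous⟩) hφ hlip hn hsmooth⟩

end Suspension

/-- A family of solutions near a given one: for `e = (θ, z, ε)` near `e₀` and times between `-η` and
`T + η`, the curve `curve · e` solves `u' s = h (θ + κ s, u s, ε)`, `u 0 = z`, in `D`; it depends
`C²` on everything. -/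
structure ArcFlow (h : ℝ × E × ℝ → E) (D : Set E) (κ T : ℝ) (e₀ : ℝ × E × ℝ) where
  curve : ℝ → ℝ × E × ℝ → E
  η : ℝ
  r : ℝ
  η_pos : 0 < η
  r_pos : 0 < r
  contDiff : ContDiff ℝ 2 fun p : ℝ × (ℝ × E × ℝ) => curve p.1 p.2
  curve_zero : ∀ e, curve 0 e = e.2.1
  curve_mem : ∀ e ∈ Metric.ball e₀ r, ∀ s ∈ Ioo (-η) (T + η), curve s e ∈ D
  hasDerivAt_curve : ∀ e ∈ Metric.ball e₀ r, ∀ s ∈ Ioo (-η) (T + η),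
    HasDerivAt (fun s => curve s e) (h (e.1 + κ * s, curve s e, e.2.2)) s

theorem exists_arcFlow [FiniteDimensional ℝ E] {U : Set (ℝ × E × ℝ)} (hU : IsOpen U)
    (hUD : ∀ e ∈ U, e.2.1 ∈ D) (hh : ContDiffOn ℝ 2 h U) (hT : 0 ≤ T) {c : ℝ → E} {θ ε : ℝ}
    (hc : ∀ t ∈ Icc 0 T, (θ + κ * t, c t, ε) ∈ U ∧
      HasDerivWithinAt c (h (θ + κ * t, c t, ε)) (Icc 0 T) t) :
    Nonempty (ArcFlow h D κ T (θ, c 0, ε)) := by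
  set γ : ℝ → ℝ × E × ℝ := fun s => (θ + κ * s, c s, ε)
  have hγ : ContinuousOn γ (Icc 0 T) := by
    have : ContinuousOn c (Icc 0 T) := fun t ht => (hc t ht).2.continuousWithinAt
    fun_prop
  obtain ⟨g, hg, hgsupp, N, hN, hγN, hNU, hgh⟩ := exists_contDiff_hasCompactSupport_eqOn (n := 2)
    hU hh (isCompact_Icc.image_of_continuousOn hγ) (image_subset_iff.2 fun t ht => (hc t ht).1)
  obtain ⟨φ, hφ, hφ2⟩ := exists_isGlobalFlow_suspension two_ne_zero hg hgsupp κ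
  have hbase : EqOn (fun s => φ s (θ, c 0, ε)) γ (Icc 0 T) :=
    hφ.suspension_eqOn (hg.of_le one_le_two) fun t ht => by
      rw [hgh (hγN ⟨t, ht, rfl⟩)]
      exact (hc t ht).2
  obtain ⟨η, hη, htube⟩ := exists_tube (hN.preimage hφ2.continuous) hT (x := (θ, c 0, ε))
    fun s hs => by
      rw [mem_preimage, show φ s (θ, c 0, ε) = γ s from hbase hs]
      exact hγN ⟨s, hs, rfl⟩
  obtain ⟨r, hr, hball⟩ := Metric.eventually_nhds_iff_ball.1 htube
  simp only [zero_sub] at hball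
  refine ⟨⟨fun s e => (φ s e).2.1, η, r, hη, hr, (contDiff_fst.comp contDiff_snd).comp hφ2,
    fun e => by rw [hφ.zero], fun e he s hs => hUD _ (hNU (hball e he s hs)),
    fun e he s hs => ?_⟩⟩
  have hmem : (e.1 + κ * s, (φ s e).2.1, e.2.2) ∈ N := by
    rw [← hφ.suspension_fst, ← hφ.suspension_snd_snd s e]
    exact hball e he s hs
  exact hgh hmem ▸ hφ.suspension_hasDerivAt s e

end ArcFlow

section Perturbation

variable {E : Type*} [NormedAddCommGroup E] [NormedSpace ℝ E]
  {h : ℝ × E × ℝ → E} {F : E → E} {g : ℝ → E → E} {D : Set E} {ε₀ t δ : ℝ} {z w : E}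

/-- The non-autonomous fields `h (·, ·, ε)`, defined on the open set `D` for `|ε| < ε₀`, form a `C²`
family with first order expansion `F + ε g`. -/
structure IsPerturbation (h : ℝ × E × ℝ → E) (F : E → E) (g : ℝ → E → E) (D : Set E) (ε₀ : ℝ) :
    Prop where
  isOpen : IsOpen D
  pos : 0 < ε₀
  contDiffOn : ContDiffOn ℝ 2 h (univ ×ˢ D ×ˢ Ioo (-ε₀) ε₀)
  zero : ∀ t, ∀ z ∈ D, h (t, z, 0) = F z
  first : ∀ t, ∀ z ∈ D, HasDerivAt (fun ε => h (t, z, ε)) (g t z) 0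

lemma IsPerturbation.isOpen_domain (hp : IsPerturbation h F g D ε₀) :
    IsOpen ((univ : Set ℝ) ×ˢ D ×ˢ Ioo (-ε₀) ε₀) :=
  isOpen_univ.prod (hp.isOpen.prod isOpen_Ioo)

lemma IsPerturbation.mem_domain (hp : IsPerturbation h F g D ε₀) (hz : z ∈ D) :
    (t, z, (0 : ℝ)) ∈ (univ : Set ℝ) ×ˢ D ×ˢ Ioo (-ε₀) ε₀ :=
  ⟨mem_univ _, hz, neg_lt_zero.2 hp.pos, hp.pos⟩

lemma IsPerturbation.hasFDerivAt (hp : IsPerturbation h F g D ε₀) (hz : z ∈ D) :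
    HasFDerivAt h (fderiv ℝ h (t, z, 0)) (t, z, 0) :=
  ((hp.contDiffOn.contDiffAt (hp.isOpen_domain.mem_nhds (hp.mem_domain hz))).differentiableAt
    two_ne_zero).hasFDerivAt

lemma IsPerturbation.contDiffOn_field (hp : IsPerturbation h F g D ε₀) : ContDiffOn ℝ 2 F D :=
  (hp.contDiffOn.comp (f := fun z => (0, z, 0))
    (contDiff_const.prodMk (contDiff_id.prodMk contDiff_const)).contDiffOn
    fun _ hz => hp.mem_domain hz).congr fun z hz => (hp.zero 0 z hz).symm

lemma IsPerturbation.fderiv_apply (hp : IsPerturbation h F g D ε₀) (hz : z ∈ D) :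
    fderiv ℝ h (t, z, 0) (0, w, δ) = fderiv ℝ F z w + δ • g t z := by
  have hF : HasFDerivAt F (fderiv ℝ h (t, z, 0) ∘L .inr ℝ ℝ (E × ℝ) ∘L .inl ℝ E ℝ) z := by
    refine ((hp.hasFDerivAt hz).comp (f := fun z => (t, z, 0)) z
      ((hasFDerivAt_prodMk_right t (z, 0)).comp z
        (hasFDerivAt_prodMk_left z (0 : ℝ)))).congr_of_eventuallyEq ?_
    filter_upwards [hp.isOpen.mem_nhds hz] with y hy using (hp.zero t y hy).symm
  have hg : HasDerivAt (fun ε => h (t, z, ε)) (fderiv ℝ h (t, z, 0) (0, 0, 1)) 0 :=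
    (hp.hasFDerivAt hz).comp_hasDerivAt (f := fun ε => (t, z, ε)) 0
      ((hasDerivAt_const _ _).prodMk ((hasDerivAt_const _ _).prodMk (hasDerivAt_id _)))
  rw [hF.fderiv, (hp.first t z hz).unique hg, ← map_smul]
  simp only [ContinuousLinearMap.comp_apply]
  rw [← map_add]
  congr 1
  ext <;> simp

lemma IsPerturbation.continuousOn_first (hp : IsPerturbation h F g D ε₀) :
    ContinuousOn (fun p : ℝ × E => g p.1 p.2) (univ ×ˢ D) := by
  have hderiv : ContinuousOn (fun p : ℝ × E => fderiv ℝ h (p.1, p.2, 0) (0, 0, 1)) (univ ×ˢ D) :=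
    ((hp.contDiffOn.continuousOn_fderiv_of_isOpen hp.isOpen_domain one_le_two).comp
      (f := fun p : ℝ × E => (p.1, p.2, (0 : ℝ))) (by fun_prop)
      fun _ hq => hp.mem_domain hq.2).clm_apply continuousOn_const
  exact hderiv.congr fun p hq => by simp [hp.fderiv_apply hq.2]

end Perturbation

section Variation

section

variable {E : Type*} [NormedAddCommGroup E] [NormedSpace ℝ E]
  {h : ℝ × E × ℝ → E} {F : E → E} {g : ℝ → E → E} {D : Set E} {κ T ε₀ θ s δ : ℝ} {z w : E}
  {e₀ e : ℝ × E × ℝ} (A : ArcFlow h D κ T e₀)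

lemma ArcFlow.continuous_curve (e : ℝ × E × ℝ) : Continuous fun s => A.curve s e :=
  A.contDiff.continuous.comp (f := fun s => (s, e)) (by fun_prop)

lemma ArcFlow.contDiff_curve (s : ℝ) : ContDiff ℝ 2 (A.curve s) :=
  A.contDiff.comp (contDiff_prodMk_right s)

lemma ArcFlow.fderiv_curve_zero (e : ℝ × E × ℝ) :
    fderiv ℝ (A.curve 0) e = .fst ℝ E ℝ ∘L .snd ℝ ℝ (E × ℝ) := by
  rw [show A.curve 0 = ContinuousLinearMap.fst ℝ E ℝ ∘L .snd ℝ ℝ (E × ℝ) from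
    funext A.curve_zero]
  exact ContinuousLinearMap.fderiv _

lemma ArcFlow.Ico_subset : Ico 0 (T + A.η) ⊆ Ioo (-A.η) (T + A.η) :=
  fun _ ht => ⟨(neg_lt_zero.2 A.η_pos).trans_le ht.1, ht.2⟩

lemma ArcFlow.Icc_subset : Icc 0 T ⊆ Ico 0 (T + A.η) :=
  fun _ ht => ⟨ht.1, ht.2.trans_lt (lt_add_of_pos_right T A.η_pos)⟩

lemma ArcFlow.hasDerivAt_fderiv_curve (he : e ∈ Metric.ball e₀ A.r)
    (hs : s ∈ Ioo (-A.η) (T + A.η)) :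
    HasDerivAt (fun s => fderiv ℝ (A.curve s) e)
      (fderiv ℝ (fun e => h (e.1 + κ * s, A.curve s e, e.2.2)) e) s := by
  refine hasDerivAt_fderiv_of_hasDerivAt A.contDiff
    (Θ := fun s e => h (e.1 + κ * s, A.curve s e, e.2.2)) ?_
  filter_upwards [prod_mem_nhds (isOpen_Ioo.mem_nhds hs) (Metric.isOpen_ball.mem_nhds he)]
    with p hp using A.hasDerivAt_curve p.2 hp.2 p.1 hp.1

lemma ArcFlow.fderiv_velocity_apply (hp : IsPerturbation h F g D ε₀)
    (he : (θ, z, 0) ∈ Metric.ball e₀ A.r) (hs : s ∈ Ioo (-A.η) (T + A.η)) :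
    fderiv ℝ (fun e => h (e.1 + κ * s, A.curve s e, e.2.2)) (θ, z, 0) (0, w, δ) =
      fderiv ℝ F (A.curve s (θ, z, 0)) (fderiv ℝ (A.curve s) (θ, z, 0) (0, w, δ)) +
        δ • g (θ + κ * s) (A.curve s (θ, z, 0)) := by
  have hmem := A.curve_mem _ he s hs
  have hinner : HasFDerivAt (fun e : ℝ × E × ℝ => (e.1 + κ * s, A.curve s e, e.2.2))
      ((ContinuousLinearMap.fst ℝ ℝ (E × ℝ)).prod ((fderiv ℝ (A.curve s) (θ, z, 0)).prod
        (.snd ℝ E ℝ ∘L .snd ℝ ℝ (E × ℝ)))) (θ, z, 0) :=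
    (hasFDerivAt_fst.add_const _).prodMk
      (((A.contDiff_curve s).differentiable two_ne_zero _).hasFDerivAt.prodMk
        (hasFDerivAt_snd.comp _ hasFDerivAt_snd))
  have houter : HasFDerivAt h (fderiv ℝ h (θ + κ * s, A.curve s (θ, z, 0), 0))
      (θ + κ * s, A.curve s (θ, z, 0), 0) := hp.hasFDerivAt hmem
  rw [← hp.fderiv_apply hmem]
  exact congr($((houter.comp (θ, z, (0 : ℝ)) hinner).fderiv) (0, w, δ))

end

variable {h : ℝ × Plane × ℝ → Plane} {F : Plane → Plane} {g : ℝ → Plane → Plane}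
  {D : Set Plane} {κ T ε₀ θ t : ℝ} {z : Plane} {e₀ : ℝ × Plane × ℝ} (A : ArcFlow h D κ T e₀)

lemma ArcFlow.isSolutionCurve (hp : IsPerturbation h F g D ε₀)
    (he : (θ, z, 0) ∈ Metric.ball e₀ A.r) (ht : t ∈ Ico 0 (T + A.η)) :
    IsSolutionCurve F D z t fun s => A.curve s (θ, z, 0) := by
  rw [isSolutionCurve_iff ht.1]
  refine ⟨A.curve_zero _, fun s hs => ?_⟩
  have hs' := A.Ico_subset ⟨hs.1, hs.2.trans_lt ht.2⟩
  have hmem := A.curve_mem _ he s hs'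
  refine ⟨hmem, ?_⟩
  rw [← hp.zero (θ + κ * s) _ hmem]
  exact (A.hasDerivAt_curve _ he s hs').hasDerivWithinAt

lemma ArcFlow.flow_eq (hp : IsPerturbation h F g D ε₀) (he : (θ, z, 0) ∈ Metric.ball e₀ A.r)
    (ht : t ∈ Ico 0 (T + A.η)) : flow F D t z = A.curve t (θ, z, 0) :=
  flow_eq_of_isSolutionCurve hp.isOpen (hp.contDiffOn_field.of_le one_le_two)
    (A.isSolutionCurve hp he ht) (right_mem_Icc.2 ht.1)

lemma ArcFlow.flow_mem (hp : IsPerturbation h F g D ε₀) (he : (θ, z, 0) ∈ Metric.ball e₀ A.r)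
    (ht : t ∈ Ico 0 (T + A.η)) : flow F D t z ∈ D := by
  rw [A.flow_eq hp he ht]
  exact A.curve_mem _ he t (A.Ico_subset ht)

lemma ArcFlow.continuousOn_flow (hp : IsPerturbation h F g D ε₀)
    (he : (θ, z, 0) ∈ Metric.ball e₀ A.r) : ContinuousOn (fun t => flow F D t z) (Icc 0 T) :=
  (A.continuous_curve (θ, z, 0)).continuousOn.congr fun _ ht =>
    A.flow_eq hp he (A.Icc_subset ht)

lemma ArcFlow.Y_eq (hp : IsPerturbation h F g D ε₀) (he : (θ, z, 0) ∈ Metric.ball e₀ A.r)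
    (ht : t ∈ Ico 0 (T + A.η)) : Y F D t z =
      fderiv ℝ (A.curve t) (θ, z, 0) ∘L .inr ℝ ℝ (Plane × ℝ) ∘L .inl ℝ Plane ℝ := by
  have hincl : HasFDerivAt (fun z : Plane => (θ, z, (0 : ℝ)))
      (.inr ℝ ℝ (Plane × ℝ) ∘L .inl ℝ Plane ℝ) z :=
    (hasFDerivAt_prodMk_right θ (z, (0 : ℝ))).comp z (hasFDerivAt_prodMk_left z (0 : ℝ))
  have hcurve := ((A.contDiff_curve t).differentiable two_ne_zero (θ, z, 0)).hasFDerivAt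
  refine ((hcurve.comp (f := fun z => (θ, z, 0)) z hincl).congr_of_eventuallyEq ?_).fderiv
  filter_upwards [hincl.continuousAt.preimage_mem_nhds (Metric.isOpen_ball.mem_nhds he)]
    with w hw using A.flow_eq hp hw ht

lemma ArcFlow.hasDerivWithinAt_Y (hp : IsPerturbation h F g D ε₀)
    (he : (θ, z, 0) ∈ Metric.ball e₀ A.r) (ht : t ∈ Icc 0 T) :
    HasDerivWithinAt (fun t => Y F D t z) (fderiv ℝ F (flow F D t z) ∘L Y F D t z)
      (Icc 0 T) t := by
  have hd := (A.hasDerivAt_fderiv_curve he (A.Ico_subset (A.Icc_subset ht))).clm_comp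
    (hasDerivAt_const t
      (ContinuousLinearMap.inr ℝ ℝ (Plane × ℝ) ∘L ContinuousLinearMap.inl ℝ Plane ℝ))
  refine (hd.hasDerivWithinAt.congr_of_mem (fun s hs => A.Y_eq hp he (A.Icc_subset hs))
    ht).congr_deriv ?_
  rw [A.flow_eq hp he (A.Icc_subset ht), A.Y_eq hp he (A.Icc_subset ht)]
  refine ContinuousLinearMap.ext fun w => ?_
  have := A.fderiv_velocity_apply (w := w) (δ := 0) hp he (A.Ico_subset (A.Icc_subset ht))
  simpa using this

lemma ArcFlow.continuousOn_fderiv_flow (hp : IsPerturbation h F g D ε₀)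
    (he : (θ, z, 0) ∈ Metric.ball e₀ A.r) :
    ContinuousOn (fun t => fderiv ℝ F (flow F D t z)) (Icc 0 T) :=
  (hp.contDiffOn_field.continuousOn_fderiv_of_isOpen hp.isOpen one_le_two).comp
    (A.continuousOn_flow hp he) fun _ ht => A.flow_mem hp he (A.Icc_subset ht)

lemma ArcFlow.isInvertible_Y (hp : IsPerturbation h F g D ε₀)
    (he : (θ, z, 0) ∈ Metric.ball e₀ A.r) (ht : t ∈ Icc 0 T) : (Y F D t z).IsInvertible := by
  refine isInvertible_of_linear_ode (Φ := fun t => Y F D t z) (A.continuousOn_fderiv_flow hp he)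
    (fun t ht => A.hasDerivWithinAt_Y hp he ht) ?_ ht
  rw [A.Y_eq hp he (A.Icc_subset ⟨le_rfl, ht.1.trans ht.2⟩), A.fderiv_curve_zero]
  exact ⟨.refl ℝ Plane, by ext <;> rfl⟩

lemma ArcFlow.continuousOn_first (hp : IsPerturbation h F g D ε₀)
    (he : (θ, z, 0) ∈ Metric.ball e₀ A.r) :
    ContinuousOn (fun t => g (θ + κ * t) (flow F D t z)) (Icc 0 T) :=
  hp.continuousOn_first.comp (f := fun t => (θ + κ * t, flow F D t z))
    ((by fun_prop : Continuous fun t => θ + κ * t).continuousOn.prodMk (A.continuousOn_flow hp he))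
    fun _ ht => ⟨mem_univ _, A.flow_mem hp he (A.Icc_subset ht)⟩

lemma ArcFlow.continuousOn_inverse_Y (hp : IsPerturbation h F g D ε₀)
    (he : (θ, z, 0) ∈ Metric.ball e₀ A.r) :
    ContinuousOn (fun t => (Y F D t z).inverse (g (θ + κ * t) (flow F D t z))) (Icc 0 T) :=
  continuousOn_inverse_apply (fun _ ht => (A.hasDerivWithinAt_Y hp he ht).continuousWithinAt)
    (fun _ ht => A.isInvertible_Y hp he ht) (A.continuousOn_first hp he)

theorem ArcFlow.fderiv_curve_parameter (hp : IsPerturbation h F g D ε₀) (hT : 0 ≤ T)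
    (he : (θ, z, 0) ∈ Metric.ball e₀ A.r) :
    fderiv ℝ (A.curve T) (θ, z, 0) (0, 0, 1) = Y F D T z
      (∫ t in (0 : ℝ)..T, (Y F D t z).inverse (g (θ + κ * t) (flow F D t z))) := by
  refine variation_of_constants hT (A.continuousOn_fderiv_flow hp he)
    (Φ := fun t => Y F D t z) (u := fun t => fderiv ℝ (A.curve t) (θ, z, 0) (0, 0, 1))
    (fun t ht => A.hasDerivWithinAt_Y hp he ht) (fun t ht => A.isInvertible_Y hp he ht)
    (A.continuousOn_first hp he) (fun t ht => ?_) ?_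
  · have ht' := A.Ico_subset (A.Icc_subset ht)
    refine ((A.hasDerivAt_fderiv_curve he ht').clm_apply
      (hasDerivAt_const t _)).hasDerivWithinAt.congr_deriv ?_
    rw [map_zero, add_zero, A.fderiv_velocity_apply hp he ht', one_smul,
      A.flow_eq hp he (A.Icc_subset ht)]
  · rw [A.fderiv_curve_zero]
    rfl

end Variation

/-! ### Transverse returns to the switching line -/

section FirstReturn

/-- The function `f` leaves zero downwards at time `0` and has, on the interval `(0, b)`, a single
zero `τ`, which it crosses upwards. -/
structure IsFirstReturn (f : ℝ → ℝ) (b τ : ℝ) : Prop where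
  pos : 0 < τ
  lt : τ < b
  below : ∀ s ∈ Ioo 0 τ, f s < 0
  hits : f τ = 0
  unique : ∀ s ∈ Ioo 0 b, f s = 0 → s = τ
  down : deriv f 0 < 0
  up : 0 < deriv f τ

lemma isFirstReturn_of_deriv {f : ℝ → ℝ} {a T τ : ℝ} (hf : Differentiable ℝ f) (ha : 0 < a)
    (haT : a ≤ T - a) (hzero : f 0 = 0) (hdown : ∀ s ∈ Ioo (-a) a, deriv f s < 0)
    (hmid : ∀ s ∈ Icc a (T - a), f s < 0) (hup : ∀ s ∈ Ioo (T - a) (T + a), 0 < deriv f s)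
    (hτ : τ ∈ Ioo (T - a) (T + a)) (hhit : f τ = 0) : IsFirstReturn f (T + a) τ := by
  have hanti : StrictAntiOn f (Icc 0 a) :=
    strictAntiOn_of_deriv_neg (convex_Icc _ _) hf.continuous.continuousOn fun s hs => by
      rw [interior_Icc] at hs
      exact hdown s ⟨by linarith [hs.1], hs.2⟩
  have hmono : StrictMonoOn f (Icc (T - a) (T + a)) :=
    strictMonoOn_of_deriv_pos (convex_Icc _ _) hf.continuous.continuousOn fun s hs =>
      hup s (interior_Icc (a := T - a) ▸ hs)
  have hearly : ∀ s ∈ Ioc 0 (T - a), f s < 0 := by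
    intro s hs
    rcases le_total s a with hsa | hsa
    · exact hzero ▸ hanti (left_mem_Icc.2 ha.le) ⟨hs.1.le, hsa⟩ hs.1
    · exact hmid s ⟨hsa, hs.2⟩
  refine ⟨by linarith [hτ.1], hτ.2, fun s hs => ?_, hhit, fun s hs hs0 => ?_,
    hdown 0 ⟨neg_lt_zero.2 ha, ha⟩, hup τ hτ⟩
  · rcases le_total s (T - a) with hsT | hsT
    · exact hearly s ⟨hs.1, hsT⟩
    · exact hhit ▸ hmono ⟨hsT, (hs.2.trans hτ.2).le⟩ (Ioo_subset_Icc_self hτ) hs.2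
  · rcases le_total s (T - a) with hsT | hsT
    · exact absurd hs0 (hearly s ⟨hs.1, hsT⟩).ne
    · exact hmono.injOn ⟨hsT, hs.2.le⟩ (Ioo_subset_Icc_self hτ) (hs0.trans hhit.symm)

variable {Q : Type*} [NormedAddCommGroup Q] [NormedSpace ℝ Q] {y : ℝ × Q → ℝ} {q₀ : Q} {T : ℝ}

lemma hasDerivAt_comp_prodMk {E : Type*} [NormedAddCommGroup E] [NormedSpace ℝ E] {f : ℝ × Q → E}
    {s : ℝ} {q : Q} (hf : DifferentiableAt ℝ f (s, q)) :
    HasDerivAt (fun s => f (s, q)) (fderiv ℝ f (s, q) (1, 0)) s :=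
  hf.hasFDerivAt.comp_hasDerivAt (f := fun s => (s, q)) s
    ((hasDerivAt_id s).prodMk (hasDerivAt_const s q))

lemma exists_contDiffAt_zero [CompleteSpace Q] (hy : ContDiffAt ℝ 2 y (T, q₀))
    (hzero : y (T, q₀) = 0) (hy' : fderiv ℝ y (T, q₀) (1, 0) ≠ 0) :
    ∃ τ : Q → ℝ, ContDiffAt ℝ 2 τ q₀ ∧ τ q₀ = T ∧ ∀ᶠ q in 𝓝 q₀, y (τ q, q) = 0 := by
  have hswap : ContDiffAt ℝ 2 (y ∘ Prod.swap) (q₀, T) :=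
    hy.comp (q₀, T) (contDiff_snd.prodMk contDiff_fst).contDiffAt
  have hpartial : fderiv ℝ (y ∘ Prod.swap) (q₀, T) ∘L .inr ℝ Q ℝ =
      .toSpanSingleton ℝ (fderiv ℝ y (T, q₀) (1, 0)) :=
    ((hswap.differentiableAt two_ne_zero).hasFDerivAt.comp T
      (hasFDerivAt_prodMk_right q₀ T)).unique
      (hasDerivAt_comp_prodMk (hy.differentiableAt two_ne_zero)).hasFDerivAt
  have hinv : (fderiv ℝ (y ∘ Prod.swap) (q₀, T) ∘L .inr ℝ Q ℝ).IsInvertible := by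
    rw [hpartial]
    exact ⟨.unitsEquivAut ℝ (.mk0 _ hy'), by ext; simp⟩
  refine ⟨_, hswap.contDiffAt_implicitFunction two_ne_zero hinv,
    hswap.implicitFunction_apply_self two_ne_zero hinv, ?_⟩
  filter_upwards [hswap.eventually_apply_implicitFunction two_ne_zero hinv] with q hq
    using hq.trans hzero

theorem exists_isFirstReturn [CompleteSpace Q] (hy : ContDiff ℝ 2 y) (hzero : ∀ q, y (0, q) = 0)
    (hT : 0 < T) (hdown : fderiv ℝ y (0, q₀) (1, 0) < 0) (hbelow : ∀ s ∈ Ioo 0 T, y (s, q₀) < 0)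
    (hhit : y (T, q₀) = 0) (hup : 0 < fderiv ℝ y (T, q₀) (1, 0)) {η₀ : ℝ} (hη₀ : 0 < η₀) :
    ∃ η ∈ Ioc 0 η₀, ∃ τ : Q → ℝ, ContDiffAt ℝ 2 τ q₀ ∧
      ∀ᶠ q in 𝓝 q₀, IsFirstReturn (fun s => y (s, q)) (T + η) (τ q) := by
  have hd : ∀ s q, HasDerivAt (fun s => y (s, q)) (fderiv ℝ y (s, q) (1, 0)) s := fun s q =>
    hasDerivAt_comp_prodMk (hy.differentiable two_ne_zero (s, q))
  have hd_cont : Continuous fun p => fderiv ℝ y p (1, 0) :=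
    (hy.continuous_fderiv two_ne_zero).clm_apply continuous_const
  obtain ⟨η₁, hη₁, hneg⟩ := exists_tube (O := {p | fderiv ℝ y p (1, 0) < 0})
    (isOpen_lt hd_cont continuous_const) (le_refl (0 : ℝ)) (x := q₀)
    fun s hs => by obtain rfl := le_antisymm hs.2 hs.1; exact hdown
  obtain ⟨η₂, hη₂, hpos⟩ := exists_tube (O := {p | 0 < fderiv ℝ y p (1, 0)})
    (isOpen_lt continuous_const hd_cont) (le_refl T) (x := q₀)
    fun s hs => by obtain rfl := le_antisymm hs.2 hs.1; exact hup
  obtain ⟨a, ha, ha'⟩ := exists_between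
    (lt_min (lt_min hη₁ hη₂) (lt_min hη₀ (half_pos hT)))
  simp only [lt_min_iff] at ha'
  obtain ⟨⟨ha₁, ha₂⟩, ha₀, haT⟩ := ha'
  have haT' : a ≤ T - a := by linarith
  obtain ⟨η₃, hη₃, hmid⟩ := exists_tube (isOpen_lt hy.continuous continuous_const) haT' (x := q₀)
    fun s hs => hbelow s ⟨by linarith [hs.1], by linarith [hs.2]⟩
  obtain ⟨τ, hτ, hτT, hτ0⟩ := exists_contDiffAt_zero hy.contDiffAt hhit hup.ne'
  have hτa : ∀ᶠ q in 𝓝 q₀, τ q ∈ Ioo (T - a) (T + a) :=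
    hτ.continuousAt.eventually (hτT ▸ Ioo_mem_nhds (by linarith) (by linarith))
  refine ⟨a, ⟨ha, ha₀.le⟩, τ, hτ, ?_⟩
  filter_upwards [hneg, hpos, hmid, hτ0, hτa] with q hneg hpos hmid hτ0 hτa
  refine isFirstReturn_of_deriv (fun s => (hd s q).differentiableAt) ha haT' (hzero q)
    (fun s hs => ?_) (fun s hs => hmid s ⟨by linarith [hs.1], by linarith [hs.2]⟩)
    (fun s hs => ?_) hτa hτ0
  · rw [(hd s q).deriv]
    exact hneg s ⟨by linarith [hs.1], by linarith [hs.2]⟩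
  · rw [(hd s q).deriv]
    exact hpos s ⟨by linarith [hs.1], by linarith [hs.2]⟩

end FirstReturn

section TransverseReturn

variable {F : Plane → Plane} {D : Set Plane} {T x : ℝ}

lemma halfReturnTime_eq (hT : 0 < T) (hsol : SolutionExists F D (x, 0) T)
    (hbelow : ∀ t ∈ Ioo 0 T, (flow F D t (x, 0)).2 < 0) (hhit : (flow F D T (x, 0)).2 = 0) :
    halfReturnTime F D x = T := by
  have hleast : IsLeast {t | 0 < t ∧ SolutionExists F D (x, 0) t ∧ (flow F D t (x, 0)).2 = 0} T :=
    ⟨⟨hT, hsol, hhit⟩, fun t ⟨ht, _, hzero⟩ => not_lt.1 fun hlt => (hbelow t ⟨ht, hlt⟩).ne hzero⟩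
  exact hleast.csInf_eq

/-- The solution of `z' = F z` starting at `(x, 0)` runs through the lower half plane and is back on
the switching line at time `T`; it leaves and reaches the line transversely. -/
structure IsTransverseReturn (F : Plane → Plane) (D : Set Plane) (x T : ℝ) : Prop where
  pos : 0 < T
  exists_solution : SolutionExists F D (x, 0) T
  below : ∀ t ∈ Ioo 0 T, (flow F D t (x, 0)).2 < 0
  hits : (flow F D T (x, 0)).2 = 0
  down : (F (x, 0)).2 < 0
  up : 0 < (F (flow F D T (x, 0))).2

lemma IsTransverseReturn.halfReturnTime_eq (hret : IsTransverseReturn F D x T) :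
    halfReturnTime F D x = T :=
  TwoFold.halfReturnTime_eq hret.pos hret.exists_solution hret.below hret.hits

lemma sub_mul_deriv_nonpos_of_isMaxOn {y : ℝ → ℝ} {y' a b s t : ℝ} (hmax : IsMaxOn y (Icc a b) s)
    (hy : HasDerivWithinAt y y' (Icc a b) s) (hs : s ∈ Icc a b) (ht : t ∈ Icc a b) :
    (t - s) * y' ≤ 0 := by
  simpa using hmax.localize.hasFDerivWithinAt_nonpos hy.hasFDerivWithinAt
    (sub_mem_posTangentConeAt_of_segment_subset ((convex_Icc a b).segment_subset hs ht))

theorem ReturnCondition.isTransverseReturn {xi xv : ℝ} (hreturn : ReturnCondition F D xi xv)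
    (hD : IsOpen D) (hF : ContDiffOn ℝ 1 F D) (hx : x ∈ Ioc xi xv) (hne : (F (x, 0)).2 ≠ 0) :
    IsTransverseReturn F D x (halfReturnTime F D x) := by
  have hpos := hreturn.pos x hx
  have hbelow := hreturn.below x hx
  have hhit := hreturn.hits x hx
  have hne' := hreturn.transverse x hx
  obtain ⟨c, hc⟩ := hreturn.exists_solution x hx
  have hflow : ∀ t ∈ Icc 0 (halfReturnTime F D x), flow F D t (x, 0) = c t := fun t ht =>
    flow_eq_of_isSolutionCurve hD hF hc ht
  generalize halfReturnTime F D x = T at *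
  have h0 : (0 : ℝ) ∈ Icc 0 T := left_mem_Icc.2 hpos.le
  have hT : T ∈ Icc 0 T := right_mem_Icc.2 hpos.le
  have hderiv := ((isSolutionCurve_iff hpos.le).1 hc).2
  have hnonpos : ∀ t ∈ Icc 0 T, (c t).2 ≤ 0 := fun t ht => by
    rcases eq_endpoints_or_mem_Ioo_of_mem_Icc ht with rfl | rfl | ht
    · rw [hc.1]
    · rw [← hflow _ hT, hhit]
    · exact hflow t (Ioo_subset_Icc_self ht) ▸ (hbelow t ht).le
  have hmax : ∀ s ∈ Icc 0 T, (c s).2 = 0 → ∀ t ∈ Icc 0 T, (t - s) * (F (c s)).2 ≤ 0 :=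
    fun s hs hzero t ht => sub_mul_deriv_nonpos_of_isMaxOn (y := fun t => (c t).2)
      (fun t ht => (hnonpos t ht).trans_eq hzero.symm) (hderiv s hs).2.snd hs ht
  have hdown := hmax 0 h0 (by rw [hc.1]) T hT
  have hup := hmax T hT (by rw [← hflow T hT, hhit]) 0 h0
  rw [hc.1] at hdown
  rw [← hflow T hT] at hup
  refine ⟨hpos, ⟨c, hc⟩, hbelow, hhit, hne.lt_of_le ?_, hne'.symm.lt_of_le ?_⟩ <;> nlinarith

end TransverseReturn

section ReturnArc

variable {h : ℝ × Plane × ℝ → Plane} {g : ℝ → Plane → Plane} {F : Plane → Plane} {D : Set Plane}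
  {κ T ε₀ θ₀ θ x₀ x s t r : ℝ} {q q₀ : ℝ × ℝ × ℝ}

/-- The initial data `(θ, (x, 0), ε)` of the arc with parameters `q = (ε, θ, x)`. -/
def arcData (q : ℝ × ℝ × ℝ) : ℝ × Plane × ℝ := (q.2.1, (q.2.2, 0), q.1)

lemma contDiff_arcData {n : WithTop ℕ∞} : ContDiff ℝ n arcData := by
  unfold arcData
  fun_prop

lemma arcData_mem_ball (hq : q ∈ Metric.ball q₀ r) : arcData q ∈ Metric.ball (arcData q₀) r := by
  rw [Metric.mem_ball, Prod.dist_eq, Prod.dist_eq, max_lt_iff, max_lt_iff] at hq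
  have hr : 0 < r := dist_nonneg.trans_lt hq.1
  simp only [arcData, Metric.mem_ball, Prod.dist_eq, dist_self]
  exact max_lt hq.2.1 (max_lt (max_lt hq.2.2 hr) hq.1)

/-- Arcs in the lower half plane: for parameters `q = (ε, θ, x)` near `(0, θ₀, x₀)` the solution of
`u' s = h (θ + κ s, u s, ε)` starting at `(x, 0)` returns transversely to the switching line, for
the first time, after time `τ q`. -/
structure ReturnArc (h : ℝ × Plane × ℝ → Plane) (D : Set Plane) (κ T θ₀ x₀ : ℝ) extends
    ArcFlow h D κ T (θ₀, (x₀, 0), 0) where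
  τ : ℝ × ℝ × ℝ → ℝ
  contDiffAt_τ : ContDiffAt ℝ 2 τ (0, θ₀, x₀)
  isFirstReturn : ∀ q ∈ Metric.ball (0, θ₀, x₀) r,
    IsFirstReturn (fun s => (curve s (arcData q)).2) (T + η) (τ q)

theorem ArcFlow.nonempty_returnArc (A : ArcFlow h D κ T (θ₀, (x₀, 0), 0))
    (hp : IsPerturbation h F g D ε₀) (hret : IsTransverseReturn F D x₀ T) :
    Nonempty (ReturnArc h D κ T θ₀ x₀) := by
  set y : ℝ × (ℝ × ℝ × ℝ) → ℝ := fun p => (A.curve p.1 (arcData p.2)).2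
  have hy : ContDiff ℝ 2 y := contDiff_snd.comp
    (A.contDiff.comp (contDiff_fst.prodMk (contDiff_arcData.comp contDiff_snd)))
  have hbase : (θ₀, ((x₀, 0) : Plane), (0 : ℝ)) ∈ Metric.ball _ A.r :=
    Metric.mem_ball_self A.r_pos
  have h0 : (0 : ℝ) ∈ Icc 0 T := left_mem_Icc.2 hret.pos.le
  have hT : T ∈ Icc 0 T := right_mem_Icc.2 hret.pos.le
  have hflow : ∀ t ∈ Icc 0 T, y (t, (0, θ₀, x₀)) = (flow F D t (x₀, 0)).2 := fun t ht =>
    congrArg Prod.snd (A.flow_eq hp hbase (A.Icc_subset ht)).symm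
  have hderiv : ∀ t ∈ Icc 0 T,
      fderiv ℝ y (t, (0, θ₀, x₀)) (1, 0) = (F (flow F D t (x₀, 0))).2 := fun t ht => by
    have ht' := A.Icc_subset ht
    have htime := (A.hasDerivAt_curve _ hbase t (A.Ico_subset ht')).snd
    rw [hp.zero _ _ (A.curve_mem _ hbase t (A.Ico_subset ht')), ← A.flow_eq hp hbase ht'] at htime
    exact (hasDerivAt_comp_prodMk (hy.differentiable two_ne_zero _)).unique htime
  have hstart : flow F D 0 (x₀, 0) = (x₀, 0) := by
    rw [A.flow_eq hp hbase (A.Icc_subset h0), A.curve_zero]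
  obtain ⟨η, hη, τ, hτ, hreturn⟩ := exists_isFirstReturn hy (q₀ := (0, θ₀, x₀))
    (fun q => congrArg Prod.snd (A.curve_zero (arcData q))) hret.pos
    (by rw [hderiv 0 h0, hstart]; exact hret.down)
    (fun s hs => hflow s (Ioo_subset_Icc_self hs) ▸ hret.below s hs)
    (hflow T hT ▸ hret.hits) (hderiv T hT ▸ hret.up) A.η_pos
  obtain ⟨r, hr, hball⟩ := Metric.eventually_nhds_iff_ball.1 hreturn
  have hηA : Ioo (-η) (T + η) ⊆ Ioo (-A.η) (T + A.η) :=
    Ioo_subset_Ioo (neg_le_neg hη.2) (add_le_add_right hη.2 T)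
  have hrA := Metric.ball_subset_ball (x := (θ₀, ((x₀, 0) : Plane), (0 : ℝ))) (min_le_left A.r r)
  exact ⟨{
    A with
    η := η
    r := min A.r r
    η_pos := hη.1
    r_pos := lt_min A.r_pos hr
    curve_mem := fun e he s hs => A.curve_mem e (hrA he) s (hηA hs)
    hasDerivAt_curve := fun e he s hs => A.hasDerivAt_curve e (hrA he) s (hηA hs)
    τ := τ
    contDiffAt_τ := hτ
    isFirstReturn := fun q hq => hball q (Metric.ball_subset_ball (min_le_right _ _) hq) }⟩

namespace ReturnArc

variable (B : ReturnArc h D κ T θ₀ x₀)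

/-- The arc with parameters `q = (ε, θ, x)`. -/
def arc (s : ℝ) (q : ℝ × ℝ × ℝ) : Plane := B.curve s (arcData q)

/-- The position at which the arc returns to the switching line. -/
def exitPoint (q : ℝ × ℝ × ℝ) : ℝ := (B.arc (B.τ q) q).1

lemma contDiff_arc : ContDiff ℝ 2 fun p : ℝ × (ℝ × ℝ × ℝ) => B.arc p.1 p.2 :=
  B.contDiff.comp (contDiff_fst.prodMk (contDiff_arcData.comp contDiff_snd))

lemma arc_zero (q : ℝ × ℝ × ℝ) : B.arc 0 q = (q.2.2, 0) := B.curve_zero _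

lemma contDiffAt_exitPoint : ContDiffAt ℝ 2 B.exitPoint (0, θ₀, x₀) :=
  contDiffAt_fst.comp _ (B.contDiff_arc.contDiffAt.comp (f := fun q => (B.τ q, q)) _
    (B.contDiffAt_τ.prodMk contDiffAt_id))

lemma mem_ball (hq : q ∈ Metric.ball (0, θ₀, x₀) B.r) :
    (q.2.1, ((q.2.2, 0) : Plane), q.1) ∈ Metric.ball (θ₀, ((x₀, 0) : Plane), (0 : ℝ)) B.r :=
  arcData_mem_ball hq

lemma τ_mem (hq : q ∈ Metric.ball (0, θ₀, x₀) B.r) : B.τ q ∈ Ico 0 (T + B.η) :=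
  ⟨(B.isFirstReturn q hq).pos.le, (B.isFirstReturn q hq).lt⟩

lemma arc_mem (hq : q ∈ Metric.ball (0, θ₀, x₀) B.r) (hs : s ∈ Ioo (-B.η) (T + B.η)) :
    B.arc s q ∈ D :=
  B.curve_mem _ (B.mem_ball hq) s hs

lemma hasDerivAt_arc (hq : q ∈ Metric.ball (0, θ₀, x₀) B.r) (hs : s ∈ Ioo (-B.η) (T + B.η)) :
    HasDerivAt (fun s => B.arc s q) (h (q.2.1 + κ * s, B.arc s q, q.1)) s :=
  B.hasDerivAt_curve _ (B.mem_ball hq) s hs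

lemma arc_τ (hq : q ∈ Metric.ball (0, θ₀, x₀) B.r) : B.arc (B.τ q) q = (B.exitPoint q, 0) :=
  Prod.ext rfl (B.isFirstReturn q hq).hits

lemma flow_eq_arc (hp : IsPerturbation h F g D ε₀)
    (hq : ((0 : ℝ), θ, x) ∈ Metric.ball ((0 : ℝ), θ₀, x₀) B.r)
    (ht : t ∈ Ico 0 (T + B.η)) : flow F D t (x, 0) = B.arc t (0, θ, x) :=
  B.flow_eq hp (B.mem_ball hq) ht

lemma τ_eq (hp : IsPerturbation h F g D ε₀)
    (hq : ((0 : ℝ), θ, x) ∈ Metric.ball ((0 : ℝ), θ₀, x₀) B.r) :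
    B.τ (0, θ, x) = halfReturnTime F D x := by
  have hret := B.isFirstReturn _ hq
  have hτ := B.τ_mem hq
  have hflow : ∀ t ∈ Ico 0 (T + B.η), (flow F D t (x, 0)).2 = (B.arc t (0, θ, x)).2 :=
    fun t ht => congrArg Prod.snd (B.flow_eq_arc hp hq ht)
  exact (halfReturnTime_eq hret.pos ⟨_, B.isSolutionCurve hp (B.mem_ball hq) hτ⟩
    (fun t ht => (hflow t ⟨ht.1.le, ht.2.trans hτ.2⟩).trans_lt (hret.below t ht))
    ((hflow _ hτ).trans hret.hits)).symm

lemma exitPoint_eq (hp : IsPerturbation h F g D ε₀)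
    (hq : ((0 : ℝ), θ, x) ∈ Metric.ball ((0 : ℝ), θ₀, x₀) B.r) :
    B.exitPoint (0, θ, x) = (flow F D (halfReturnTime F D x) (x, 0)).1 := by
  have hτ := B.τ_mem hq
  rw [B.τ_eq hp hq] at hτ
  rw [exitPoint, B.τ_eq hp hq, B.flow_eq_arc hp hq hτ]

end ReturnArc

end ReturnArc

namespace ReturnArc

variable {h : ℝ × Plane × ℝ → Plane} {g : ℝ → Plane → Plane} {F : Plane → Plane} {D : Set Plane}
  {κ T ε₀ θ₀ θ x₀ x : ℝ} {q : ℝ × ℝ × ℝ} (B : ReturnArc h D κ T θ₀ x₀)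

lemma hasDerivAt_arc_snd {s : ℝ} (hq : q ∈ Metric.ball (0, θ₀, x₀) B.r)
    (hs : s ∈ Ioo (-B.η) (T + B.η)) :
    HasDerivAt (fun s => (B.arc s q).2) (h (q.2.1 + κ * s, B.arc s q, q.1)).2 s :=
  (B.hasDerivAt_arc hq hs).snd

lemma velocity_zero_neg (hq : q ∈ Metric.ball (0, θ₀, x₀) B.r) :
    (h (q.2.1, (q.2.2, 0), q.1)).2 < 0 := by
  have hτ := B.τ_mem hq
  have hzero := B.Ico_subset ⟨le_rfl, hτ.1.trans_lt hτ.2⟩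
  have hdown : deriv (fun s => (B.arc s q).2) 0 < 0 := (B.isFirstReturn q hq).down
  rw [(B.hasDerivAt_arc_snd hq hzero).deriv] at hdown
  simpa only [mul_zero, add_zero, B.arc_zero] using hdown

lemma velocity_τ_pos (hq : q ∈ Metric.ball (0, θ₀, x₀) B.r) :
    0 < (h (q.2.1 + κ * B.τ q, (B.exitPoint q, 0), q.1)).2 := by
  rw [← B.arc_τ hq, ← (B.hasDerivAt_arc_snd hq (B.Ico_subset (B.τ_mem hq))).deriv]
  exact (B.isFirstReturn q hq).up

lemma field_flow_pos (hp : IsPerturbation h F g D ε₀)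
    (hq : ((0 : ℝ), θ, x) ∈ Metric.ball ((0 : ℝ), θ₀, x₀) B.r) (hx : halfReturnTime F D x = T) :
    0 < (F (flow F D T (x, 0))).2 := by
  have hτ := B.τ_mem hq
  have hup := B.velocity_τ_pos hq
  rw [← B.arc_τ hq, B.τ_eq hp hq, hx] at hup
  rw [B.τ_eq hp hq, hx] at hτ
  rw [B.flow_eq_arc hp hq hτ, ← hp.zero (θ + κ * T) _ (B.arc_mem hq (B.Ico_subset hτ))]
  exact hup

lemma hasDerivAt_arc_τ (hp : IsPerturbation h F g D ε₀)
    (hq : ((0 : ℝ), θ, x) ∈ Metric.ball ((0 : ℝ), θ₀, x₀) B.r) (hx : halfReturnTime F D x = T)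
    (hτ : DifferentiableAt ℝ B.τ (0, θ, x)) :
    HasDerivAt (fun ε => B.arc (B.τ (ε, θ, x)) (ε, θ, x))
      (fderiv ℝ B.τ (0, θ, x) (1, 0) • F (flow F D T (x, 0)) +
        Y F D T (x, 0) (∫ t in (0 : ℝ)..T,
          (Y F D t (x, 0)).inverse (g (θ + κ * t) (flow F D t (x, 0))))) 0 := by
  have hτT : B.τ (0, θ, x) = T := (B.τ_eq hp hq).trans hx
  have hT : T ∈ Ico 0 (T + B.η) := by simpa only [hτT] using B.τ_mem hq
  set Φ : ℝ × ℝ → Plane := fun p => B.arc p.1 (p.2, θ, x)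
  have hΦ : HasFDerivAt Φ (fderiv ℝ Φ (T, 0)) (T, 0) :=
    ((B.contDiff_arc.comp (f := fun p : ℝ × ℝ => (p.1, (p.2, θ, x))) (by fun_prop)).differentiable
      two_ne_zero _).hasFDerivAt
  have htime : fderiv ℝ Φ (T, 0) (1, 0) = F (flow F D T (x, 0)) := by
    rw [B.flow_eq_arc hp hq hT, ← hp.zero (θ + κ * T) _ (B.arc_mem hq (B.Ico_subset hT))]
    exact (hasDerivAt_comp_prodMk hΦ.differentiableAt).unique
      (B.hasDerivAt_arc hq (B.Ico_subset hT))
  have hparameter : fderiv ℝ Φ (T, 0) (0, 1) = Y F D T (x, 0) (∫ t in (0 : ℝ)..T,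
      (Y F D t (x, 0)).inverse (g (θ + κ * t) (flow F D t (x, 0)))) := by
    rw [← B.fderiv_curve_parameter hp hT.1 (B.mem_ball hq)]
    exact (hΦ.comp_hasDerivAt (f := fun ε => (T, ε)) 0
      ((hasDerivAt_const _ _).prodMk (hasDerivAt_id _))).unique
      (((B.contDiff_curve T).differentiable two_ne_zero _).hasFDerivAt.comp_hasDerivAt
        (f := fun ε => (θ, ((x, 0) : Plane), ε)) 0
        ((hasDerivAt_const _ _).prodMk ((hasDerivAt_const _ _).prodMk (hasDerivAt_id _))))
  rw [← hτT] at hΦ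
  refine (hΦ.comp_hasDerivAt (f := fun ε => (B.τ (ε, θ, x), ε)) 0
    ((hasDerivAt_comp_prodMk hτ).prodMk (hasDerivAt_id _))).congr_deriv ?_
  rw [hτT, ← htime, ← hparameter, ← map_smul, ← map_add]
  simp

theorem fderiv_exitPoint (hp : IsPerturbation h F g D ε₀)
    (hq : ((0 : ℝ), θ, x) ∈ Metric.ball ((0 : ℝ), θ₀, x₀) B.r) (hx : halfReturnTime F D x = T)
    (hτ : DifferentiableAt ℝ B.τ (0, θ, x)) :
    fderiv ℝ B.exitPoint (0, θ, x) (1, 0) =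
      -wedge (F (flow F D T (x, 0))) (Y F D T (x, 0) (∫ t in (0 : ℝ)..T,
        (Y F D t (x, 0)).inverse (g (θ + κ * t) (flow F D t (x, 0))))) /
        (F (flow F D T (x, 0))).2 := by
  have harc := B.hasDerivAt_arc_τ hp hq hx hτ
  have hpos := B.field_flow_pos hp hq hx
  generalize Y F D T (x, 0) _ = v at harc ⊢
  have hexit : DifferentiableAt ℝ B.exitPoint (0, θ, x) := differentiableAt_fst.comp _
    ((B.contDiff_arc.differentiable two_ne_zero _).comp (f := fun q => (B.τ q, q)) _
      (hτ.prodMk differentiableAt_id))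
  have hfst := (hasDerivAt_comp_prodMk hexit).unique harc.fst
  have hsnd : HasDerivAt (fun ε => (B.arc (B.τ (ε, θ, x)) (ε, θ, x)).2) _ 0 := harc.snd
  have hzero := hsnd.unique <| by
    refine (hasDerivAt_const (0 : ℝ) (0 : ℝ)).congr_of_eventuallyEq ?_
    have hcont : ContinuousAt (fun ε : ℝ => (ε, θ, x)) 0 := by fun_prop
    filter_upwards [hcont.preimage_mem_nhds (Metric.isOpen_ball.mem_nhds hq)] with ε hε
      using congrArg Prod.snd (B.arc_τ hε)
  rw [hfst, eq_div_iff hpos.ne', wedge]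
  simp only [Prod.fst_add, Prod.smul_fst, Prod.snd_add, Prod.smul_snd, smul_eq_mul] at hzero ⊢
  linear_combination (F (flow F D T (x, 0))).1 * hzero

end ReturnArc

section Fields

variable {F : Plane → Plane} {G : ℝ → Plane → Plane} {H : ℝ → Plane → ℝ → Plane} {D : Set Plane}
  {ε₀ : ℝ} {n : WithTop ℕ∞}

lemma contDiff_R : ContDiff ℝ n R := by
  unfold R
  fun_prop

lemma R_R (z : Plane) : R (R z) = z := by
  simp [R]

theorem isPerturbation_perturbedField (hD : IsOpen D) (hε₀ : 0 < ε₀) (hF : ContDiffOn ℝ 2 F D)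
    (hG : ContDiffOn ℝ 2 (fun p : ℝ × Plane => G p.1 p.2) (univ ×ˢ D))
    (hH : ContDiffOn ℝ 2 (fun p : ℝ × Plane × ℝ => H p.1 p.2.1 p.2.2)
      (univ ×ˢ D ×ˢ Ioo (-ε₀) ε₀)) :
    IsPerturbation (fun e => perturbedField F G H e.2.2 e.1 e.2.1) F G D ε₀ where
  isOpen := hD
  pos := hε₀
  contDiffOn := by
    have hF' : ContDiffOn ℝ 2 (fun e : ℝ × Plane × ℝ => F e.2.1) (univ ×ˢ D ×ˢ Ioo (-ε₀) ε₀) :=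
      hF.comp (f := fun e : ℝ × Plane × ℝ => e.2.1) (by fun_prop) fun e he => he.2.1
    have hG' : ContDiffOn ℝ 2 (fun e : ℝ × Plane × ℝ => G e.1 e.2.1)
        (univ ×ˢ D ×ˢ Ioo (-ε₀) ε₀) :=
      hG.comp (f := fun e : ℝ × Plane × ℝ => (e.1, e.2.1)) (by fun_prop)
        fun e he => ⟨mem_univ _, he.2.1⟩
    have hε : ContDiffOn ℝ 2 (fun e : ℝ × Plane × ℝ => e.2.2) (univ ×ˢ D ×ˢ Ioo (-ε₀) ε₀) := by
      fun_prop
    exact (hF'.add (hε.smul hG')).add ((hε.pow 2).smul hH)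
  zero t z _ := by simp [perturbedField]
  first t z hz := by
    have hH' : DifferentiableAt ℝ (H t z) 0 :=
      ((hH.comp (f := fun ε : ℝ => (t, z, ε)) (by fun_prop)
        fun ε hε => ⟨mem_univ _, hz, hε⟩).contDiffAt
          (Ioo_mem_nhds (neg_lt_zero.2 hε₀) hε₀)).differentiableAt two_ne_zero
    exact ((((hasDerivAt_id (0 : ℝ)).smul_const (G t z)).const_add (F z)).add
      (((hasDerivAt_id (0 : ℝ)).pow 2).smul hH'.hasDerivAt)).congr_deriv (by simp)

/-- The time-dependent analogue `-R (G (t, R z))` of `upperField`. Reversing time and reflecting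
turns solutions of `z' = G (t, z)` into solutions of `z' = reflectField G (-t, z)`. -/
def reflectField (G : ℝ → Plane → Plane) (t : ℝ) (z : Plane) : Plane := -R (G t (R z))

/-- `reflectField` for fields depending on a parameter. -/
def reflectFamily (H : ℝ → Plane → ℝ → Plane) (t : ℝ) (z : Plane) (ε : ℝ) : Plane :=
  -R (H t (R z) ε)

lemma contDiffOn_reflectField (hDR : ∀ z ∈ D, R z ∈ D)
    (hG : ContDiffOn ℝ n (fun p : ℝ × Plane => G p.1 p.2) (univ ×ˢ D)) :
    ContDiffOn ℝ n (fun p : ℝ × Plane => reflectField G p.1 p.2) (univ ×ˢ D) :=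
  (contDiff_R.comp_contDiffOn (hG.comp (f := fun p : ℝ × Plane => (p.1, R p.2))
    (contDiff_fst.prodMk (contDiff_R.comp contDiff_snd)).contDiffOn
      fun _ hp => ⟨mem_univ _, hDR _ hp.2⟩)).neg

lemma contDiffOn_reflectFamily {J : Set ℝ} (hDR : ∀ z ∈ D, R z ∈ D)
    (hH : ContDiffOn ℝ n (fun p : ℝ × Plane × ℝ => H p.1 p.2.1 p.2.2) (univ ×ˢ D ×ˢ J)) :
    ContDiffOn ℝ n (fun p : ℝ × Plane × ℝ => reflectFamily H p.1 p.2.1 p.2.2)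
      (univ ×ˢ D ×ˢ J) :=
  (contDiff_R.comp_contDiffOn (hH.comp (f := fun p : ℝ × Plane × ℝ => (p.1, R p.2.1, p.2.2))
    (contDiff_fst.prodMk ((contDiff_R.comp (contDiff_fst.comp contDiff_snd)).prodMk
      (contDiff_snd.comp contDiff_snd))).contDiffOn
      fun _ hp => ⟨mem_univ _, hDR _ hp.2.1, hp.2.2⟩)).neg

lemma perturbedField_upperField (ε t : ℝ) (z : Plane) :
    perturbedField (upperField F) G H ε t z =
      -R (perturbedField F (reflectField G) (reflectFamily H) ε t (R z)) := by
  ext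
  · simp only [perturbedField, upperField, reflectField, reflectFamily, R, Prod.fst_add,
      Prod.smul_fst, Prod.fst_neg, neg_neg, smul_eq_mul]
    ring
  · simp only [perturbedField, upperField, reflectField, reflectFamily, R, Prod.snd_add,
      Prod.smul_snd, Prod.snd_neg, neg_neg, smul_eq_mul]

lemma perturbedField_add_period {T ε : ℝ} (hε : ε ∈ Ioo (-ε₀) ε₀)
    (hG : ∀ t, ∀ z ∈ D, G (t + T) z = G t z)
    (hH : ∀ t, ∀ z ∈ D, ∀ ε ∈ Ioo (-ε₀) ε₀, H (t + T) z ε = H t z ε) (t : ℝ) (z : Plane)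
    (hz : z ∈ D) : perturbedField F G H ε (t + T) z = perturbedField F G H ε t z := by
  simp only [perturbedField, hG t z hz, hH t z hz ε hε]

end Fields

/-! ### The Melnikov function -/

section Melnikov

variable {F : Plane → Plane} {Gp Gm : ℝ → Plane → Plane} {hm hp : ℝ × Plane × ℝ → Plane}
  {D : Set Plane} {ε₀ σ θ₀ x₀ : ℝ}

/-- The lower arc `A` and the reflected, time-reversed upper arc `B` with parameters
`q = (ε, θ, x)` together form a closed orbit of period `2 σ`. -/
def Closes (A : ReturnArc hm D 1 σ θ₀ x₀) (B : ReturnArc hp D (-1) σ θ₀ x₀) (q : ℝ × ℝ × ℝ) :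
    Prop :=
  A.τ q + B.τ q = 2 * σ ∧ A.exitPoint q = B.exitPoint q

variable (A : ReturnArc hm D 1 σ θ₀ x₀) (B : ReturnArc hp D (-1) σ θ₀ x₀)

lemma eventually_mem_ball {r : ℝ} (hr : 0 < r) :
    ∀ᶠ b : ℝ × ℝ in 𝓝 (θ₀, x₀), ((0 : ℝ), b) ∈ Metric.ball ((0 : ℝ), θ₀, x₀) r :=
  (Continuous.prodMk_right (0 : ℝ)).continuousAt.preimage_mem_nhds (Metric.ball_mem_nhds _ hr)

lemma ReturnArc.intervalIntegrable_inverse_Y {h : ℝ × Plane × ℝ → Plane} {g : ℝ → Plane → Plane}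
    {κ θ x : ℝ} (A : ReturnArc h D κ σ θ₀ x₀) (hA : IsPerturbation h F g D ε₀) (hσ : 0 ≤ σ)
    (hq : ((0 : ℝ), θ, x) ∈ Metric.ball ((0 : ℝ), θ₀, x₀) A.r) :
    IntervalIntegrable (fun t => (Y F D t (x, 0)).inverse
      (g (θ + κ * t) (flow F D t (x, 0)))) volume 0 σ :=
  ContinuousOn.intervalIntegrable <| by
    rw [uIcc_of_le hσ]
    exact A.continuousOn_inverse_Y hA (A.mem_ball hq)

lemma wedge_sub (a b c : Plane) : wedge a (b - c) = wedge a b - wedge a c := by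
  simp only [wedge, Prod.fst_sub, Prod.snd_sub]
  ring

include A B in
lemma melnikov_eq_sub (hA : IsPerturbation hm F Gm D ε₀)
    (hB : IsPerturbation hp F (reflectField Gp) D ε₀) {θ x : ℝ} (hσ : 0 ≤ σ)
    (hx : halfReturnTime F D x = σ)
    (hqA : ((0 : ℝ), θ, x) ∈ Metric.ball ((0 : ℝ), θ₀, x₀) A.r)
    (hqB : ((0 : ℝ), θ, x) ∈ Metric.ball ((0 : ℝ), θ₀, x₀) B.r) :
    melnikov F D Gp Gm θ x =
      wedge (F (flow F D σ (x, 0))) (Y F D σ (x, 0) (∫ t in (0 : ℝ)..σ,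
        (Y F D t (x, 0)).inverse (Gm (θ + 1 * t) (flow F D t (x, 0))))) -
      wedge (F (flow F D σ (x, 0))) (Y F D σ (x, 0) (∫ t in (0 : ℝ)..σ,
        (Y F D t (x, 0)).inverse (reflectField Gp (θ + -1 * t) (flow F D t (x, 0))))) := by
  rw [← wedge_sub, ← map_sub, ← intervalIntegral.integral_sub
    (A.intervalIntegrable_inverse_Y hA hσ hqA) (B.intervalIntegrable_inverse_Y hB hσ hqB),
    melnikov, hx, orbit, if_pos hσ]
  congr 2
  refine intervalIntegral.integral_congr fun t ht => ?_
  rw [uIcc_of_le hσ] at ht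
  rw [← map_sub, orbit, if_pos ht.1, reversibilityDefect, reflectField, sub_neg_eq_add, one_mul,
    neg_one_mul, add_comm t, add_comm (-t)]

theorem eventually_fderiv_exitPoint_sub (hA : IsPerturbation hm F Gm D ε₀)
    (hB : IsPerturbation hp F (reflectField Gp) D ε₀) (hσ : 0 ≤ σ)
    (hx₀ : halfReturnTime F D x₀ = σ) :
    ∀ᶠ θ in 𝓝 θ₀, fderiv ℝ (A.exitPoint - B.exitPoint) (0, θ, x₀) (1, 0) =
      -melnikov F D Gp Gm θ x₀ / (F (flow F D σ (x₀, 0))).2 := by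
  have hsmooth := (A.contDiffAt_exitPoint.eventually (by simp)).and
    ((B.contDiffAt_exitPoint.eventually (by simp)).and
    ((A.contDiffAt_τ.eventually (by simp)).and (B.contDiffAt_τ.eventually (by simp))))
  have htend : Tendsto (fun θ : ℝ => ((0 : ℝ), θ, x₀)) (𝓝 θ₀) (𝓝 (0, θ₀, x₀)) :=
    (by fun_prop : Continuous fun θ : ℝ => ((0 : ℝ), θ, x₀)).tendsto θ₀
  filter_upwards [htend.eventually hsmooth, htend (Metric.ball_mem_nhds _ A.r_pos),
    htend (Metric.ball_mem_nhds _ B.r_pos)] with θ ⟨hexitA, hexitB, hτA, hτB⟩ hqA hqB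
  rw [fderiv_sub (hexitA.differentiableAt two_ne_zero) (hexitB.differentiableAt two_ne_zero),
    sub_apply, A.fderiv_exitPoint hA hqA hx₀ (hτA.differentiableAt two_ne_zero),
    B.fderiv_exitPoint hB hqB hx₀ (hτB.differentiableAt two_ne_zero), ← sub_div,
    melnikov_eq_sub A B hA hB hσ hx₀ hqA hqB]
  ring

end Melnikov

section ClosingBranch

variable {F : Plane → Plane} {Gp Gm : ℝ → Plane → Plane} {h hm hp : ℝ × Plane × ℝ → Plane}
  {g : ℝ → Plane → Plane} {D : Set Plane} {κ T ε₀ σ θ₀ x₀ : ℝ}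

theorem IsTransverseReturn.nonempty_returnArc (hret : IsTransverseReturn F D x₀ T)
    (hpert : IsPerturbation h F g D ε₀) : Nonempty (ReturnArc h D κ T θ₀ x₀) := by
  obtain ⟨c, hc⟩ := hret.exists_solution
  obtain ⟨hc0, hderiv⟩ := (isSolutionCurve_iff hret.pos.le).1 hc
  obtain ⟨A⟩ := exists_arcFlow (κ := κ) (θ := θ₀) (ε := 0) hpert.isOpen_domain (fun _ he => he.2.1)
    hpert.contDiffOn hret.pos.le fun t ht =>
      ⟨hpert.mem_domain (hderiv t ht).1, (hpert.zero _ _ (hderiv t ht).1).symm ▸ (hderiv t ht).2⟩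
  rw [hc0] at A
  exact A.nonempty_returnArc hpert hret

lemma fderiv_apply_of_eventuallyEq_comp_snd {S : ℝ × ℝ × ℝ → ℝ} {ψ : ℝ → ℝ} {ψ' : ℝ} {a : ℝ × ℝ}
    (hS : DifferentiableAt ℝ S (0, a)) (hψ : HasDerivAt ψ ψ' a.2)
    (h : ∀ᶠ b in 𝓝 a, S (0, b) = ψ b.2) (v : ℝ × ℝ) : fderiv ℝ S (0, a) (0, v) = v.2 * ψ' := by
  have hcomp : HasFDerivAt (fun b : ℝ × ℝ => S (0, b)) (fderiv ℝ S (0, a) ∘L .inr ℝ ℝ (ℝ × ℝ)) a :=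
    hS.hasFDerivAt.comp a (hasFDerivAt_prodMk_right 0 a)
  have hsnd := (hψ.hasFDerivAt.comp a hasFDerivAt_snd).congr_of_eventuallyEq h
  simpa using DFunLike.congr_fun (hcomp.unique hsnd) v

variable (A : ReturnArc hm D 1 σ θ₀ x₀) (B : ReturnArc hp D (-1) σ θ₀ x₀)

lemma eventually_τ_add (hA : IsPerturbation hm F Gm D ε₀)
    (hB : IsPerturbation hp F (reflectField Gp) D ε₀) :
    ∀ᶠ b in 𝓝 (θ₀, x₀), A.τ (0, b) + B.τ (0, b) = 2 * halfReturnTime F D b.2 := by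
  filter_upwards [eventually_mem_ball A.r_pos, eventually_mem_ball B.r_pos] with b hbA hbB
  rw [A.τ_eq hA hbA, B.τ_eq hB hbB, two_mul]

lemma eventually_exitPoint_eq (hA : IsPerturbation hm F Gm D ε₀)
    (hB : IsPerturbation hp F (reflectField Gp) D ε₀) :
    ∀ᶠ b in 𝓝 (θ₀, x₀), A.exitPoint (0, b) = B.exitPoint (0, b) := by
  filter_upwards [eventually_mem_ball A.r_pos, eventually_mem_ball B.r_pos] with b hbA hbB
  rw [A.exitPoint_eq hA hbA, B.exitPoint_eq hB hbB]

theorem exists_unique_closes (hA : IsPerturbation hm F Gm D ε₀)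
    (hB : IsPerturbation hp F (reflectField Gp) D ε₀) (hret : IsTransverseReturn F D x₀ σ)
    (hσ' : deriv (halfReturnTime F D) x₀ ≠ 0) (hM : melnikov F D Gp Gm θ₀ x₀ = 0)
    (hM' : deriv (fun θ => melnikov F D Gp Gm θ x₀) θ₀ ≠ 0) :
    ∃ C > 0, ∃ ρ > 0, ∃ ε₁ > 0, ∀ ε ∈ Ioo 0 ε₁, ∃ b, ‖b - (θ₀, x₀)‖ ≤ C * ε ∧
      Closes A B (ε, b) ∧ ∀ b' ∈ Metric.ball (θ₀, x₀) ρ, Closes A B (ε, b') → b' = b := by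
  have hσ := hret.halfReturnTime_eq
  set S : ℝ × ℝ × ℝ → ℝ := fun q => A.τ q + B.τ q - 2 * σ
  have hS : ContDiffAt ℝ 2 S (0, θ₀, x₀) :=
    (A.contDiffAt_τ.add B.contDiffAt_τ).sub contDiffAt_const
  have hS0 : ∀ᶠ b in 𝓝 (θ₀, x₀), S (0, b) = 2 * halfReturnTime F D b.2 - 2 * σ :=
    (eventually_τ_add A B hA hB).mono fun _ hb => congrArg (· - 2 * σ) hb
  have hSv := fderiv_apply_of_eventuallyEq_comp_snd (hS.differentiableAt two_ne_zero)
    (((differentiableAt_of_deriv_ne_zero hσ').hasDerivAt.const_mul 2).sub_const (2 * σ)) hS0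
  have hmel := eventually_fderiv_exitPoint_sub A B hA hB hret.pos.le hσ
  have hbranch := exists_unique_branch (S := S) (P := A.exitPoint - B.exitPoint)
    (hS.of_le one_le_two) (A.contDiffAt_exitPoint.sub B.contDiffAt_exitPoint)
    (by rw [hS0.self_of_nhds, hσ, sub_self])
    (by rw [hSv, zero_mul])
    (by rw [hSv, one_mul]; exact mul_ne_zero two_ne_zero hσ')
    ((eventually_exitPoint_eq A B hA hB).mono fun _ hb => sub_eq_zero.2 hb)
    (by rw [hmel.self_of_nhds, hM, neg_zero, zero_div])
    (by rw [EventuallyEq.deriv_eq hmel, deriv_div_const, deriv.fun_neg]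
        exact div_ne_zero (neg_ne_zero.2 hM') hret.up.ne')
  simpa only [S, Pi.sub_apply, sub_eq_zero, Closes] using hbranch

theorem exists_isolated_closes (hA : IsPerturbation hm F Gm D ε₀)
    (hB : IsPerturbation hp F (reflectField Gp) D ε₀) (hret : IsTransverseReturn F D x₀ σ)
    (hσ' : deriv (halfReturnTime F D) x₀ ≠ 0) (hM : melnikov F D Gp Gm θ₀ x₀ = 0)
    (hM' : deriv (fun θ => melnikov F D Gp Gm θ x₀) θ₀ ≠ 0) :
    ∃ C > 0, ∃ ε₁ > 0, ε₁ ≤ ε₀ ∧ ∀ ε ∈ Ioo 0 ε₁, ∃ b, ‖b - (θ₀, x₀)‖ ≤ C * ε ∧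
      (ε, b) ∈ Metric.ball (0, θ₀, x₀) A.r ∧ (ε, b) ∈ Metric.ball (0, θ₀, x₀) B.r ∧
      Closes A B (ε, b) ∧ ∀ᶠ b' in 𝓝 b, Closes A B (ε, b') → b' = b := by
  obtain ⟨C, hC, ρ, hρ, ε₁, hε₁, hclose⟩ := exists_unique_closes A B hA hB hret hσ' hM hM'
  set r := min ρ (min A.r B.r)
  have hr : 0 < r := lt_min hρ (lt_min A.r_pos B.r_pos)
  refine ⟨C, hC, min (min ε₁ ε₀) (min r (r / C)), lt_min (lt_min hε₁ hA.pos) (by positivity),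
    (min_le_left _ _).trans (min_le_right _ _), fun ε ⟨hε, hε'⟩ => ?_⟩
  obtain ⟨⟨hεε₁, -⟩, hεr, hεC⟩ := by simpa only [lt_min_iff] using hε'
  obtain ⟨b, hb, hcl, huniq⟩ := hclose ε ⟨hε, hεε₁⟩
  have hbr : dist b (θ₀, x₀) < r :=
    (dist_eq_norm b _).trans_lt (hb.trans_lt ((lt_div_iff₀' hC).1 hεC))
  have hq : dist (ε, b) (0, θ₀, x₀) < r :=
    max_lt (by rwa [Real.dist_0_eq_abs, abs_of_pos hε]) hbr
  have hrAB : r ≤ min A.r B.r := min_le_right _ _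
  exact ⟨b, hb, hq.trans_le (hrAB.trans (min_le_left _ _)),
    hq.trans_le (hrAB.trans (min_le_right _ _)), hcl,
    mem_of_superset (Metric.isOpen_ball.mem_nhds (hbr.trans_le (min_le_left _ _))) huniq⟩

end ClosingBranch

/-! ### Filippov solutions near a crossing cycle -/

section Filippov

variable {Xp Xm A B X : ℝ → Plane → Plane} {D S : Set Plane} {u w : ℝ → Plane}
  {a b c d e t K m : ℝ} {z z₀ : Plane} {L : ℝ≥0}

/-- `u` is an absolutely continuous solution of the Filippov inclusion of `(Xp, Xm)`. -/
def IsFilippovCurve (Xp Xm : ℝ → Plane → Plane) (u : ℝ → Plane) : Prop :=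
  ∃ v : ℝ → Plane, (∀ a b : ℝ, IntervalIntegrable v volume a b) ∧
    (∀ a b : ℝ, u b - u a = ∫ t in a..b, v t) ∧
    ∀ᵐ t : ℝ, v t ∈ filippovSet Xp Xm t (u t)

lemma filippovSet_subset (hS : Convex ℝ S) (hp : Xp t z ∈ S) (hm : Xm t z ∈ S) :
    filippovSet Xp Xm t z ⊆ S := by
  rintro v (⟨-, rfl⟩ | ⟨-, rfl⟩ | ⟨-, hv⟩)
  exacts [hp, hm, hS.segment_subset hp hm hv]

lemma eq_of_mem_filippovSet_of_neg {v : Plane} (hv : v ∈ filippovSet Xp Xm t z) (hz : z.2 < 0) :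
    v = Xm t z := by
  rcases hv with ⟨h, -⟩ | ⟨-, h⟩ | ⟨h, -⟩
  exacts [absurd h hz.not_gt, h, absurd h hz.ne]

lemma eq_of_mem_filippovSet_of_pos {v : Plane} (hv : v ∈ filippovSet Xp Xm t z) (hz : 0 < z.2) :
    v = Xp t z := by
  rcases hv with ⟨-, h⟩ | ⟨h, -⟩ | ⟨h, -⟩
  exacts [h, absurd h hz.not_gt, absurd h hz.ne']

lemma IsFilippovCurve.continuous (hu : IsFilippovCurve Xp Xm u) : Continuous u := by
  obtain ⟨v, hv, hint, -⟩ := hu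
  have hu : u = fun t => u 0 + ∫ s in (0 : ℝ)..t, v s :=
    funext fun t => by rw [← hint 0 t, add_sub_cancel]
  rw [hu]
  exact continuous_const.add (intervalIntegral.continuous_primitive hv 0)

lemma IsFilippovCurve.dist_le (hu : IsFilippovCurve Xp Xm u) (hab : a ≤ b)
    (hK : ∀ t ∈ Icc a b, ‖Xp t (u t)‖ ≤ K ∧ ‖Xm t (u t)‖ ≤ K) :
    dist (u a) (u b) ≤ K * (b - a) := by
  obtain ⟨v, -, hint, hae⟩ := hu
  have hle : ∀ᵐ t, t ∈ uIoc a b → ‖v t‖ ≤ K := by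
    filter_upwards [hae] with t ht htab
    rw [uIoc_of_le hab] at htab
    obtain ⟨hp, hm⟩ := hK t (Ioc_subset_Icc_self htab)
    exact mem_closedBall_zero_iff.1 (filippovSet_subset (convex_closedBall 0 K)
      (mem_closedBall_zero_iff.2 hp) (mem_closedBall_zero_iff.2 hm) ht)
  have hnorm := intervalIntegral.norm_integral_le_of_norm_le_const_ae hle
  rwa [abs_of_nonneg (sub_nonneg.2 hab), ← hint, ← dist_eq_norm, dist_comm] at hnorm

lemma IsFilippovCurve.mul_sub_le (hu : IsFilippovCurve Xp Xm u) (hab : a ≤ b)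
    (hm : ∀ t ∈ Icc a b, m ≤ e * (Xp t (u t)).2 ∧ m ≤ e * (Xm t (u t)).2) :
    m * (b - a) ≤ e * (u b).2 - e * (u a).2 := by
  obtain ⟨v, hv, hint, hae⟩ := hu
  set ℓ : Plane →L[ℝ] ℝ := e • ContinuousLinearMap.snd ℝ ℝ ℝ
  have hae_le : ∀ᵐ t ∂volume.restrict (Icc a b), m ≤ ℓ (v t) := by
    rw [ae_restrict_iff' measurableSet_Icc]
    filter_upwards [hae] with t ht htab
    exact filippovSet_subset (convex_halfSpace_ge ℓ.isLinear m) (hm t htab).1 (hm t htab).2 ht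
  have hℓ : IntervalIntegrable (fun t => ℓ (v t)) volume a b :=
    ⟨ℓ.integrable_comp (hv a b).1, ℓ.integrable_comp (hv a b).2⟩
  calc m * (b - a) = ∫ _ in a..b, m := by
        rw [intervalIntegral.integral_const, smul_eq_mul, mul_comm]
    _ ≤ ∫ t in a..b, ℓ (v t) :=
        intervalIntegral.integral_mono_ae_restrict hab intervalIntegrable_const hℓ hae_le
    _ = ℓ (u b - u a) := by rw [ℓ.intervalIntegral_comp_comm (hv a b), hint]
    _ = e * (u b).2 - e * (u a).2 := map_sub ℓ _ _

lemma hasDerivWithinAt_of_sub_eq_integral {v f : ℝ → Plane}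
    (hint : ∀ a b : ℝ, u b - u a = ∫ t in a..b, v t) (hae : ∀ᵐ t, t ∈ Ioo a b → v t = f t)
    (hf : ContinuousOn f (Icc a b)) (ht : t ∈ Icc a b) :
    HasDerivWithinAt u (f t) (Icc a b) t := by
  have : Fact (t ∈ Icc a b) := ⟨ht⟩
  have hderiv : HasDerivWithinAt (fun t => ∫ s in a..t, f s) (f t) (Icc a b) t :=
    intervalIntegral.integral_hasDerivWithinAt_right
      ((hf.mono (by rw [uIcc_of_le ht.1]; exact Icc_subset_Icc_right ht.2)).intervalIntegrable)
      (hf.stronglyMeasurableAtFilter_nhdsWithin measurableSet_Icc t) (hf t ht)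
  have hu : ∀ s ∈ Icc a b, u s = u a + ∫ r in a..s, f r := fun s hs => by
    have hvf : ∫ r in a..s, v r = ∫ r in a..s, f r := by
      refine intervalIntegral.integral_congr_ae ?_
      filter_upwards [hae, volume.ae_ne b] with r hr hrb hrs
      rw [uIoc_of_le hs.1] at hrs
      exact hr ⟨hrs.1, lt_of_le_of_ne (hrs.2.trans hs.2) hrb⟩
    rw [← hvf, ← hint, add_sub_cancel]
  exact (hderiv.const_add (u a)).congr hu (hu t ht)

lemma continuousOn_field_comp (hX : ContinuousOn (Function.uncurry X) (univ ×ˢ D))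
    (hu : ContinuousOn u (Icc a b)) (huD : ∀ t ∈ Icc a b, u t ∈ D) :
    ContinuousOn (fun t => X t (u t)) (Icc a b) :=
  hX.comp (f := fun t => (t, u t)) (by fun_prop) fun t ht => ⟨mem_univ _, huD t ht⟩

lemma IsFilippovCurve.hasDerivWithinAt_lower (hu : IsFilippovCurve Xp Xm u)
    (hX : ContinuousOn (Function.uncurry Xm) (univ ×ˢ D)) (huD : ∀ t ∈ Icc a b, u t ∈ D)
    (hneg : ∀ t ∈ Ioo a b, (u t).2 < 0) (ht : t ∈ Icc a b) :
    HasDerivWithinAt u (Xm t (u t)) (Icc a b) t := by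
  have hf := continuousOn_field_comp hX hu.continuous.continuousOn huD
  obtain ⟨v, -, hint, hae⟩ := hu
  exact hasDerivWithinAt_of_sub_eq_integral hint
    (hae.mono fun s hs hsab => eq_of_mem_filippovSet_of_neg hs (hneg s hsab)) hf ht

lemma IsFilippovCurve.hasDerivWithinAt_upper (hu : IsFilippovCurve Xp Xm u)
    (hX : ContinuousOn (Function.uncurry Xp) (univ ×ˢ D)) (huD : ∀ t ∈ Icc a b, u t ∈ D)
    (hpos : ∀ t ∈ Ioo a b, 0 < (u t).2) (ht : t ∈ Icc a b) :
    HasDerivWithinAt u (Xp t (u t)) (Icc a b) t := by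
  have hf := continuousOn_field_comp hX hu.continuous.continuousOn huD
  obtain ⟨v, -, hint, hae⟩ := hu
  exact hasDerivWithinAt_of_sub_eq_integral hint
    (hae.mono fun s hs hsab => eq_of_mem_filippovSet_of_pos hs (hpos s hsab)) hf ht

lemma IsFilippovCurve.mem_ball {ρ : ℝ} (hu : IsFilippovCurve Xp Xm u)
    (hK : ∀ t ∈ Icc a b, ∀ z ∈ Metric.ball z₀ ρ, ‖Xp t z‖ ≤ K ∧ ‖Xm t z‖ ≤ K) (hK0 : 0 ≤ K)
    (hstart : dist (u a) z₀ + K * (b - a) < ρ) (ht : t ∈ Icc a b) : u t ∈ Metric.ball z₀ ρ := by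
  have hcont := hu.continuous
  have hball : ∀ s ∈ Icc a b, dist (u a) (u s) ≤ K * (s - a) → dist (u s) z₀ < ρ :=
    fun s hs hdist => by
      have htri := dist_triangle_left (u s) z₀ (u a)
      have hsb := mul_le_mul_of_nonneg_left (sub_le_sub_right hs.2 a) hK0
      linarith
  suffices hdist : Icc a b ⊆ {s | dist (u a) (u s) ≤ K * (s - a)} from hball t ht (hdist ht)
  refine IsClosed.Icc_subset_of_forall_exists_gt
    ((isClosed_le (continuous_const.dist hcont) (by fun_prop)).inter isClosed_Icc) (by simp) ?_
  rintro s ⟨hs, hsab⟩ y hy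
  have hopen : IsOpen (u ⁻¹' Metric.ball z₀ ρ) := Metric.isOpen_ball.preimage hcont
  have hnhds := hopen.mem_nhds (hball s (Ico_subset_Icc_self hsab) hs)
  obtain ⟨t', ht', hsub⟩ := mem_nhdsGE_iff_exists_Icc_subset.1
    (mem_nhdsWithin_of_mem_nhds hnhds)
  set r := min t' (min y b)
  have hsr : s < r := lt_min ht' (lt_min hy hsab.2)
  have hry : r ≤ y := (min_le_right _ _).trans (min_le_left _ _)
  have hrb : r ≤ b := (min_le_right _ _).trans (min_le_right _ _)
  have hstep : dist (u s) (u r) ≤ K * (r - s) := hu.dist_le hsr.le fun x hx =>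
    hK x ⟨hsab.1.trans hx.1, hx.2.trans hrb⟩ _ (hsub ⟨hx.1, hx.2.trans (min_le_left _ _)⟩)
  refine ⟨r, (dist_triangle _ (u s) _).trans ((add_le_add hs hstep).trans_eq ?_), hsr, hry⟩
  ring

lemma dist_le_of_hasDerivWithinAt (hL : ∀ t ∈ Icc a b, LipschitzOnWith L (X t) S)
    (hu : ∀ t ∈ Icc a b, HasDerivWithinAt u (X t (u t)) (Icc a b) t) (huS : ∀ t ∈ Icc a b, u t ∈ S)
    (hw : ∀ t ∈ Icc a b, HasDerivWithinAt w (X t (w t)) (Icc a b) t) (hwS : ∀ t ∈ Icc a b, w t ∈ S)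
    (ht : t ∈ Icc a b) : dist (u t) (w t) ≤ dist (u a) (w a) * Real.exp (L * (t - a)) :=
  dist_le_of_trajectories_ODE_of_mem (v := X) (s := fun _ => S)
    (fun t ht => hL t (Ico_subset_Icc_self ht)) (fun t ht => (hu t ht).continuousWithinAt)
    (fun t ht => (hu t (Ico_subset_Icc_self ht)).mono_of_mem_nhdsWithin (Icc_mem_nhdsGE_of_mem ht))
    (fun t ht => huS t (Ico_subset_Icc_self ht)) (fun t ht => (hw t ht).continuousWithinAt)
    (fun t ht => (hw t (Ico_subset_Icc_self ht)).mono_of_mem_nhdsWithin (Icc_mem_nhdsGE_of_mem ht))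
    (fun t ht => hwS t (Ico_subset_Icc_self ht)) le_rfl t ht

/-- During `[a, b]` the curve `u` moves in `S`, with speed at most `K` and transversely to the
switching line, `e y` increasing at rate at least `m`; it solves `u' = A(t, u)` while `e y < 0` and
`u' = B(t, u)` while `e y > 0`. -/
structure IsTransit (A B : ℝ → Plane → Plane) (S : Set Plane) (e K m a b : ℝ) (u : ℝ → Plane) :
    Prop where
  continuous : Continuous u
  mem : ∀ t ∈ Icc a b, u t ∈ S
  mono : ∀ s ∈ Icc a b, ∀ t ∈ Icc a b, s ≤ t → m * (t - s) ≤ e * (u t).2 - e * (u s).2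
  lip : ∀ s ∈ Icc a b, ∀ t ∈ Icc a b, s ≤ t → dist (u s) (u t) ≤ K * (t - s)
  before : ∀ a' b', a ≤ a' → b' ≤ b → (∀ t ∈ Ioo a' b', e * (u t).2 < 0) →
    ∀ t ∈ Icc a' b', HasDerivWithinAt u (A t (u t)) (Icc a' b') t
  after : ∀ a' b', a ≤ a' → b' ≤ b → (∀ t ∈ Ioo a' b', 0 < e * (u t).2) →
    ∀ t ∈ Icc a' b', HasDerivWithinAt u (B t (u t)) (Icc a' b') t

/-- The time `c` separates the part of `[a, b]` where `e y < 0` from the part where `e y > 0`; one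
of the two may be empty. -/
structure IsSwitch (e a b : ℝ) (u : ℝ → Plane) (c : ℝ) : Prop where
  mem : c ∈ Icc a b
  neg : ∀ t ∈ Ico a c, e * (u t).2 < 0
  pos : ∀ t ∈ Ioc c b, 0 < e * (u t).2
  nonneg : c < b → 0 ≤ e * (u c).2
  nonpos : a < c → e * (u c).2 ≤ 0

lemma exists_isSwitch (hu : Continuous u)
    (hmono : StrictMonoOn (fun t => e * (u t).2) (Icc a b)) (hab : a ≤ b) :
    ∃ c, IsSwitch e a b u c := by
  have ha' : a ∈ Icc a b := left_mem_Icc.2 hab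
  have hb' : b ∈ Icc a b := right_mem_Icc.2 hab
  rcases le_or_gt 0 (e * (u a).2) with ha | ha
  · exact ⟨a, ha', by simp, fun t ht => ha.trans_lt (hmono ha' (Ioc_subset_Icc_self ht) ht.1),
      fun _ => ha, fun h => absurd h (lt_irrefl _)⟩
  rcases le_or_gt (e * (u b).2) 0 with hb | hb
  · exact ⟨b, hb', fun t ht => (hmono (Ico_subset_Icc_self ht) hb' ht.2).trans_le hb, by simp,
      fun h => absurd h (lt_irrefl _), fun _ => hb⟩
  obtain ⟨c, hc, hzero : e * (u c).2 = 0⟩ := intermediate_value_Icc hab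
    (continuous_const.mul (continuous_snd.comp hu)).continuousOn ⟨ha.le, hb.le⟩
  exact ⟨c, hc, fun t ht => (hmono ⟨ht.1, ht.2.le.trans hc.2⟩ hc ht.2).trans_eq hzero,
    fun t ht => hzero.symm.trans_lt (hmono hc ⟨hc.1.trans ht.1.le, ht.2⟩ ht.1),
    fun _ => hzero.ge, fun _ => hzero.le⟩

lemma IsTransit.exists_isSwitch (hu : IsTransit A B S e K m a b u) (hm : 0 < m) (hab : a ≤ b) :
    ∃ c, IsSwitch e a b u c :=
  TwoFold.exists_isSwitch hu.continuous (fun s hs t ht hst =>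
    sub_pos.1 ((mul_pos hm (sub_pos.2 hst)).trans_le (hu.mono s hs t ht hst.le))) hab

lemma IsTransit.mul_switch_sub_le (hw : IsTransit A B S e K m a b w) (he : |e| = 1)
    (hc : IsSwitch e a b u c) (hd : IsSwitch e a b w d) (hcd : c ≤ d) :
    m * (d - c) ≤ dist (u c) (w c) := by
  rcases hcd.eq_or_lt with rfl | hlt
  · simp
  calc m * (d - c) ≤ e * (w d).2 - e * (w c).2 := hw.mono c hc.mem d hd.mem hcd
    _ ≤ e * (u c).2 - e * (w c).2 := sub_le_sub_right
        ((hd.nonpos (hc.mem.1.trans_lt hlt)).trans (hc.nonneg (hlt.trans_le hd.mem.2))) _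
    _ = e * ((u c).2 - (w c).2) := (mul_sub _ _ _).symm
    _ ≤ |(u c).2 - (w c).2| := (le_abs_self _).trans_eq (by rw [abs_mul, he, one_mul])
    _ ≤ dist (u c) (w c) := le_max_right _ _

lemma IsTransit.dist_le_between (hu : IsTransit A B S e K m a b u)
    (hw : IsTransit A B S e K m a b w) (hm : 0 < m) (hK : 0 ≤ K) (he : |e| = 1)
    (hc : IsSwitch e a b u c) (hd : IsSwitch e a b w d) (ht : t ∈ Icc c d) :
    dist (u t) (w t) ≤ (1 + 2 * K / m) * dist (u c) (w c) := by
  have htab : t ∈ Icc a b := ⟨hc.mem.1.trans ht.1, ht.2.trans hd.mem.2⟩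
  have hKt : K * (t - c) ≤ K / m * dist (u c) (w c) := by
    rw [div_mul_eq_mul_div, le_div_iff₀ hm, mul_assoc, mul_comm (t - c)]
    gcongr
    exact (mul_le_mul_of_nonneg_left (sub_le_sub_right ht.2 c) hm.le).trans
      (hw.mul_switch_sub_le he hc hd (ht.1.trans ht.2))
  calc dist (u t) (w t) ≤ dist (u t) (u c) + dist (u c) (w c) + dist (w c) (w t) :=
        dist_triangle4 _ _ _ _
    _ ≤ K * (t - c) + dist (u c) (w c) + K * (t - c) := by
        rw [dist_comm (u t)]
        gcongr
        exacts [hu.lip c hc.mem t htab ht.1, hw.lip c hc.mem t htab ht.1]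
    _ ≤ K / m * dist (u c) (w c) + dist (u c) (w c) + K / m * dist (u c) (w c) := by gcongr
    _ = (1 + 2 * K / m) * dist (u c) (w c) := by ring

lemma IsTransit.dist_le_of_switch_le (hu : IsTransit A B S e K m a b u)
    (hw : IsTransit A B S e K m a b w) (hm : 0 < m) (hK : 0 ≤ K) (he : |e| = 1)
    (hLA : ∀ t ∈ Icc a b, LipschitzOnWith L (A t) S)
    (hLB : ∀ t ∈ Icc a b, LipschitzOnWith L (B t) S)
    (hc : IsSwitch e a b u c) (hd : IsSwitch e a b w d) (hcd : c ≤ d) (ht : t ∈ Icc a b) :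
    dist (u t) (w t) ≤ (1 + 2 * K / m) * (dist (u a) (w a) * Real.exp (L * (t - a))) := by
  have hac : Icc a c ⊆ Icc a b := Icc_subset_Icc_right hc.mem.2
  have hdb : Icc d b ⊆ Icc a b := Icc_subset_Icc_left hd.mem.1
  have hbefore : ∀ t ∈ Icc a c, dist (u t) (w t) ≤ dist (u a) (w a) * Real.exp (L * (t - a)) :=
    fun t => dist_le_of_hasDerivWithinAt (fun t ht => hLA t (hac ht))
      (hu.before a c le_rfl hc.mem.2 fun t ht => hc.neg t ⟨ht.1.le, ht.2⟩)
      (fun t ht => hu.mem t (hac ht))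
      (hw.before a c le_rfl hc.mem.2 fun t ht => hd.neg t ⟨ht.1.le, ht.2.trans_le hcd⟩)
      (fun t ht => hw.mem t (hac ht))
  have hbetween : ∀ t ∈ Icc c d,
      dist (u t) (w t) ≤ (1 + 2 * K / m) * (dist (u a) (w a) * Real.exp (L * (c - a))) :=
    fun t ht => (hu.dist_le_between hw hm hK he hc hd ht).trans
      (by gcongr; exact hbefore c (right_mem_Icc.2 hc.mem.1))
  rcases le_total t c with htc | hct
  · exact (hbefore t ⟨ht.1, htc⟩).trans (le_mul_of_one_le_left (by positivity)
      (le_add_of_nonneg_right (by positivity)))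
  rcases le_total t d with htd | hdt
  · exact (hbetween t ⟨hct, htd⟩).trans (by gcongr)
  calc dist (u t) (w t) ≤ dist (u d) (w d) * Real.exp (L * (t - d)) :=
        dist_le_of_hasDerivWithinAt (fun t ht => hLB t (hdb ht))
          (hu.after d b hd.mem.1 le_rfl fun t ht => hc.pos t ⟨hcd.trans_lt ht.1, ht.2.le⟩)
          (fun t ht => hu.mem t (hdb ht))
          (hw.after d b hd.mem.1 le_rfl fun t ht => hd.pos t ⟨ht.1, ht.2.le⟩)
          (fun t ht => hw.mem t (hdb ht)) ⟨hdt, ht.2⟩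
    _ ≤ (1 + 2 * K / m) * (dist (u a) (w a) * Real.exp (L * (c - a))) *
          Real.exp (L * (t - d)) := by gcongr; exact hbetween d (right_mem_Icc.2 hcd)
    _ = (1 + 2 * K / m) * (dist (u a) (w a) * Real.exp (L * (c - a) + L * (t - d))) := by
        rw [Real.exp_add]
        ring
    _ ≤ _ := by
        rw [← mul_add]
        gcongr
        linarith

lemma IsTransit.dist_le (hu : IsTransit A B S e K m a b u) (hw : IsTransit A B S e K m a b w)
    (hm : 0 < m) (hK : 0 ≤ K) (he : |e| = 1)
    (hLA : ∀ t ∈ Icc a b, LipschitzOnWith L (A t) S)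
    (hLB : ∀ t ∈ Icc a b, LipschitzOnWith L (B t) S) (ht : t ∈ Icc a b) :
    dist (u t) (w t) ≤ (1 + 2 * K / m) * (dist (u a) (w a) * Real.exp (L * (t - a))) := by
  have hab := ht.1.trans ht.2
  obtain ⟨c, hc⟩ := hu.exists_isSwitch hm hab
  obtain ⟨d, hd⟩ := hw.exists_isSwitch hm hab
  rcases le_total c d with hcd | hdc
  · exact hu.dist_le_of_switch_le hw hm hK he hLA hLB hc hd hcd ht
  · rw [dist_comm, dist_comm (u a)]
    exact hw.dist_le_of_switch_le hu hm hK he hLA hLB hd hc hdc ht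

/-- The field on the side of the switching line where `e y < 0`. -/
def beforeField (Xp Xm : ℝ → Plane → Plane) (e : ℝ) : ℝ → Plane → Plane := if 0 < e then Xm else Xp

lemma IsFilippovCurve.isTransit (hu : IsFilippovCurve Xp Xm u)
    (hXp : ContinuousOn (Function.uncurry Xp) (univ ×ˢ S))
    (hXm : ContinuousOn (Function.uncurry Xm) (univ ×ˢ S))
    (huS : ∀ t ∈ Icc a b, u t ∈ S) (he : e ≠ 0)
    (hK : ∀ t ∈ Icc a b, ‖Xp t (u t)‖ ≤ K ∧ ‖Xm t (u t)‖ ≤ K)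
    (hm : ∀ t ∈ Icc a b, m ≤ e * (Xp t (u t)).2 ∧ m ≤ e * (Xm t (u t)).2) :
    IsTransit (beforeField Xp Xm e) (beforeField Xm Xp e) S e K m a b u := by
  refine ⟨hu.continuous, huS,
    fun s hs t ht hst => hu.mul_sub_le hst fun r hr => hm r ⟨hs.1.trans hr.1, hr.2.trans ht.2⟩,
    fun s hs t ht hst => hu.dist_le hst fun r hr => hK r ⟨hs.1.trans hr.1, hr.2.trans ht.2⟩,
    fun a' b' ha' hb' hneg t ht => ?_, fun a' b' ha' hb' hpos t ht => ?_⟩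
  all_goals
    have huS' : ∀ t ∈ Icc a' b', u t ∈ S := fun t ht => huS t ⟨ha'.trans ht.1, ht.2.trans hb'⟩
    unfold beforeField
    split_ifs with h
  · exact hu.hasDerivWithinAt_lower hXm huS'
      (fun t ht => (pos_iff_neg_of_mul_neg (hneg t ht)).1 h) ht
  · exact hu.hasDerivWithinAt_upper hXp huS'
      (fun t ht => (neg_iff_pos_of_mul_neg (hneg t ht)).1 (lt_of_le_of_ne (not_lt.1 h) he)) ht
  · exact hu.hasDerivWithinAt_upper hXp huS' (fun t ht => pos_of_mul_pos_right (hpos t ht) h.le) ht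
  · exact hu.hasDerivWithinAt_lower hXm huS'
      (fun t ht => neg_of_mul_pos_right (hpos t ht) (not_lt.1 h)) ht

end Filippov

section Stability

variable {Xp Xm X : ℝ → Plane → Plane} {D : Set Plane} {w : ℝ → Plane} {K T s ρ : ℝ}
  {z : Plane} {L : ℝ≥0}

/-- Near `(s, z)` both fields are bounded by `K` and `L`-Lipschitz in space. -/
structure IsControlBall (Xp Xm : ℝ → Plane → Plane) (D : Set Plane) (L : ℝ≥0) (K s : ℝ) (z : Plane)
    (ρ : ℝ) : Prop where
  lip_upper : ∀ t ∈ Metric.ball s ρ, LipschitzOnWith L (Xp t) (Metric.ball z ρ)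
  lip_lower : ∀ t ∈ Metric.ball s ρ, LipschitzOnWith L (Xm t) (Metric.ball z ρ)
  subset : Metric.ball z ρ ⊆ D
  norm_le : ∀ t ∈ Metric.ball s ρ, ∀ x ∈ Metric.ball z ρ, ‖Xp t x‖ ≤ K ∧ ‖Xm t x‖ ≤ K

lemma exists_lipschitzOnWith_ball (hX : ContDiffAt ℝ 1 (Function.uncurry X) (s, z)) :
    ∃ L : ℝ≥0, ∀ᶠ ρ in 𝓝[>] (0 : ℝ), ∀ t ∈ Metric.ball s ρ,
      LipschitzOnWith L (X t) (Metric.ball z ρ) := by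
  obtain ⟨L, N, hN, hL⟩ := hX.exists_lipschitzOnWith
  obtain ⟨ρ₀, hρ₀, hball⟩ := Metric.mem_nhds_iff.1 hN
  refine ⟨L, ?_⟩
  filter_upwards [Ioc_mem_nhdsGT hρ₀] with ρ hρ t ht
  have hslice := hL.comp (LipschitzWith.prodMk_left t).lipschitzOnWith fun x hx => hball
    (ball_prod_same s z ρ₀ ▸ ⟨Metric.ball_subset_ball hρ.2 ht, Metric.ball_subset_ball hρ.2 hx⟩)
  rwa [mul_one] at hslice

lemma exists_isControlBall (hD : IsOpen D)
    (hXp : ContDiffOn ℝ 1 (Function.uncurry Xp) (univ ×ˢ D))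
    (hXm : ContDiffOn ℝ 1 (Function.uncurry Xm) (univ ×ˢ D)) (hz : z ∈ D) {P : ℝ × Plane → Prop}
    (hP : ∀ᶠ p in 𝓝 (s, z), P p) :
    ∃ L : ℝ≥0, ∃ K ≥ 0, ∃ ρ > 0, IsControlBall Xp Xm D L K s z ρ ∧
      ∀ t ∈ Metric.ball s ρ, ∀ x ∈ Metric.ball z ρ, P (t, x) := by
  have hnhds : univ ×ˢ D ∈ 𝓝 (s, z) := (isOpen_univ.prod hD).mem_nhds ⟨mem_univ _, hz⟩
  have hCp := hXp.contDiffAt hnhds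
  have hCm := hXm.contDiffAt hnhds
  obtain ⟨Lp, hLp⟩ := exists_lipschitzOnWith_ball hCp
  obtain ⟨Lm, hLm⟩ := exists_lipschitzOnWith_ball hCm
  set K := max (‖Xp s z‖ + 1) (‖Xm s z‖ + 1)
  have hKp := hCp.continuousAt.norm.eventually_lt continuousAt_const
    (lt_max_of_lt_left (lt_add_one _) : _ < K)
  have hKm := hCm.continuousAt.norm.eventually_lt continuousAt_const
    (lt_max_of_lt_right (lt_add_one _) : _ < K)
  obtain ⟨ρ₀, hρ₀, h⟩ := Metric.eventually_nhds_iff_ball.1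
    (((hKp.and hKm).and hP).and (continuousAt_snd.eventually (hD.mem_nhds hz)))
  obtain ⟨ρ, ⟨hρp, hρm⟩, hρ : 0 < ρ, hle⟩ :=
    ((hLp.and hLm).and (Ioc_mem_nhdsGT hρ₀)).exists
  have hmem : ∀ t ∈ Metric.ball s ρ, ∀ x ∈ Metric.ball z ρ, (t, x) ∈ Metric.ball (s, z) ρ₀ :=
    fun t ht x hx => ball_prod_same s z ρ₀ ▸
      ⟨Metric.ball_subset_ball hle ht, Metric.ball_subset_ball hle hx⟩
  refine ⟨max Lp Lm, K, le_max_of_le_left (by positivity), ρ, hρ,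
    ⟨fun t ht => (hρp t ht).weaken (le_max_left _ _),
      fun t ht => (hρm t ht).weaken (le_max_right _ _),
      fun x hx => (h _ (hmem s (Metric.mem_ball_self hρ) x hx)).2, fun t ht x hx => ?_⟩,
    fun t ht x hx => (h _ (hmem t ht x hx)).1.2⟩
  exact (h _ (hmem t ht x hx)).1.1.imp le_of_lt le_of_lt

/-- The distance of a Filippov curve to the reference curve `w` grows at most by a constant factor
over short time intervals starting in `S`, uniformly over all curves close enough to `w`. -/
def StableOn (Xp Xm : ℝ → Plane → Plane) (w : ℝ → Plane) (S : Set ℝ) : Prop :=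
  ∃ η > 0, ∃ C ≥ 1, ∃ δ > 0, ∀ u, IsFilippovCurve Xp Xm u → ∀ a ∈ S, dist (u a) (w a) < δ →
    ∀ b ∈ Icc a (a + η), dist (u b) (w b) ≤ C * dist (u a) (w a)

lemma StableOn.mono {S S' : Set ℝ} (hS : S ⊆ S') : StableOn Xp Xm w S' → StableOn Xp Xm w S := by
  rintro ⟨η, hη, C, hC, δ, hδ, h⟩
  exact ⟨η, hη, C, hC, δ, hδ, fun u hu a ha => h u hu a (hS ha)⟩

lemma StableOn.union {S S' : Set ℝ} :
    StableOn Xp Xm w S → StableOn Xp Xm w S' → StableOn Xp Xm w (S ∪ S') := by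
  rintro ⟨η, hη, C, hC, δ, hδ, h⟩ ⟨η', hη', C', -, δ', hδ', h'⟩
  refine ⟨min η η', lt_min hη hη', max C C', le_max_of_le_left hC, min δ δ', lt_min hδ hδ', ?_⟩
  rintro u hu a (ha | ha) hd b ⟨hab, hb⟩
  · exact (h u hu a ha (hd.trans_le (min_le_left _ _)) b
      ⟨hab, hb.trans (by gcongr; exact min_le_left _ _)⟩).trans (by gcongr; exact le_max_left _ _)
  · exact (h' u hu a ha (hd.trans_le (min_le_right _ _)) b
      ⟨hab, hb.trans (by gcongr; exact min_le_right _ _)⟩).trans (by gcongr; exact le_max_right _ _)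

lemma exists_stableOn_of_forall_ball (hw : IsFilippovCurve Xp Xm w) (hρ : 0 < ρ) (hK : 0 ≤ K)
    (hball : IsControlBall Xp Xm D L K s (w s) ρ) {C : ℝ} (hC : 1 ≤ C)
    (hest : ∀ a b, a ≤ b → b - a ≤ ρ → Icc a b ⊆ Metric.ball s ρ →
      ∀ u v, IsFilippovCurve Xp Xm u → IsFilippovCurve Xp Xm v →
      (∀ t ∈ Icc a b, u t ∈ Metric.ball (w s) ρ) → (∀ t ∈ Icc a b, v t ∈ Metric.ball (w s) ρ) →
      dist (u b) (v b) ≤ C * dist (u a) (v a)) :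
    ∃ N ∈ 𝓝 s, StableOn Xp Xm w N := by
  obtain ⟨r, hr, hwr⟩ := Metric.eventually_nhds_iff_ball.1
    (hw.continuous.continuousAt.eventually (Metric.ball_mem_nhds (w s) (by linarith : 0 < ρ / 4)))
  have hKη : ∀ᶠ η in 𝓝[>] (0 : ℝ), K * η < ρ / 4 :=
    ((continuous_const_mul K).tendsto' 0 0 (mul_zero K)).eventually_lt_const (by linarith)
      |>.filter_mono nhdsWithin_le_nhds
  obtain ⟨η, ⟨⟨hη : 0 < η, hηr⟩, hη2⟩, hKη : K * η < ρ / 4⟩ :=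
    (inter_mem (inter_mem (Ioo_mem_nhdsGT hr) (Ioo_mem_nhdsGT (half_pos hρ))) hKη
      |> Filter.nonempty_of_mem)
  refine ⟨Metric.ball s η, Metric.ball_mem_nhds s hη, η, hη, C, hC, ρ / 4, by linarith,
    fun u hu a ha hd b hb => ?_⟩
  have hsub : Icc a b ⊆ Metric.ball s ρ := fun t ht => by
    rw [Metric.mem_ball, Real.dist_eq, abs_lt] at ha ⊢
    constructor <;> linarith [ht.1, ht.2, hb.2, hη2.2]
  have hwa : dist (w a) (w s) < ρ / 4 := hwr a (Metric.ball_subset_ball hηr.le ha)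
  have hmem : ∀ v, IsFilippovCurve Xp Xm v → dist (v a) (w a) < ρ / 4 →
      ∀ t ∈ Icc a b, v t ∈ Metric.ball (w s) ρ := fun v hv hva t ht =>
    hv.mem_ball (fun t ht => hball.norm_le t (hsub ht)) hK (by
      have hKb : K * (b - a) ≤ K * η := by gcongr; linarith [hb.2]
      linarith [dist_triangle (v a) (w a) (w s)]) ht
  exact hest a b hb.1 (by linarith [hb.2, hη2.2]) hsub u w hu hw (hmem u hu hd)
    (hmem w hw (by rw [dist_self]; linarith))

lemma exists_stableOn_of_snd_ne_zero (hD : IsOpen D)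
    (hXp : ContDiffOn ℝ 1 (Function.uncurry Xp) (univ ×ˢ D))
    (hXm : ContDiffOn ℝ 1 (Function.uncurry Xm) (univ ×ˢ D))
    (hw : IsFilippovCurve Xp Xm w) (hwD : w s ∈ D) (hs : (w s).2 ≠ 0) :
    ∃ N ∈ 𝓝 s, StableOn Xp Xm w N := by
  have hside : ∀ᶠ p : ℝ × Plane in 𝓝 (s, w s), 0 < (w s).2 * p.2.2 :=
    (by fun_prop : ContinuousAt (fun p : ℝ × Plane => (w s).2 * p.2.2) (s, w s)).eventually_const_lt
      (mul_self_pos.2 hs)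
  obtain ⟨L, K, hK, ρ, hρ, hball, hside⟩ := exists_isControlBall hD hXp hXm hwD hside
  refine exists_stableOn_of_forall_ball hw hρ hK hball (C := Real.exp (L * ρ))
    (Real.one_le_exp (by positivity)) fun a b hab hba hsub u v hu hv huρ hvρ => ?_
  obtain ⟨X, hLX, hX⟩ : ∃ X : ℝ → Plane → Plane,
      (∀ t ∈ Metric.ball s ρ, LipschitzOnWith L (X t) (Metric.ball (w s) ρ)) ∧
      ∀ u, IsFilippovCurve Xp Xm u → (∀ t ∈ Icc a b, u t ∈ Metric.ball (w s) ρ) →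
        ∀ t ∈ Icc a b, HasDerivWithinAt u (X t (u t)) (Icc a b) t := by
    rcases hs.lt_or_gt with hneg | hpos
    · exact ⟨Xm, hball.lip_lower, fun u hu huρ t => hu.hasDerivWithinAt_lower hXm.continuousOn
        (fun t ht => hball.subset (huρ t ht)) fun t ht =>
          neg_of_mul_pos_right (hside t (hsub (Ioo_subset_Icc_self ht)) _
            (huρ t (Ioo_subset_Icc_self ht))) hneg.le⟩
    · exact ⟨Xp, hball.lip_upper, fun u hu huρ t => hu.hasDerivWithinAt_upper hXp.continuousOn
        (fun t ht => hball.subset (huρ t ht)) fun t ht =>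
          pos_of_mul_pos_right (hside t (hsub (Ioo_subset_Icc_self ht)) _
            (huρ t (Ioo_subset_Icc_self ht))) hpos.le⟩
  rw [mul_comm]
  refine (dist_le_of_hasDerivWithinAt (fun t ht => hLX t (hsub ht)) (hX u hu huρ) huρ
    (hX v hv hvρ) hvρ (right_mem_Icc.2 hab)).trans ?_
  gcongr

lemma exists_abs_eq_one_mul_pos {x y : ℝ} (h : 0 < x * y) :
    ∃ e : ℝ, |e| = 1 ∧ 0 < e * x ∧ 0 < e * y := by
  rcases mul_pos_iff.1 h with ⟨hx, hy⟩ | ⟨hx, hy⟩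
  · exact ⟨1, by simp, by simpa using hx, by simpa using hy⟩
  · exact ⟨-1, by simp, by simpa using hx, by simpa using hy⟩

lemma exists_eventually_le_mul_snd {e : ℝ} (hXp : ContinuousAt (Function.uncurry Xp) (s, z))
    (hXm : ContinuousAt (Function.uncurry Xm) (s, z)) (hp : 0 < e * (Xp s z).2)
    (hm : 0 < e * (Xm s z).2) :
    ∃ m > 0, ∀ᶠ p : ℝ × Plane in 𝓝 (s, z), m ≤ e * (Xp p.1 p.2).2 ∧ m ≤ e * (Xm p.1 p.2).2 := by
  obtain ⟨m, hm, hlt⟩ := exists_between (lt_min hp hm)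
  have hcont : ∀ {X : ℝ → Plane → Plane}, ContinuousAt (Function.uncurry X) (s, z) →
      ContinuousAt (fun p : ℝ × Plane => e * (X p.1 p.2).2) (s, z) := fun hX =>
    continuousAt_const.mul (continuousAt_snd.comp hX)
  refine ⟨m, hm, ?_⟩
  filter_upwards [(hcont hXp).eventually_const_lt (hlt.trans_le (min_le_left _ _)),
    (hcont hXm).eventually_const_lt (hlt.trans_le (min_le_right _ _))] with p hp hm
  exact ⟨hp.le, hm.le⟩

lemma exists_stableOn_of_crossing (hD : IsOpen D)
    (hXp : ContDiffOn ℝ 1 (Function.uncurry Xp) (univ ×ˢ D))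
    (hXm : ContDiffOn ℝ 1 (Function.uncurry Xm) (univ ×ˢ D))
    (hw : IsFilippovCurve Xp Xm w) (hwD : w s ∈ D) (hpos : 0 < (Xp s (w s)).2 * (Xm s (w s)).2) :
    ∃ N ∈ 𝓝 s, StableOn Xp Xm w N := by
  have hnhds : univ ×ˢ D ∈ 𝓝 (s, w s) := (isOpen_univ.prod hD).mem_nhds ⟨mem_univ _, hwD⟩
  obtain ⟨e, he, hp, hm⟩ := exists_abs_eq_one_mul_pos hpos
  obtain ⟨m, hm, hspeed⟩ := exists_eventually_le_mul_snd
    (hXp.continuousOn.continuousAt hnhds) (hXm.continuousOn.continuousAt hnhds) hp hm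
  obtain ⟨L, K, hK, ρ, hρ, hball, hspeed⟩ := exists_isControlBall hD hXp hXm hwD hspeed
  have hsubD : univ ×ˢ Metric.ball (w s) ρ ⊆ (univ : Set ℝ) ×ˢ D := prod_mono_right hball.subset
  have hLA : ∀ t ∈ Metric.ball s ρ,
      LipschitzOnWith L (beforeField Xp Xm e t) (Metric.ball (w s) ρ) := fun t ht => by
    unfold beforeField
    split_ifs
    exacts [hball.lip_lower t ht, hball.lip_upper t ht]
  have hLB : ∀ t ∈ Metric.ball s ρ,
      LipschitzOnWith L (beforeField Xm Xp e t) (Metric.ball (w s) ρ) := fun t ht => by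
    unfold beforeField
    split_ifs
    exacts [hball.lip_upper t ht, hball.lip_lower t ht]
  refine exists_stableOn_of_forall_ball hw hρ hK hball
    (C := (1 + 2 * K / m) * Real.exp (L * ρ)) (one_le_mul_of_one_le_of_one_le
      (le_add_of_nonneg_right (by positivity)) (Real.one_le_exp (by positivity)))
    fun a b hab hba hsub u v hu hv huρ hvρ => ?_
  have htransit : ∀ u, IsFilippovCurve Xp Xm u → (∀ t ∈ Icc a b, u t ∈ Metric.ball (w s) ρ) →
      IsTransit (beforeField Xp Xm e) (beforeField Xm Xp e) (Metric.ball (w s) ρ) e K m a b u :=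
    fun u hu huρ => hu.isTransit (hXp.continuousOn.mono hsubD) (hXm.continuousOn.mono hsubD) huρ
      (abs_pos.1 (he ▸ one_pos)) (fun t ht => hball.norm_le t (hsub ht) _ (huρ t ht))
      fun t ht => hspeed t (hsub ht) _ (huρ t ht)
  refine ((htransit u hu huρ).dist_le (htransit v hv hvρ) hm hK he (fun t ht => hLA t (hsub ht))
    (fun t ht => hLB t (hsub ht)) (right_mem_Icc.2 hab)).trans ?_
  rw [mul_assoc, mul_comm (Real.exp _)]
  gcongr

lemma IsPeriodicSolution.exists_stableOn_nhds (hw : IsPeriodicSolution Xp Xm D T w)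
    (hcr : IsCrossing Xp Xm w) (hD : IsOpen D)
    (hXp : ContDiffOn ℝ 1 (Function.uncurry Xp) (univ ×ˢ D))
    (hXm : ContDiffOn ℝ 1 (Function.uncurry Xm) (univ ×ˢ D)) (s : ℝ) :
    ∃ N ∈ 𝓝 s, StableOn Xp Xm w N := by
  by_cases hs : (w s).2 = 0
  · exact exists_stableOn_of_crossing hD hXp hXm hw.inclusion (hw.mem s) (hcr s hs)
  · exact exists_stableOn_of_snd_ne_zero hD hXp hXm hw.inclusion (hw.mem s) hs

lemma IsPeriodicSolution.stableOn_Icc (hw : IsPeriodicSolution Xp Xm D T w)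
    (hcr : IsCrossing Xp Xm w) (hD : IsOpen D)
    (hXp : ContDiffOn ℝ 1 (Function.uncurry Xp) (univ ×ˢ D))
    (hXm : ContDiffOn ℝ 1 (Function.uncurry Xm) (univ ×ˢ D)) (a b : ℝ) :
    StableOn Xp Xm w (Icc a b) := by
  refine isCompact_Icc.induction_on
    ⟨1, one_pos, 1, le_rfl, 1, one_pos, fun _ _ a ha => absurd ha (notMem_empty a)⟩
    (fun _ _ => StableOn.mono) (fun _ _ => StableOn.union) fun s _ => ?_
  obtain ⟨N, hN, hstable⟩ := hw.exists_stableOn_nhds hcr hD hXp hXm s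
  exact ⟨N, mem_nhdsWithin_of_mem_nhds hN, hstable⟩

lemma dist_le_pow_mul_of_forall_step {u w : ℝ → Plane} {C δ η t₀ : ℝ} (hC : 1 ≤ C) (hη : 0 < η)
    (hstep : ∀ a, dist (u a) (w a) < δ → ∀ b ∈ Icc a (a + η),
      dist (u b) (w b) ≤ C * dist (u a) (w a))
    (k : ℕ) (hδ : C ^ k * dist (u t₀) (w t₀) < δ) :
    ∀ t ∈ Icc t₀ (t₀ + k * η), dist (u t) (w t) ≤ C ^ k * dist (u t₀) (w t₀) := by
  induction k with
  | zero =>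
    intro t ht
    obtain rfl : t = t₀ := le_antisymm (by simpa using ht.2) ht.1
    simp
  | succ k ih =>
    intro t ht
    have hle : C ^ k * dist (u t₀) (w t₀) ≤ C ^ (k + 1) * dist (u t₀) (w t₀) := by
      gcongr
      exact k.le_succ
    have ih := ih (hle.trans_lt hδ)
    rcases le_total t (t₀ + k * η) with htk | hkt
    · exact (ih t ⟨ht.1, htk⟩).trans hle
    have hk := ih (t₀ + k * η) ⟨le_add_of_nonneg_right (by positivity), le_rfl⟩
    refine (hstep _ ((hk.trans hle).trans_lt hδ) t
      ⟨hkt, ht.2.trans_eq (by push_cast; ring)⟩).trans ?_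
    rw [pow_succ', mul_assoc]
    gcongr

lemma IsPeriodicSolution.forall_dist_lt (hw : IsPeriodicSolution Xp Xm D T w)
    (hcr : IsCrossing Xp Xm w) (hD : IsOpen D) (hT : 0 < T)
    (hXp : ContDiffOn ℝ 1 (Function.uncurry Xp) (univ ×ˢ D))
    (hXm : ContDiffOn ℝ 1 (Function.uncurry Xm) (univ ×ˢ D)) (hρ : 0 < ρ) :
    ∃ δ > 0, ∀ u, IsPeriodicSolution Xp Xm D T u → (∃ t, dist (u t) (w t) < δ) →
      ∀ t, dist (u t) (w t) < ρ := by
  obtain ⟨η, hη, C, hC, δ, hδ, hstable⟩ := hw.stableOn_Icc hcr hD hXp hXm 0 T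
  obtain ⟨n, hn⟩ := exists_nat_gt (T / η)
  rw [div_lt_iff₀ hη] at hn
  have hCn : 0 < C ^ n := by positivity
  refine ⟨min δ ρ / C ^ n, div_pos (lt_min hδ hρ) hCn, fun u hu ⟨t₀, ht₀⟩ t => ?_⟩
  have hup : ∀ t (k : ℤ), u (t - k • T) = u t := fun t k =>
    Function.Periodic.sub_zsmul_eq hu.periodic k
  have hwp : ∀ t (k : ℤ), w (t - k • T) = w t := fun t k =>
    Function.Periodic.sub_zsmul_eq hw.periodic k
  have hstep : ∀ a, dist (u a) (w a) < δ → ∀ b ∈ Icc a (a + η),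
      dist (u b) (w b) ≤ C * dist (u a) (w a) := fun a hd b hb => by
    obtain ⟨k, hk, -⟩ := existsUnique_sub_zsmul_mem_Ico hT a 0
    have hshift := hstable u hu.inclusion (a - k • T) ⟨hk.1, hk.2.le.trans_eq (zero_add T)⟩
      (by rwa [hup, hwp]) (b - k • T) ⟨by linarith [hb.1], by linarith [hb.2]⟩
    rwa [hup, hwp, hup, hwp] at hshift
  rw [lt_div_iff₀ hCn, mul_comm, lt_min_iff] at ht₀
  obtain ⟨k, hk, -⟩ := existsUnique_sub_zsmul_mem_Ico hT t t₀
  rw [← hup t k, ← hwp t k]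
  exact (dist_le_pow_mul_of_forall_step hC hη hstep n ht₀.1 _
    ⟨hk.1, by linarith [hk.2]⟩).trans_lt ht₀.2

end Stability

section PeriodicPrimitive

variable {E : Type*} [NormedAddCommGroup E] [NormedSpace ℝ E] [CompleteSpace E] {f g : ℝ → E}
  {s : Set ℝ} {a T : ℝ}

lemma sub_eq_integral_comp_toIcoMod (hT : 0 < T) (hf : ContinuousOn f (Icc a (a + T)))
    (hfa : f (a + T) = f a) (hs : s.Countable)
    (hderiv : ∀ t ∈ Ioo a (a + T) \ s, HasDerivAt f (g t) t)
    (hg : IntervalIntegrable g volume a (a + T)) :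
    (∀ p q, IntervalIntegrable (g ∘ toIcoMod hT a) volume p q) ∧
      ∀ p q, f (toIcoMod hT a q) - f (toIcoMod hT a p) = ∫ t in p..q, g (toIcoMod hT a t) := by
  set π := toIcoMod hT a
  have hπ : ∀ t ∈ Ico a (a + T), π t = t := fun t ht => (toIcoMod_eq_self hT).2 ht
  have hper : Function.Periodic (g ∘ π) T := (toIcoMod_periodic hT a).comp g
  have hEq : EqOn g (g ∘ π) (Ioo a (a + T)) := fun t ht =>
    congrArg g (hπ t (Ioo_subset_Ico_self ht)).symm
  have hint : ∀ p q, IntervalIntegrable (g ∘ π) volume p q :=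
    hper.intervalIntegrable hT.ne' (hg.congr_uIoo (by rwa [uIoo_of_le (by linarith)]))
  have hprim : ∀ t ∈ Icc a (a + T), ∫ s in a..t, (g ∘ π) s = f t - f a := fun t ht => by
    rw [intervalIntegral.integral_congr_Ioo_of_le ht.1
      (hEq.symm.mono (Ioo_subset_Ioo_right ht.2))]
    exact integral_eq_of_hasDerivAt_off_countable_of_le f g ht.1 hs
      (hf.mono (Icc_subset_Icc_right ht.2))
      (fun r hr => hderiv r ⟨⟨hr.1.1, hr.1.2.trans_le ht.2⟩, hr.2⟩)
      (hg.mono_set (by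
        rw [uIcc_of_le ht.1, uIcc_of_le (by linarith)]
        exact Icc_subset_Icc_right ht.2))
  have hper' : Function.Periodic (fun t => ∫ s in a..t, (g ∘ π) s) T := fun t => by
    change ∫ s in a..t + T, (g ∘ π) s = _
    rw [hper.intervalIntegral_add_eq_add a t hint, hprim _ (right_mem_Icc.2 (by linarith)), hfa,
      sub_self, add_zero]
  have hπ_prim : ∀ t, f (π t) - f a = ∫ s in a..t, (g ∘ π) s := fun t => by
    rw [← hprim (π t) (Ico_subset_Icc_self (toIcoMod_mem_Ico hT a t)),
      show π t = t - toIcoDiv hT a t • T from (self_sub_toIcoDiv_zsmul hT a t).symm]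
    exact hper'.sub_zsmul_eq _
  refine ⟨hint, fun p q => ?_⟩
  rw [← sub_sub_sub_cancel_right _ _ (f a), hπ_prim, hπ_prim]
  exact intervalIntegral.integral_interval_sub_left (hint a q) (hint a p)

end PeriodicPrimitive

/-- Over one period `u` passes from the upper to the lower half plane at the time `θ` and back at
the time `θ'`, and meets the switching line at no other time. -/
structure IsCrossingPattern (T : ℝ) (u : ℝ → Plane) (θ θ' : ℝ) : Prop where
  lt : θ < θ'
  sub_lt : θ' - T < θ
  zero_down : (u θ).2 = 0
  zero_up : (u θ').2 = 0
  neg : ∀ t ∈ Ioo θ θ', (u t).2 < 0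
  pos : ∀ t ∈ Ioo (θ' - T) θ, 0 < (u t).2

section Gluing

variable {Xp Xm : ℝ → Plane → Plane} {D : Set Plane} {f : ℝ → Plane} {T θ θ' : ℝ}

lemma IsCrossingPattern.period_pos (hf : IsCrossingPattern T f θ θ') : 0 < T := by
  linarith [hf.lt, hf.sub_lt]

lemma intervalIntegrable_ite_field {a b : ℝ} (hθ : θ ∈ Icc a b)
    (hXp : ContinuousOn (Function.uncurry Xp) (univ ×ˢ D))
    (hXm : ContinuousOn (Function.uncurry Xm) (univ ×ˢ D))
    (hf : ContinuousOn f (Icc a b)) (hfD : ∀ t ∈ Icc a b, f t ∈ D) :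
    IntervalIntegrable (fun t => if t < θ then Xp t (f t) else Xm t (f t)) volume a b := by
  have hsub : Icc a θ ⊆ Icc a b := Icc_subset_Icc_right hθ.2
  have hsub' : Icc θ b ⊆ Icc a b := Icc_subset_Icc_left hθ.1
  have hp := continuousOn_field_comp hXp (hf.mono hsub) fun t ht => hfD t (hsub ht)
  have hm := continuousOn_field_comp hXm (hf.mono hsub') fun t ht => hfD t (hsub' ht)
  rw [← uIcc_of_le hθ.1] at hp
  rw [← uIcc_of_le hθ.2] at hm
  refine (hp.intervalIntegrable.congr_uIoo ?_).trans (hm.intervalIntegrable.congr_uIoo ?_)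
  · rw [uIoo_of_le hθ.1]
    exact fun t ht => (if_pos ht.2).symm
  · rw [uIoo_of_le hθ.2]
    exact fun t ht => (if_neg ht.1.not_gt).symm

lemma IsCrossingPattern.ite_field_mem_filippovSet (hf : IsCrossingPattern T f θ θ')
    (hper : f (θ' - T) = f θ') {t : ℝ} (ht : t ∈ Ico (θ' - T) θ') :
    (if t < θ then Xp t (f t) else Xm t (f t)) ∈ filippovSet Xp Xm t (f t) := by
  split_ifs with htθ
  · rcases ht.1.eq_or_lt with rfl | hlt
    · exact Or.inr (Or.inr ⟨by rw [hper, hf.zero_up], left_mem_segment ℝ _ _⟩)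
    · exact Or.inl ⟨hf.pos t ⟨hlt, htθ⟩, rfl⟩
  · rcases (not_lt.1 htθ).eq_or_lt with rfl | hlt
    · exact Or.inr (Or.inr ⟨hf.zero_down, right_mem_segment ℝ _ _⟩)
    · exact Or.inr (Or.inl ⟨hf.neg t ⟨hlt, ht.2⟩, rfl⟩)

lemma filippovSet_toIcoMod (hT : 0 < T) (hperp : ∀ t, ∀ z ∈ D, Xp (t + T) z = Xp t z)
    (hperm : ∀ t, ∀ z ∈ D, Xm (t + T) z = Xm t z) {z : Plane} (hz : z ∈ D) (a t : ℝ) :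
    filippovSet Xp Xm (toIcoMod hT a t) z = filippovSet Xp Xm t z := by
  have hper : Function.Periodic (fun t => filippovSet Xp Xm t z) T := fun t => by
    simp only [filippovSet, hperp t z hz, hperm t z hz]
  rw [← self_sub_toIcoDiv_zsmul hT a t]
  exact hper.sub_zsmul_eq _

lemma IsCrossingPattern.exists_isPeriodicSolution_eqOn (hf : IsCrossingPattern T f θ θ')
    (hper : f (θ' - T) = f θ') (hcont : ContinuousOn f (Icc (θ' - T) θ'))
    (hfD : ∀ t ∈ Icc (θ' - T) θ', f t ∈ D)
    (hupper : ∀ t ∈ Ioo (θ' - T) θ, HasDerivAt f (Xp t (f t)) t)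
    (hlower : ∀ t ∈ Ioo θ θ', HasDerivAt f (Xm t (f t)) t)
    (hXp : ContinuousOn (Function.uncurry Xp) (univ ×ˢ D))
    (hXm : ContinuousOn (Function.uncurry Xm) (univ ×ˢ D))
    (hperp : ∀ t, ∀ z ∈ D, Xp (t + T) z = Xp t z)
    (hperm : ∀ t, ∀ z ∈ D, Xm (t + T) z = Xm t z) :
    ∃ w, IsPeriodicSolution Xp Xm D T w ∧ EqOn w f (Icc (θ' - T) θ') := by
  obtain ⟨a, rfl⟩ : ∃ a, θ' = a + T := ⟨θ' - T, (sub_add_cancel θ' T).symm⟩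
  have hT := hf.period_pos
  have hθ : θ ∈ Icc a (a + T) := ⟨by linarith [hf.sub_lt], hf.lt.le⟩
  have hvel := fun {t} ht => hf.ite_field_mem_filippovSet (Xp := Xp) (Xm := Xm) hper (t := t) ht
  rw [add_sub_cancel_right] at *
  set g : ℝ → Plane := fun t => if t < θ then Xp t (f t) else Xm t (f t)
  have hderiv : ∀ t ∈ Ioo a (a + T) \ {θ}, HasDerivAt f (g t) t := fun t ht => by
    rcases lt_or_gt_of_ne ht.2 with hlt | hgt
    · simpa only [g, if_pos hlt] using hupper t ⟨ht.1.1, hlt⟩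
    · simpa only [g, if_neg hgt.not_gt] using hlower t ⟨hgt, ht.1.2⟩
  obtain ⟨hint, hprim⟩ := sub_eq_integral_comp_toIcoMod hT hcont hper.symm (countable_singleton θ)
    hderiv (intervalIntegrable_ite_field hθ hXp hXm hcont hfD)
  have hmem : ∀ t, f (toIcoMod hT a t) ∈ D := fun t =>
    hfD _ (Ico_subset_Icc_self (toIcoMod_mem_Ico hT a t))
  refine ⟨f ∘ toIcoMod hT a, ⟨hmem, (toIcoMod_periodic hT a).comp f, g ∘ toIcoMod hT a, hint,
    fun p q => hprim p q, Eventually.of_forall fun t => ?_⟩, fun t ht => ?_⟩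
  · change g _ ∈ filippovSet Xp Xm t (f _)
    rw [← filippovSet_toIcoMod hT hperp hperm (hmem t) a t]
    exact hvel (toIcoMod_mem_Ico hT a t)
  · rcases ht.2.lt_or_eq with hlt | rfl
    · exact congrArg f ((toIcoMod_eq_self hT).2 ⟨ht.1, hlt⟩)
    · rw [Function.comp_apply, toIcoMod_periodic hT a, toIcoMod_apply_left, hper]

end Gluing

section CrossingCycle

variable {Xp Xm : ℝ → Plane → Plane} {D : Set Plane} {u w : ℝ → Plane}
  {a b c c' e r s t T θ θ' : ℝ}

lemma exists_isSwitch_of_dist_lt (hw : ContinuousAt w s)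
    (hXp : ContinuousAt (Function.uncurry Xp) (s, w s))
    (hXm : ContinuousAt (Function.uncurry Xm) (s, w s)) (hp : 0 < e * (Xp s (w s)).2)
    (hm : 0 < e * (Xm s (w s)).2) :
    ∃ ρ > 0, ∀ u, IsFilippovCurve Xp Xm u → (∀ t, dist (u t) (w t) < ρ) →
      ∀ r ∈ Ioo 0 ρ, ∃ c, IsSwitch e (s - r) (s + r) u c := by
  obtain ⟨m, hm0, hspeed⟩ := exists_eventually_le_mul_snd hXp hXm hp hm
  obtain ⟨ρ, hρ, hspeed⟩ := Metric.eventually_nhds_iff_ball.1 hspeed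
  obtain ⟨η, hη, hwη⟩ := Metric.continuousAt_iff.1 hw (ρ / 2) (half_pos hρ)
  refine ⟨min (ρ / 2) η, lt_min (half_pos hρ) hη, fun u hu huw r hr => ?_⟩
  obtain ⟨hrρ, hrη⟩ := lt_min_iff.1 hr.2
  have hball : ∀ t ∈ Icc (s - r) (s + r), (t, u t) ∈ Metric.ball (s, w s) ρ := fun t ht => by
    have hts : dist t s ≤ r := abs_le.2 ⟨by linarith [ht.1], by linarith [ht.2]⟩
    have hut := (huw t).trans_le (min_le_left _ _)
    exact max_lt (by linarith) ((dist_triangle _ (w t) _).trans_lt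
      (by linarith [hwη (hts.trans_lt hrη)]))
  refine exists_isSwitch hu.continuous (fun p hp q hq hpq => ?_) (by linarith [hr.1])
  have hle := hu.mul_sub_le hpq.le fun t ht =>
    hspeed (t, u t) (hball t ⟨hp.1.trans ht.1, ht.2.trans hq.2⟩)
  exact sub_pos.1 ((mul_pos hm0 (sub_pos.2 hpq)).trans_le hle)

lemma IsSwitch.mem_Ioo (hc : IsSwitch e a b u c) (hab : a ≤ b) (ha : e * (u a).2 < 0)
    (hb : 0 < e * (u b).2) : c ∈ Ioo a b := by
  have hlt : a < b := hab.lt_of_ne (by rintro rfl; exact ha.not_gt hb)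
  refine ⟨hc.mem.1.lt_of_ne ?_, hc.mem.2.lt_of_ne ?_⟩
  · rintro rfl
    exact ha.not_ge (hc.nonneg hlt)
  · rintro rfl
    exact hb.not_ge (hc.nonpos hlt)

lemma IsSwitch.snd_eq_zero (hc : IsSwitch e a b u c) (he : e ≠ 0) (hmem : c ∈ Ioo a b) :
    (u c).2 = 0 :=
  (mul_eq_zero.1 ((hc.nonpos hmem.1).antisymm (hc.nonneg hmem.2))).resolve_left he

lemma isCrossingPattern_of_isSwitch (hu : Function.Periodic u T) (hr : 0 ≤ r)
    (hlt : θ + r ≤ θ' - r) (hlt' : θ' - T + r ≤ θ - r)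
    (hneg : ∀ t ∈ Icc (θ + r) (θ' - r), (u t).2 < 0)
    (hpos : ∀ t ∈ Icc (θ' - T + r) (θ - r), 0 < (u t).2)
    (hc : IsSwitch (-1) (θ - r) (θ + r) u c) (hc' : IsSwitch 1 (θ' - r) (θ' + r) u c') :
    c ∈ Ioo (θ - r) (θ + r) ∧ c' ∈ Ioo (θ' - r) (θ' + r) ∧ IsCrossingPattern T u c c' := by
  have hcI : c ∈ Ioo (θ - r) (θ + r) := hc.mem_Ioo (by linarith)
    (by linarith [hpos _ (right_mem_Icc.2 hlt')]) (by linarith [hneg _ (left_mem_Icc.2 hlt)])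
  have hpos' : 0 < (u (θ' + r)).2 := by
    rw [← hu.sub_eq, ← sub_add_eq_add_sub]
    exact hpos _ (left_mem_Icc.2 hlt')
  have hcI' : c' ∈ Ioo (θ' - r) (θ' + r) := hc'.mem_Ioo (by linarith)
    (by linarith [hneg _ (right_mem_Icc.2 hlt)]) (by linarith)
  refine ⟨hcI, hcI', by linarith [hcI.2, hcI'.1], by linarith [hcI.1, hcI'.2],
    hc.snd_eq_zero (by norm_num) hcI, hc'.snd_eq_zero one_ne_zero hcI', fun t ht => ?_,
    fun t ht => ?_⟩
  · rcases le_total t (θ + r) with h | h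
    · linarith [hc.pos t ⟨ht.1, h⟩]
    rcases le_total t (θ' - r) with h' | h'
    · exact hneg t ⟨h, h'⟩
    · linarith [hc'.neg t ⟨h', ht.2⟩]
  · rcases le_total t (θ' - T + r) with h | h
    · rw [← hu t]
      linarith [hc'.pos (t + T) ⟨by linarith [ht.1], by linarith⟩]
    rcases le_total t (θ - r) with h' | h'
    · exact hpos t ⟨h, h'⟩
    · linarith [hc.neg t ⟨h', ht.2⟩]

/-- `w` is a periodic solution which crosses the switching line exactly twice in each period,
downwards at the time `θ` and upwards at the time `θ'`. -/
structure IsCrossingCycle (Xp Xm : ℝ → Plane → Plane) (D : Set Plane) (T : ℝ) (w : ℝ → Plane)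
    (θ θ' : ℝ) : Prop where
  isPeriodicSolution : IsPeriodicSolution Xp Xm D T w
  isCrossingPattern : IsCrossingPattern T w θ θ'
  down_upper : (Xp θ (w θ)).2 < 0
  down_lower : (Xm θ (w θ)).2 < 0
  up_upper : 0 < (Xp θ' (w θ')).2
  up_lower : 0 < (Xm θ' (w θ')).2

lemma IsCrossingCycle.isCrossing (hw : IsCrossingCycle Xp Xm D T w θ θ')
    (hperp : ∀ t, ∀ z ∈ D, Xp (t + T) z = Xp t z) (hperm : ∀ t, ∀ z ∈ D, Xm (t + T) z = Xm t z) :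
    IsCrossing Xp Xm w := by
  have hpat := hw.isCrossingPattern
  have hper : Function.Periodic (fun t => ((w t).2, (Xp t (w t)).2 * (Xm t (w t)).2)) T :=
    fun t => by
      simp only [hw.isPeriodicSolution.periodic t, hperp t _ (hw.isPeriodicSolution.mem t),
        hperm t _ (hw.isPeriodicSolution.mem t)]
  intro t ht
  obtain ⟨s, hs, hst⟩ := hper.exists_mem_Ioc hpat.period_pos t (θ' - T)
  obtain ⟨hsnd, hmul⟩ := Prod.ext_iff.1 hst
  dsimp only at hsnd hmul
  rw [hmul]
  rw [sub_add_cancel] at hs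
  rw [hsnd] at ht
  rcases lt_trichotomy s θ with hlt | rfl | hgt
  · exact absurd ht (hpat.pos s ⟨hs.1, hlt⟩).ne'
  · exact mul_pos_of_neg_of_neg hw.down_upper hw.down_lower
  · rcases hs.2.lt_or_eq with hlt | rfl
    · exact absurd ht (hpat.neg s ⟨hgt, hlt⟩).ne
    · exact mul_pos hw.up_upper hw.up_lower

lemma exists_pos_forall_dist_lt_mem {α : Type*} [PseudoMetricSpace α] {K : Set ℝ} {U : Set α}
    {w : ℝ → α} (hK : IsCompact K) (hw : ContinuousOn w K) (hU : IsOpen U) (hwU : MapsTo w K U) :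
    ∃ κ > 0, ∀ t ∈ K, ∀ z, dist z (w t) < κ → z ∈ U := by
  obtain ⟨κ, hκ, hsub⟩ := (hK.image_of_continuousOn hw).exists_thickening_subset_open hU
    hwU.image_subset
  exact ⟨κ, hκ, fun t ht z hz =>
    hsub (Metric.mem_thickening_iff.2 ⟨w t, mem_image_of_mem w ht, hz⟩)⟩

lemma IsCrossingCycle.exists_isCrossingPattern_of_forall_dist_lt (hD : IsOpen D)
    (hXp : ContinuousOn (Function.uncurry Xp) (univ ×ˢ D))
    (hXm : ContinuousOn (Function.uncurry Xm) (univ ×ˢ D))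
    (hw : IsCrossingCycle Xp Xm D T w θ θ') {ρ : ℝ} (hρ : 0 < ρ) :
    ∃ κ > 0, ∀ u, IsPeriodicSolution Xp Xm D T u → (∀ t, dist (u t) (w t) < κ) →
      ∃ c c', |c - θ| < ρ ∧ |c' - θ'| < ρ ∧ IsCrossingPattern T u c c' := by
  have hpat := hw.isCrossingPattern
  have hwc : Continuous w := IsFilippovCurve.continuous hw.isPeriodicSolution.inclusion
  have hat : ∀ {X : ℝ → Plane → Plane} (s : ℝ), ContinuousOn (Function.uncurry X) (univ ×ˢ D) →
      ContinuousAt (Function.uncurry X) (s, w s) := fun s hX =>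
    hX.continuousAt ((isOpen_univ.prod hD).mem_nhds ⟨mem_univ _, hw.isPeriodicSolution.mem s⟩)
  obtain ⟨ρ₁, hρ₁, hdown⟩ := exists_isSwitch_of_dist_lt (e := -1) hwc.continuousAt (hat θ hXp)
    (hat θ hXm) (by linarith [hw.down_upper]) (by linarith [hw.down_lower])
  obtain ⟨ρ₂, hρ₂, hup⟩ := exists_isSwitch_of_dist_lt (e := 1) hwc.continuousAt (hat θ' hXp)
    (hat θ' hXm) (by linarith [hw.up_upper]) (by linarith [hw.up_lower])
  obtain ⟨r, hr, hlt⟩ := exists_between (lt_min (lt_min hρ (lt_min hρ₁ hρ₂)) (lt_min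
    (half_pos (sub_pos.2 hpat.lt)) (half_pos (sub_pos.2 hpat.sub_lt))))
  simp only [lt_min_iff] at hlt
  obtain ⟨⟨hrρ, hr₁, hr₂⟩, hrm, hrp⟩ := hlt
  obtain ⟨κ₁, hκ₁, hneg⟩ := exists_pos_forall_dist_lt_mem
    (isCompact_Icc (a := θ + r) (b := θ' - r)) hwc.continuousOn
    (isOpen_Iio.preimage continuous_snd : IsOpen {z : Plane | z.2 < 0})
    fun t ht => hpat.neg t ⟨by linarith [ht.1], by linarith [ht.2]⟩
  obtain ⟨κ₂, hκ₂, hpos⟩ := exists_pos_forall_dist_lt_mem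
    (isCompact_Icc (a := θ' - T + r) (b := θ - r)) hwc.continuousOn
    (isOpen_Ioi.preimage continuous_snd : IsOpen {z : Plane | 0 < z.2})
    fun t ht => hpat.pos t ⟨by linarith [ht.1], by linarith [ht.2]⟩
  refine ⟨min (min ρ₁ ρ₂) (min κ₁ κ₂), by positivity, fun u hu hdist => ?_⟩
  simp only [lt_min_iff] at hdist
  obtain ⟨c, hc⟩ := hdown u hu.inclusion (fun t => (hdist t).1.1) r ⟨hr, hr₁⟩
  obtain ⟨c', hc'⟩ := hup u hu.inclusion (fun t => (hdist t).1.2) r ⟨hr, hr₂⟩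
  obtain ⟨hcI, hcI', hpat'⟩ := isCrossingPattern_of_isSwitch hu.periodic hr.le (by linarith)
    (by linarith) (fun t ht => hneg t ht _ (hdist t).2.1) (fun t ht => hpos t ht _ (hdist t).2.2)
    hc hc'
  exact ⟨c, c', abs_lt.2 ⟨by linarith [hcI.1], by linarith [hcI.2]⟩,
    abs_lt.2 ⟨by linarith [hcI'.1], by linarith [hcI'.2]⟩, hpat'⟩

lemma IsCrossingCycle.exists_isCrossingPattern (hD : IsOpen D)
    (hXp : ContDiffOn ℝ 1 (Function.uncurry Xp) (univ ×ˢ D))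
    (hXm : ContDiffOn ℝ 1 (Function.uncurry Xm) (univ ×ˢ D))
    (hw : IsCrossingCycle Xp Xm D T w θ θ') (hcr : IsCrossing Xp Xm w) {ρ : ℝ} (hρ : 0 < ρ) :
    ∃ δ > 0, ∀ u, IsPeriodicSolution Xp Xm D T u → (∃ t, dist (u t) (w t) < δ) →
      ∃ c c', |c - θ| < ρ ∧ |c' - θ'| < ρ ∧ dist (u c) (w θ) < ρ ∧ IsCrossingPattern T u c c' := by
  have hwc : Continuous w := IsFilippovCurve.continuous hw.isPeriodicSolution.inclusion
  obtain ⟨η, hη, hwη⟩ := Metric.continuousAt_iff.1 hwc.continuousAt (ρ / 2) (half_pos hρ)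
  obtain ⟨κ, hκ, hpat⟩ := hw.exists_isCrossingPattern_of_forall_dist_lt hD hXp.continuousOn
    hXm.continuousOn (lt_min hη hρ)
  obtain ⟨δ, hδ, hstab⟩ := hw.isPeriodicSolution.forall_dist_lt hcr hD
    hw.isCrossingPattern.period_pos hXp hXm (lt_min hκ (half_pos hρ))
  refine ⟨δ, hδ, fun u hu hex => ?_⟩
  have hdist := hstab u hu hex
  simp only [lt_min_iff] at hdist
  obtain ⟨c, c', hc, hc', hpat'⟩ := hpat u hu fun t => (hdist t).1
  exact ⟨c, c', (lt_min_iff.1 hc).2, (lt_min_iff.1 hc').2, (dist_triangle _ (w c) _).trans_lt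
    (by linarith [(hdist c).2, hwη (lt_min_iff.1 hc).1]), hpat'⟩

end CrossingCycle

/-! ### Closed orbits and their isolation -/

section ClosedOrbit

/-- The member `z' = h (t, z, ε)` of a family of fields, as a time-dependent field. -/
def slice (h : ℝ × Plane × ℝ → Plane) (ε t : ℝ) (z : Plane) : Plane := h (t, z, ε)

variable {h hm hp : ℝ × Plane × ℝ → Plane} {D : Set Plane} {f u v : ℝ → Plane}
  {κ σ T θ₀ x₀ b c t θ θ' : ℝ} {q : ℝ × ℝ × ℝ} {A : ReturnArc hm D 1 σ θ₀ x₀}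
  {B : ReturnArc hp D (-1) σ θ₀ x₀}

lemma R_mk_zero (x : ℝ) : R (x, 0) = (x, 0) := by
  simp [R]

lemma R_neg (z : Plane) : R (-z) = -R z := by
  simp [R]

lemma hasDerivWithinAt_R_comp_const_sub {f' : Plane} {s s' : Set ℝ}
    (hf : HasDerivWithinAt f f' s (c - t)) (hmaps : MapsTo (fun t => c - t) s' s) :
    HasDerivWithinAt (fun t => R (f (c - t))) (-R f') s' t := by
  have hcomp : HasDerivWithinAt (fun t => f (c - t)) (-f') s' t := by
    have hscomp := hf.scomp t ((hasDerivWithinAt_id t s').const_sub c) hmaps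
    rw [neg_one_smul] at hscomp
    exact hscomp
  have hfst : HasDerivWithinAt (fun t => (f (c - t)).1) (-f').1 s' t := hcomp.fst
  have hsnd : HasDerivWithinAt (fun t => (f (c - t)).2) (-f').2 s' t := hcomp.snd
  exact (hfst.prodMk hsnd.neg).congr_deriv (by simp [R])

lemma ReturnArc.eqOn_arc (C : ReturnArc h D κ T θ₀ x₀) (hD : IsOpen D)
    (hX : ContDiffOn ℝ 1 (Function.uncurry (slice h q.1)) (univ ×ˢ D))
    (hq : q ∈ Metric.ball (0, θ₀, x₀) C.r) (hb : b < T + C.η)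
    (hv : ∀ t ∈ Icc 0 b, v t ∈ D ∧
      HasDerivWithinAt v (slice h q.1 (q.2.1 + κ * t) (v t)) (Icc 0 b) t)
    (hv0 : v 0 = (q.2.2, 0)) : EqOn v (fun t => C.arc t q) (Icc 0 b) := by
  have hsub : Icc 0 b ⊆ Ioo (-C.η) (T + C.η) := fun t ht =>
    C.Ico_subset ⟨ht.1, ht.2.trans_lt hb⟩
  refine eqOn_Icc_of_hasDerivWithinAt (X := fun t z => slice h q.1 (q.2.1 + κ * t) z) hD
    (hX.comp (f := fun p : ℝ × Plane => (q.2.1 + κ * p.1, p.2)) (by fun_prop)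
      fun p hp => ⟨mem_univ _, hp.2⟩) hv
    (fun t ht => ⟨C.arc_mem hq (hsub ht), (C.hasDerivAt_arc hq (hsub ht)).hasDerivWithinAt⟩) ?_
  rw [hv0, C.arc_zero]

/-- The arc above the switching line, run backwards from `(x, 0)`, followed by the arc below it. -/
def closedOrbit (A : ReturnArc hm D 1 σ θ₀ x₀) (B : ReturnArc hp D (-1) σ θ₀ x₀)
    (q : ℝ × ℝ × ℝ) (t : ℝ) : Plane :=
  if t ≤ q.2.1 then R (B.arc (q.2.1 - t) q) else A.arc (t - q.2.1) q

lemma closedOrbit_of_le (ht : t ≤ q.2.1) : closedOrbit A B q t = R (B.arc (q.2.1 - t) q) :=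
  if_pos ht

lemma closedOrbit_of_ge (ht : q.2.1 ≤ t) : closedOrbit A B q t = A.arc (t - q.2.1) q := by
  rcases ht.eq_or_lt with rfl | hlt
  · rw [closedOrbit_of_le le_rfl, sub_self, A.arc_zero, B.arc_zero, R_mk_zero]
  · exact if_neg hlt.not_ge

lemma closedOrbit_start : closedOrbit A B q q.2.1 = (q.2.2, 0) := by
  rw [closedOrbit_of_ge le_rfl, sub_self, A.arc_zero]

lemma closedOrbit_add_τ (hqA : q ∈ Metric.ball (0, θ₀, x₀) A.r) :
    closedOrbit A B q (q.2.1 + A.τ q) = (A.exitPoint q, 0) := by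
  rw [closedOrbit_of_ge (le_add_of_nonneg_right (A.τ_mem hqA).1), add_sub_cancel_left,
    A.arc_τ hqA]

lemma Closes.add_τ_sub (hcl : Closes A B q) : q.2.1 + A.τ q - 2 * σ = q.2.1 - B.τ q := by
  linarith [hcl.1]

lemma Closes.closedOrbit_sub_period (hcl : Closes A B q)
    (hqA : q ∈ Metric.ball (0, θ₀, x₀) A.r) (hqB : q ∈ Metric.ball (0, θ₀, x₀) B.r) :
    closedOrbit A B q (q.2.1 + A.τ q - 2 * σ) = closedOrbit A B q (q.2.1 + A.τ q) := by
  rw [closedOrbit_add_τ hqA, hcl.add_τ_sub, closedOrbit_of_le (sub_le_self _ (B.τ_mem hqB).1),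
    sub_sub_cancel, B.arc_τ hqB, R_mk_zero, hcl.2]

lemma continuous_closedOrbit : Continuous (closedOrbit A B q) := by
  have hA : Continuous fun s => A.arc s q := A.continuous_curve _
  have hB : Continuous fun s => B.arc s q := B.continuous_curve _
  refine Continuous.if_le ((contDiff_R (n := 0)).continuous.comp (hB.comp (by fun_prop)))
    (hA.comp (by fun_prop)) continuous_id continuous_const fun t ht => ?_
  rw [← closedOrbit_of_le (A := A) (B := B) (le_of_eq ht), closedOrbit_of_ge (ge_of_eq ht)]

lemma closedOrbit_hasDerivAt_lower (hqA : q ∈ Metric.ball (0, θ₀, x₀) A.r)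
    (ht : t ∈ Ioo q.2.1 (q.2.1 + A.τ q)) :
    HasDerivAt (closedOrbit A B q) (slice hm q.1 t (closedOrbit A B q t)) t := by
  have hs : t - q.2.1 ∈ Ioo (-A.η) (σ + A.η) :=
    A.Ico_subset ⟨by linarith [ht.1], by linarith [ht.2, (A.τ_mem hqA).2]⟩
  have harc := (A.hasDerivAt_arc hqA hs).comp_sub_const t q.2.1
  rw [one_mul, add_sub_cancel] at harc
  rw [closedOrbit_of_ge ht.1.le]
  exact harc.congr_of_eventuallyEq
    ((eventually_ge_nhds ht.1).mono fun s hs => closedOrbit_of_ge hs)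

lemma closedOrbit_hasDerivAt_upper (hqB : q ∈ Metric.ball (0, θ₀, x₀) B.r)
    (ht : t ∈ Ioo (q.2.1 - B.τ q) q.2.1) :
    HasDerivAt (closedOrbit A B q)
      (reflectField (slice hp q.1) t (closedOrbit A B q t)) t := by
  have hs : q.2.1 - t ∈ Ioo (-B.η) (σ + B.η) :=
    B.Ico_subset ⟨by linarith [ht.2], by linarith [ht.1, (B.τ_mem hqB).2]⟩
  have harc := hasDerivWithinAt_R_comp_const_sub (B.hasDerivAt_arc hqB hs).hasDerivWithinAt
    (mapsTo_univ _ univ)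
  rw [hasDerivWithinAt_univ, neg_one_mul, neg_sub, add_sub_cancel] at harc
  rw [closedOrbit_of_le ht.2.le, reflectField, R_R]
  exact harc.congr_of_eventuallyEq
    ((eventually_le_nhds ht.2).mono fun s hs => closedOrbit_of_le hs)

lemma Closes.closedOrbit_mem (hcl : Closes A B q) (hDR : ∀ z ∈ D, R z ∈ D)
    (hqA : q ∈ Metric.ball (0, θ₀, x₀) A.r) (hqB : q ∈ Metric.ball (0, θ₀, x₀) B.r)
    (ht : t ∈ Icc (q.2.1 + A.τ q - 2 * σ) (q.2.1 + A.τ q)) : closedOrbit A B q t ∈ D := by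
  rw [hcl.add_τ_sub] at ht
  rcases le_total t q.2.1 with h | h
  · rw [closedOrbit_of_le h]
    exact hDR _ (B.arc_mem hqB (B.Ico_subset
      ⟨by linarith, by linarith [ht.1, (B.τ_mem hqB).2]⟩))
  · rw [closedOrbit_of_ge h]
    exact A.arc_mem hqA (A.Ico_subset ⟨by linarith, by linarith [ht.2, (A.τ_mem hqA).2]⟩)

lemma Closes.isCrossingPattern (hcl : Closes A B q) (hqA : q ∈ Metric.ball (0, θ₀, x₀) A.r)
    (hqB : q ∈ Metric.ball (0, θ₀, x₀) B.r) :
    IsCrossingPattern (2 * σ) (closedOrbit A B q) q.2.1 (q.2.1 + A.τ q) where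
  lt := lt_add_of_pos_right _ (A.isFirstReturn q hqA).pos
  sub_lt := hcl.add_τ_sub.trans_lt (sub_lt_self _ (B.isFirstReturn q hqB).pos)
  zero_down := by rw [closedOrbit_start]
  zero_up := by rw [closedOrbit_add_τ hqA]
  neg t ht := by
    rw [closedOrbit_of_ge ht.1.le]
    exact (A.isFirstReturn q hqA).below _ ⟨by linarith [ht.1], by linarith [ht.2]⟩
  pos t ht := by
    rw [hcl.add_τ_sub] at ht
    rw [closedOrbit_of_le ht.2.le]
    exact neg_pos.2 ((B.isFirstReturn q hqB).below _ ⟨by linarith [ht.2], by linarith [ht.1]⟩)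

lemma IsCrossingPattern.congr (hf : IsCrossingPattern T f θ θ')
    (h : EqOn u f (Icc (θ' - T) θ')) : IsCrossingPattern T u θ θ' where
  lt := hf.lt
  sub_lt := hf.sub_lt
  zero_down := by rw [h ⟨hf.sub_lt.le, hf.lt.le⟩, hf.zero_down]
  zero_up := by rw [h (right_mem_Icc.2 (hf.sub_lt.trans hf.lt).le), hf.zero_up]
  neg t ht := by
    rw [h ⟨(hf.sub_lt.trans ht.1).le, ht.2.le⟩]
    exact hf.neg t ht
  pos t ht := by
    rw [h ⟨ht.1.le, (ht.2.trans hf.lt).le⟩]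
    exact hf.pos t ht

lemma Closes.exists_isCrossingCycle (hcl : Closes A B q) (hDR : ∀ z ∈ D, R z ∈ D)
    (hqA : q ∈ Metric.ball (0, θ₀, x₀) A.r) (hqB : q ∈ Metric.ball (0, θ₀, x₀) B.r)
    (hXp : ContinuousOn (Function.uncurry (reflectField (slice hp q.1))) (univ ×ˢ D))
    (hXm : ContinuousOn (Function.uncurry (slice hm q.1)) (univ ×ˢ D))
    (hperp : ∀ t, ∀ z ∈ D,
      reflectField (slice hp q.1) (t + 2 * σ) z = reflectField (slice hp q.1) t z)
    (hperm : ∀ t, ∀ z ∈ D, slice hm q.1 (t + 2 * σ) z = slice hm q.1 t z) :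
    ∃ w, IsCrossingCycle (reflectField (slice hp q.1)) (slice hm q.1) D (2 * σ) w q.2.1
        (q.2.1 + A.τ q) ∧
      EqOn w (closedOrbit A B q) (Icc (q.2.1 + A.τ q - 2 * σ) (q.2.1 + A.τ q)) := by
  have hpat := hcl.isCrossingPattern hqA hqB
  obtain ⟨w, hw, heq⟩ := hpat.exists_isPeriodicSolution_eqOn
    (hcl.closedOrbit_sub_period hqA hqB) continuous_closedOrbit.continuousOn
    (fun t ht => hcl.closedOrbit_mem hDR hqA hqB ht)
    (fun t ht => closedOrbit_hasDerivAt_upper hqB (hcl.add_τ_sub ▸ ht))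
    (fun t ht => closedOrbit_hasDerivAt_lower hqA ht) hXp hXm hperp hperm
  have hstart : w q.2.1 = (q.2.2, 0) := by
    rw [heq ⟨hpat.sub_lt.le, hpat.lt.le⟩, closedOrbit_start]
  have hexit : w (q.2.1 + A.τ q) = (A.exitPoint q, 0) := by
    rw [heq (right_mem_Icc.2 (hpat.sub_lt.trans hpat.lt).le), closedOrbit_add_τ hqA]
  refine ⟨w, ⟨hw, hpat.congr heq, ?_, ?_, ?_, ?_⟩, heq⟩
  · rw [hstart, reflectField, R_mk_zero]
    exact (neg_neg _).trans_lt (B.velocity_zero_neg hqB)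
  · rw [hstart]
    exact A.velocity_zero_neg hqA
  · have hmem := hw.mem (q.2.1 + A.τ q)
    rw [hexit] at hmem
    have hup := B.velocity_τ_pos hqB
    rw [neg_one_mul, ← sub_eq_add_neg, ← hcl.add_τ_sub, ← hcl.2] at hup
    rw [hexit, ← sub_add_cancel (q.2.1 + A.τ q) (2 * σ), hperp _ _ hmem, reflectField, R_mk_zero]
    exact hup.trans_eq (neg_neg _).symm
  · rw [hexit]
    simpa only [slice, one_mul] using A.velocity_τ_pos hqA

end ClosedOrbit

section IsolatedPeriodicSolution

variable {h hm hp : ℝ × Plane × ℝ → Plane} {D : Set Plane} {u v : ℝ → Plane}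
  {κ σ T θ₀ x₀ ε b c c' : ℝ} {q : ℝ × ℝ × ℝ} {A : ReturnArc hm D 1 σ θ₀ x₀}
  {B : ReturnArc hp D (-1) σ θ₀ x₀}

lemma ReturnArc.eq_τ_of_eqOn_arc (C : ReturnArc h D κ T θ₀ x₀)
    (hq : q ∈ Metric.ball (0, θ₀, x₀) C.r) (hb : b ∈ Ioo 0 (T + C.η))
    (hv : EqOn v (fun t => C.arc t q) (Icc 0 b)) (hvb : (v b).2 = 0) :
    b = C.τ q ∧ (v b).1 = C.exitPoint q := by
  have hvC : v b = C.arc b q := hv (right_mem_Icc.2 hb.1.le)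
  rw [hvC] at hvb
  have hbτ : b = C.τ q := (C.isFirstReturn q hq).unique b hb hvb
  refine ⟨hbτ, ?_⟩
  rw [hvC, hbτ, C.arc_τ hq]

lemma IsCrossingPattern.eqOn_arc_lower (hpat : IsCrossingPattern (2 * σ) u c c') (hD : IsOpen D)
    (hX : ContDiffOn ℝ 1 (Function.uncurry (slice hm ε)) (univ ×ˢ D))
    (hu : IsPeriodicSolution (reflectField (slice hp ε)) (slice hm ε) D (2 * σ) u)
    (hq : (ε, c, (u c).1) ∈ Metric.ball (0, θ₀, x₀) A.r) (hc' : c' - c < σ + A.η) :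
    EqOn (fun t => u (c + t)) (fun t => A.arc t (ε, c, (u c).1)) (Icc 0 (c' - c)) := by
  refine A.eqOn_arc hD hX hq hc' (fun t ht => ⟨hu.mem _, ?_⟩) ?_
  · have hder := IsFilippovCurve.hasDerivWithinAt_lower hu.inclusion hX.continuousOn
      (fun s _ => hu.mem s) hpat.neg (t := c + t) ⟨by linarith [ht.1], by linarith [ht.2]⟩
    rw [one_mul]
    have hshift := hder.scomp t ((hasDerivWithinAt_id t (Icc 0 (c' - c))).const_add c)
      fun s hs => ⟨by linarith [hs.1], by linarith [hs.2]⟩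
    rwa [one_smul] at hshift
  · rw [add_zero, ← hpat.zero_down]

lemma IsCrossingPattern.eqOn_arc_upper (hpat : IsCrossingPattern (2 * σ) u c c') (hD : IsOpen D)
    (hDR : ∀ z ∈ D, R z ∈ D)
    (hX : ContDiffOn ℝ 1 (Function.uncurry (slice hp ε)) (univ ×ˢ D))
    (hXR : ContinuousOn (Function.uncurry (reflectField (slice hp ε))) (univ ×ˢ D))
    (hu : IsPeriodicSolution (reflectField (slice hp ε)) (slice hm ε) D (2 * σ) u)
    (hq : (ε, c, (u c).1) ∈ Metric.ball (0, θ₀, x₀) B.r) (hc' : c - (c' - 2 * σ) < σ + B.η) :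
    EqOn (fun t => R (u (c - t))) (fun t => B.arc t (ε, c, (u c).1))
      (Icc 0 (c - (c' - 2 * σ))) := by
  refine B.eqOn_arc hD hX hq hc' (fun t ht => ⟨hDR _ (hu.mem _), ?_⟩) ?_
  · have hder := IsFilippovCurve.hasDerivWithinAt_upper hu.inclusion hXR
      (fun s _ => hu.mem s) hpat.pos (t := c - t) ⟨by linarith [ht.2], by linarith [ht.1]⟩
    have hrefl := hasDerivWithinAt_R_comp_const_sub hder
      (s' := Icc 0 (c - (c' - 2 * σ))) fun s hs => ⟨by linarith [hs.2], by linarith [hs.1]⟩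
    rw [reflectField, R_neg, neg_neg, R_R] at hrefl
    rwa [neg_one_mul, ← sub_eq_add_neg]
  · rw [sub_zero, ← R_mk_zero, ← hpat.zero_down]

lemma IsCrossingPattern.closes_and_eqOn (hpat : IsCrossingPattern (2 * σ) u c c') (hD : IsOpen D)
    (hDR : ∀ z ∈ D, R z ∈ D)
    (hXp : ContDiffOn ℝ 1 (Function.uncurry (slice hp ε)) (univ ×ˢ D))
    (hXm : ContDiffOn ℝ 1 (Function.uncurry (slice hm ε)) (univ ×ˢ D))
    (hu : IsPeriodicSolution (reflectField (slice hp ε)) (slice hm ε) D (2 * σ) u)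
    (hqA : (ε, c, (u c).1) ∈ Metric.ball (0, θ₀, x₀) A.r)
    (hqB : (ε, c, (u c).1) ∈ Metric.ball (0, θ₀, x₀) B.r) (hcA : c' - c < σ + A.η)
    (hcB : c - (c' - 2 * σ) < σ + B.η) :
    Closes A B (ε, c, (u c).1) ∧ c' = c + A.τ (ε, c, (u c).1) ∧
      EqOn u (closedOrbit A B (ε, c, (u c).1)) (Icc (c' - 2 * σ) c') := by
  have hlower := hpat.eqOn_arc_lower hD hXm hu hqA hcA
  have hupper := hpat.eqOn_arc_upper hD hDR hXp
    (contDiffOn_reflectField hDR hXp).continuousOn hu hqB hcB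
  have hend : u (c' - 2 * σ) = u c' := Function.Periodic.sub_eq hu.periodic c'
  obtain ⟨hτA, hexitA⟩ := A.eq_τ_of_eqOn_arc hqA ⟨sub_pos.2 hpat.lt, hcA⟩ hlower
    (by rw [add_sub_cancel, hpat.zero_up])
  obtain ⟨hτB, hexitB⟩ := B.eq_τ_of_eqOn_arc hqB ⟨sub_pos.2 hpat.sub_lt, hcB⟩ hupper
    (by rw [sub_sub_cancel, hend]; exact neg_eq_zero.2 hpat.zero_up)
  refine ⟨⟨by linarith, ?_⟩, by linarith, fun t ht => ?_⟩
  · rw [← hexitA, ← hexitB, add_sub_cancel, sub_sub_cancel, hend]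
    rfl
  · rcases le_total t c with h | h
    · have hRu : R (u (c - (c - t))) = B.arc (c - t) (ε, c, (u c).1) :=
        hupper ⟨sub_nonneg.2 h, by linarith [ht.1]⟩
      rw [closedOrbit_of_le h, ← hRu, sub_sub_cancel, R_R]
    · have hu' : u (c + (t - c)) = A.arc (t - c) (ε, c, (u c).1) :=
        hlower ⟨sub_nonneg.2 h, by linarith [ht.2]⟩
      rw [closedOrbit_of_ge h, ← hu', add_sub_cancel]

lemma eq_of_periodic_of_eqOn_Icc {α : Type*} {f g : ℝ → α} (hf : Function.Periodic f T)
    (hg : Function.Periodic g T) (hT : 0 < T) (heq : EqOn f g (Icc (b - T) b)) : f = g := by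
  have hpair : Function.Periodic (fun t => (f t, g t)) T := fun t => Prod.ext (hf t) (hg t)
  ext t
  obtain ⟨s, hs, hst⟩ := hpair.exists_mem_Ioc hT t (b - T)
  rw [sub_add_cancel] at hs
  obtain ⟨hf', hg'⟩ := Prod.mk.inj hst
  rw [hf', hg', heq ⟨hs.1.le, hs.2⟩]

lemma Closes.isIsolated {b : ℝ × ℝ} {w : ℝ → Plane} (hcl : Closes A B (ε, b)) (hD : IsOpen D)
    (hDR : ∀ z ∈ D, R z ∈ D) (hqA : (ε, b) ∈ Metric.ball (0, θ₀, x₀) A.r)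
    (hqB : (ε, b) ∈ Metric.ball (0, θ₀, x₀) B.r)
    (huniq : ∀ᶠ b' in 𝓝 b, Closes A B (ε, b') → b' = b)
    (hXp : ContDiffOn ℝ 1 (Function.uncurry (slice hp ε)) (univ ×ˢ D))
    (hXm : ContDiffOn ℝ 1 (Function.uncurry (slice hm ε)) (univ ×ˢ D))
    (hw : IsCrossingCycle (reflectField (slice hp ε)) (slice hm ε) D (2 * σ) w b.1
      (b.1 + A.τ (ε, b)))
    (hcr : IsCrossing (reflectField (slice hp ε)) (slice hm ε) w)
    (heq : EqOn w (closedOrbit A B (ε, b))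
      (Icc (b.1 + A.τ (ε, b) - 2 * σ) (b.1 + A.τ (ε, b)))) :
    IsIsolated (reflectField (slice hp ε)) (slice hm ε) D (2 * σ) w := by
  have hXR : ContDiffOn ℝ 1 (Function.uncurry (reflectField (slice hp ε))) (univ ×ˢ D) :=
    contDiffOn_reflectField hDR hXp
  have hpat := hw.isCrossingPattern
  have hstart : w b.1 = (b.2, 0) := (heq ⟨hpat.sub_lt.le, hpat.lt.le⟩).trans closedOrbit_start
  obtain ⟨ρ, hρ, hball⟩ := Metric.eventually_nhds_iff_ball.1 <| huniq.and <|
    ((Continuous.prodMk_right ε).continuousAt.eventually (Metric.isOpen_ball.mem_nhds hqA)).and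
      ((Continuous.prodMk_right ε).continuousAt.eventually (Metric.isOpen_ball.mem_nhds hqB))
  set m := min (σ + A.η - A.τ (ε, b)) (σ + B.η - B.τ (ε, b))
  have hm0 : 0 < m := lt_min (sub_pos.2 (A.τ_mem hqA).2) (sub_pos.2 (B.τ_mem hqB).2)
  obtain ⟨δ, hδ, hnear⟩ := hw.exists_isCrossingPattern hD hXR hXm hcr
    (lt_min hρ (half_pos hm0))
  refine ⟨δ, hδ, fun u hu hex => ?_⟩
  obtain ⟨c, c', hc, hc', hdist, hpatu⟩ := hnear u hu hex
  rw [lt_min_iff] at hc hc' hdist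
  obtain ⟨huniqu, hquA, hquB⟩ := hball (c, (u c).1)
    (max_lt hc.1 ((le_max_left _ _).trans_lt (hstart ▸ hdist.1)))
  have hcm := abs_lt.1 hc.2
  have hcm' := abs_lt.1 hc'.2
  have hmA : m ≤ σ + A.η - A.τ (ε, b) := min_le_left _ _
  have hmB : m ≤ σ + B.η - B.τ (ε, b) := min_le_right _ _
  obtain ⟨hclu, hcu, hequ⟩ := hpatu.closes_and_eqOn hD hDR hXp hXm hu hquA hquB
    (by linarith) (by linarith [hcl.1])
  have hqu := huniqu hclu
  rw [hqu] at hcu hequ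
  obtain rfl : c = b.1 := congrArg Prod.fst hqu
  subst hcu
  exact eq_of_periodic_of_eqOn_Icc hu.periodic hw.isPeriodicSolution.periodic
    hpat.period_pos (hequ.trans heq.symm)

theorem Closes.exists_isolated_isPeriodicSolution {b : ℝ × ℝ} (hcl : Closes A B (ε, b))
    (hD : IsOpen D) (hDR : ∀ z ∈ D, R z ∈ D) (hqA : (ε, b) ∈ Metric.ball (0, θ₀, x₀) A.r)
    (hqB : (ε, b) ∈ Metric.ball (0, θ₀, x₀) B.r)
    (huniq : ∀ᶠ b' in 𝓝 b, Closes A B (ε, b') → b' = b)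
    (hXp : ContDiffOn ℝ 1 (Function.uncurry (slice hp ε)) (univ ×ˢ D))
    (hXm : ContDiffOn ℝ 1 (Function.uncurry (slice hm ε)) (univ ×ˢ D))
    (hperp : ∀ t, ∀ z ∈ D,
      reflectField (slice hp ε) (t + 2 * σ) z = reflectField (slice hp ε) t z)
    (hperm : ∀ t, ∀ z ∈ D, slice hm ε (t + 2 * σ) z = slice hm ε t z) :
    ∃ w, w b.1 = (b.2, 0) ∧
      IsPeriodicSolution (reflectField (slice hp ε)) (slice hm ε) D (2 * σ) w ∧
      IsCrossing (reflectField (slice hp ε)) (slice hm ε) w ∧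
      IsIsolated (reflectField (slice hp ε)) (slice hm ε) D (2 * σ) w := by
  obtain ⟨w, hw, heq⟩ := hcl.exists_isCrossingCycle hDR hqA hqB
    (contDiffOn_reflectField hDR hXp).continuousOn hXm.continuousOn hperp hperm
  have hpat := hw.isCrossingPattern
  have hcr := hw.isCrossing hperp hperm
  exact ⟨w, (heq ⟨hpat.sub_lt.le, hpat.lt.le⟩).trans closedOrbit_start, hw.isPeriodicSolution, hcr,
    hcl.isIsolated hD hDR hqA hqB huniq hXp hXm hw hcr heq⟩

end IsolatedPeriodicSolution

lemma IsPerturbation.contDiffOn_slice {h : ℝ × Plane × ℝ → Plane} {F : Plane → Plane}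
    {g : ℝ → Plane → Plane} {D : Set Plane} {ε₀ ε : ℝ} (hp : IsPerturbation h F g D ε₀)
    (hε : ε ∈ Ioo (-ε₀) ε₀) : ContDiffOn ℝ 2 (Function.uncurry (slice h ε)) (univ ×ˢ D) :=
  hp.contDiffOn.comp (f := fun p : ℝ × Plane => (p.1, p.2, ε)) (by fun_prop)
    fun _ he => ⟨mem_univ _, he.2, hε⟩

end TwoFold

end

theorem theoremA_general (D : Set Plane) (hD : IsOpen D) (hDR : ∀ z ∈ D, R z ∈ D)
    (F : Plane → Plane) (hF : ContDiffOn ℝ 2 F D) (xσ σ : ℝ) (hret : IsTransverseReturn F D xσ σ)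
    (hσ' : deriv (halfReturnTime F D) xσ ≠ 0) (ε₀ : ℝ) (hε₀ : 0 < ε₀)
    (Gp Gm : ℝ → Plane → Plane)
    (hGp : ContDiffOn ℝ 2 (fun p : ℝ × Plane => Gp p.1 p.2) (univ ×ˢ D))
    (hGm : ContDiffOn ℝ 2 (fun p : ℝ × Plane => Gm p.1 p.2) (univ ×ˢ D))
    (Hp Hm : ℝ → Plane → ℝ → Plane)
    (hHp : ContDiffOn ℝ 2 (fun p : ℝ × Plane × ℝ => Hp p.1 p.2.1 p.2.2)
      (univ ×ˢ D ×ˢ Ioo (-ε₀) ε₀))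
    (hHm : ContDiffOn ℝ 2 (fun p : ℝ × Plane × ℝ => Hm p.1 p.2.1 p.2.2)
      (univ ×ˢ D ×ˢ Ioo (-ε₀) ε₀))
    (hGp_per : ∀ t, ∀ z ∈ D, Gp (t + 2 * σ) z = Gp t z)
    (hGm_per : ∀ t, ∀ z ∈ D, Gm (t + 2 * σ) z = Gm t z)
    (hHp_per : ∀ t, ∀ z ∈ D, ∀ ε ∈ Ioo (-ε₀) ε₀, Hp (t + 2 * σ) z ε = Hp t z ε)
    (hHm_per : ∀ t, ∀ z ∈ D, ∀ ε ∈ Ioo (-ε₀) ε₀, Hm (t + 2 * σ) z ε = Hm t z ε)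
    (θstar : ℝ) (hM : melnikov F D Gp Gm θstar xσ = 0)
    (hM' : deriv (fun θ : ℝ => melnikov F D Gp Gm θ xσ) θstar ≠ 0) :
    ∃ C > 0, ∃ ε₁ > 0, ε₁ ≤ ε₀ ∧ ∀ ε ∈ Ioo 0 ε₁,
      ∃ (θ x : ℝ) (w : ℝ → Plane),
        |θ - θstar| ≤ C * ε ∧ |x - xσ| ≤ C * ε ∧ w θ = (x, 0) ∧
        IsPeriodicSolution (perturbedField (upperField F) Gp Hp ε) (perturbedField F Gm Hm ε)
          D (2 * σ) w ∧
        IsCrossing (perturbedField (upperField F) Gp Hp ε) (perturbedField F Gm Hm ε) w ∧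
        IsIsolated (perturbedField (upperField F) Gp Hp ε) (perturbedField F Gm Hm ε)
          D (2 * σ) w := by
  have hA := isPerturbation_perturbedField hD hε₀ hF hGm hHm
  have hB := isPerturbation_perturbedField hD hε₀ hF (contDiffOn_reflectField hDR hGp)
    (contDiffOn_reflectFamily hDR hHp)
  obtain ⟨A⟩ := hret.nonempty_returnArc hA (κ := 1) (θ₀ := θstar)
  obtain ⟨B⟩ := hret.nonempty_returnArc hB (κ := -1) (θ₀ := θstar)
  obtain ⟨C, hC, ε₁, hε₁, hle, hcloses⟩ := exists_isolated_closes A B hA hB hret hσ' hM hM'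
  refine ⟨C, hC, ε₁, hε₁, hle, fun ε hε => ?_⟩
  have hε' : ε ∈ Ioo (-ε₀) ε₀ := ⟨by linarith [hε.1], hε.2.trans_le hle⟩
  obtain ⟨b, hb, hqA, hqB, hcl, huniq⟩ := hcloses ε hε
  have hupper : perturbedField (upperField F) Gp Hp ε = reflectField (slice (fun e =>
      perturbedField F (reflectField Gp) (reflectFamily Hp) e.2.2 e.1 e.2.1) ε) :=
    funext₂ (perturbedField_upperField ε)
  obtain ⟨w, hw, hsol⟩ := hcl.exists_isolated_isPeriodicSolution hD hDR hqA hqB huniq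
    ((hB.contDiffOn_slice hε').of_le one_le_two) ((hA.contDiffOn_slice hε').of_le one_le_two)
    (hupper ▸ perturbedField_add_period hε' hGp_per hHp_per)
    (perturbedField_add_period hε' hGm_per hHm_per)
  rw [hupper]
  exact ⟨b.1, b.2, w, (norm_fst_le _).trans hb, (norm_snd_le _).trans hb, hw, hsol⟩

theorem theoremA
    (D : Set Plane) (hD_open : IsOpen D) (hD_bdd : Bornology.IsBounded D)
    (hD_symm : ∀ z ∈ D, R z ∈ D)
    (F : Plane → Plane) (hF : ContDiffOn ℝ 2 F D)
    (xi xv : ℝ) (h1 : FoldCondition F D xi xv) (h2 : ReturnCondition F D xi xv)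
    (xσ σ : ℝ) (hxσ : xσ ∈ Ioo xi xv) (hσ : halfReturnTime F D xσ = σ)
    (hσ' : deriv (halfReturnTime F D) xσ ≠ 0)
    (ε₀ : ℝ) (hε₀ : 0 < ε₀)
    (Gp Gm : ℝ → Plane → Plane)
    (hGp : ContDiffOn ℝ ∞ (fun p : ℝ × Plane => Gp p.1 p.2) (univ ×ˢ D))
    (hGm : ContDiffOn ℝ ∞ (fun p : ℝ × Plane => Gm p.1 p.2) (univ ×ˢ D))
    (Hp Hm : ℝ → Plane → ℝ → Plane)
    (hHp : ContDiffOn ℝ ∞ (fun p : ℝ × Plane × ℝ => Hp p.1 p.2.1 p.2.2)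
      (univ ×ˢ D ×ˢ Ioo (-ε₀) ε₀))
    (hHm : ContDiffOn ℝ ∞ (fun p : ℝ × Plane × ℝ => Hm p.1 p.2.1 p.2.2)
      (univ ×ˢ D ×ˢ Ioo (-ε₀) ε₀))
    (hGp_per : ∀ t, ∀ z ∈ D, Gp (t + 2 * σ) z = Gp t z)
    (hGm_per : ∀ t, ∀ z ∈ D, Gm (t + 2 * σ) z = Gm t z)
    (hHp_per : ∀ t, ∀ z ∈ D, ∀ ε ∈ Ioo (-ε₀) ε₀, Hp (t + 2 * σ) z ε = Hp t z ε)
    (hHm_per : ∀ t, ∀ z ∈ D, ∀ ε ∈ Ioo (-ε₀) ε₀, Hm (t + 2 * σ) z ε = Hm t z ε)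
    (θstar : ℝ) (hM : melnikov F D Gp Gm θstar xσ = 0)
    (hM' : deriv (fun θ : ℝ => melnikov F D Gp Gm θ xσ) θstar ≠ 0) :
    ∃ C > 0, ∃ ε₁ > 0, ε₁ ≤ ε₀ ∧ ∀ ε ∈ Ioo 0 ε₁,
      ∃ (θ x : ℝ) (w : ℝ → Plane),
        |θ - θstar| ≤ C * ε ∧ |x - xσ| ≤ C * ε ∧ w θ = (x, 0) ∧
        IsPeriodicSolution (perturbedField (upperField F) Gp Hp ε) (perturbedField F Gm Hm ε)
          D (2 * σ) w ∧
        IsCrossing (perturbedField (upperField F) Gp Hp ε) (perturbedField F Gm Hm ε) w ∧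
        IsIsolated (perturbedField (upperField F) Gp Hp ε) (perturbedField F Gm Hm ε)
          D (2 * σ) w := by
  have hret := h2.isTransverseReturn hD_open (hF.of_le one_le_two) ⟨hxσ.1, hxσ.2.le⟩
    (h1.ne_zero xσ hxσ)
  exact theoremA_general D hD_open hD_symm F hF xσ σ (hσ ▸ hret) hσ' ε₀ hε₀ Gp Gm
    (hGp.of_le (by norm_cast)) (hGm.of_le (by norm_cast)) Hp Hm
    (hHp.of_le (by norm_cast)) (hHm.of_le (by norm_cast))
    hGp_per hGm_per hHp_per hHm_per θstar hM hM'
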